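/- Let $R=\mathbb{C}[s_0,s_1]\otimes\mathbb{C}[t_0,t_1]\otimes\mathbb{C}[u_0,u_1]$. A trilinear birational map is a rational map $\phi=(f_0:f_1:f_2:f_3):(\mathbb{P}^1_{\mathbb{C}})^3\dashrightarrow\mathbb{P}^3_{\mathbb{C}}$, with $f_i\in R$ trilinear and without a common factor, that admits an inverse $\phi^{-1}=(\sigma_0:\sigma_1)\times(\tau_0:\tau_1)\times(\upsilon_0:\upsilon_1)$, where each pair consists of two homogeneous polynomials in $x_0,\dots,x_3$ of the same degree without a common factor; its type is $(\deg\sigma_j,\deg\tau_j,\deg\upsilon_j)$. The congruence $S\subset\mathbb{P}^5_{\mathbb{C}}$ is the Zariski closure of the set of Plücker points of the $s$-lines of $\phi$, i.e. of the points $[\phi((1:0),t,u)\wedge\phi((0:1),t,u)]$ with nonzero wedge product, and $T$, $U$ are defined in the same way by the $t$-lines and the $u$-lines. A line congruence is an (irreducible) algebraic surface $X$ in the Klein quadric $Q\subset\mathbb{P}^5_{\mathbb{C}}$ of lines of $\mathbb{P}^3_{\mathbb{C}}$; it is linear if it is contained in a $3$-plane of $\mathbb{P}^5_{\mathbb{C}}$.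 An algebraic set $V\subset\mathbb{P}^3_{\mathbb{C}}$ is focal for $X$ if it meets every line of $X$ and no proper algebraic subset of $V$ does; a focal line is a line that is focal. Proposition. Let $\phi$ be a general trilinear birational map of type $(1,2,2)$; that is, the following holds for all $\phi$ in a nonempty, relatively Zariski open and dense subset of the set of (coefficient tuples of) trilinear birational maps of type $(1,2,2)$. There are lines $a,b,c,x,y\subset\mathbb{P}^3_{\mathbb{C}}$ such that 1. $x,y$ are skew; 2. $a,b,c$ are pairwise skew; 3. each of $a,b,c$ intersects both $x$ and $y$; and such that - the focal lines of $S$ are exactly $x$ and $y$; - the focal lines of $T$ are exactly $a$ and $c$; - the focal lines of $U$ are exactly $a$ and $b$. The lines $a,b,c$ are unique, and $x,y$ are unique up to interchanging $x$ and $y$. Moreover, $S$, $T$ and $U$ are linear line congruences. -/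

import Mathlib

open scoped LinearAlgebra.Projectivization

noncomputable section

namespace TrilinearLC

/-! ### Projective algebraic sets -/

/-- Complex projective space with homogeneous coordinates indexed by `Fin n`
(so its dimension is `n - 1`). -/
abbrev Proj (n : ℕ) : Type := ℙ ℂ (Fin n → ℂ)

/-- `Z` is a Zariski closed subset of projective space: the common zero set of a family of
homogeneous polynomials. -/
def IsProjClosed {n : ℕ} (Z : Set (Proj n)) : Prop :=
  ∃ F : Set (MvPolynomial (Fin n) ℂ),
    (∀ f ∈ F, ∃ d : ℕ, f.IsHomogeneous d) ∧
    Z = {x | ∀ f ∈ F, MvPolynomial.eval x.rep f = 0}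

/-- The Zariski closure of a subset of projective space. -/
def projClosure {n : ℕ} (Z : Set (Proj n)) : Set (Proj n) :=
  {x | ∀ (f : MvPolynomial (Fin n) ℂ) (d : ℕ), f.IsHomogeneous d →
    (∀ z ∈ Z, MvPolynomial.eval z.rep f = 0) → MvPolynomial.eval x.rep f = 0}

/-- The affine cone over a subset of projective space (it contains the origin). -/
def affineCone {n : ℕ} (Z : Set (Proj n)) : Set (Fin n → ℂ) :=
  {v | ∀ hv : v ≠ 0, Projectivization.mk ℂ v hv ∈ Z}

/-- The homogeneous vanishing ideal of a subset of projective space. -/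
def homogeneousIdeal {n : ℕ} (Z : Set (Proj n)) : Ideal (MvPolynomial (Fin n) ℂ) :=
  MvPolynomial.vanishingIdeal ℂ (affineCone Z)

/-- An irreducible Zariski closed subset of projective space, of dimension 2: its homogeneous
coordinate ring is a domain of Krull dimension `2 + 1`. -/
def IsProjSurface {n : ℕ} (Z : Set (Proj n)) : Prop :=
  IsProjClosed Z ∧ (homogeneousIdeal Z).IsPrime ∧
    ringKrullDim (MvPolynomial (Fin n) ℂ ⧸ homogeneousIdeal Z) = 3

/-! ### Lines in projective 3-space, Plücker coordinates -/

/-- A line in `ℙ³`: a two-dimensional linear subspace of `ℂ⁴`. -/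
abbrev Line : Type :=
  {L : Submodule ℂ (Fin 4 → ℂ) // Module.finrank ℂ L = 2}

/-- The set of points of `ℙ³` on a line. -/
def Line.points (l : Line) : Set (Proj 4) := {p | p.submodule ≤ l.1}

/-- Two lines intersect if they have a common point. -/
def Meet (l m : Line) : Prop := (l.points ∩ m.points).Nonempty

/-- Two lines are skew if they have no common point. -/
def Skew (l m : Line) : Prop := Disjoint l.points m.points

/-- The Plücker vector `(c₀₁, c₀₂, c₀₃, c₂₃, c₃₁, c₁₂)` of `p ∧ q`. -/
def wedge (p q : Fin 4 → ℂ) : Fin 6 → ℂ :=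
  ![p 0 * q 1 - p 1 * q 0, p 0 * q 2 - p 2 * q 0, p 0 * q 3 - p 3 * q 0,
    p 2 * q 3 - p 3 * q 2, p 3 * q 1 - p 1 * q 3, p 1 * q 2 - p 2 * q 1]

/-- The Klein quadric in `ℙ⁵`, whose points are the lines of `ℙ³`: the set of all classes of
nonzero vectors `p ∧ q`. -/
def kleinQuadric : Set (Proj 6) :=
  {x | ∃ (p q : Fin 4 → ℂ) (h : wedge p q ≠ 0), x = Projectivization.mk ℂ (wedge p q) h}

/-! ### Line congruences and their focal varieties -/

/-- A line congruence: a surface contained in the Klein quadric. -/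
def IsLineCongruence (X : Set (Proj 6)) : Prop :=
  IsProjSurface X ∧ X ⊆ kleinQuadric

/-- A linear congruence: a line congruence contained in a 3-plane of `ℙ⁵`. -/
def IsLinearCongruence (X : Set (Proj 6)) : Prop :=
  IsLineCongruence X ∧
    ∃ W : Submodule ℂ (Fin 6 → ℂ), Module.finrank ℂ W = 4 ∧ ∀ x ∈ X, x.submodule ≤ W

/-- `V` meets every line of `X`. A line of `X` is the line spanned by two vectors `p`, `q`
with `p ∧ q ≠ 0` whose Plücker point belongs to `X`. -/
def MeetsEveryLine (V : Set (Proj 4)) (X : Set (Proj 6)) : Prop :=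
  ∀ (p q : Fin 4 → ℂ) (h : wedge p q ≠ 0), Projectivization.mk ℂ (wedge p q) h ∈ X →
    ∃ v ∈ V, v.submodule ≤ Submodule.span ℂ {p, q}

/-- `V` is a focal variety of `X`: an algebraic set that meets every line of `X` and is
minimal among the algebraic sets with this property. -/
def IsFocalVariety (V : Set (Proj 4)) (X : Set (Proj 6)) : Prop :=
  IsProjClosed V ∧ MeetsEveryLine V X ∧
    ∀ W : Set (Proj 4), IsProjClosed W → W ⊆ V → MeetsEveryLine W X → W = V

/-- The set of focal lines of `X`. -/
def focalLines (X : Set (Proj 6)) : Set Line := {l | IsFocalVariety l.points X}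

/-! ### Trilinear birational maps -/

/-- Four trilinear forms in `(s, t, u)`, given by coefficients: the entry at `(i, j, k, l)` is
the coefficient of `s_j t_k u_l` in `f_i`. -/
abbrev Tuple : Type := Fin 4 × Fin 2 × Fin 2 × Fin 2 → ℂ

/-- The trilinear polynomial `f_i`; the variables `X (0, j)`, `X (1, k)`, `X (2, l)` are
`s_j`, `t_k`, `u_l`. -/
def Tuple.poly (Φ : Tuple) (i : Fin 4) : MvPolynomial (Fin 3 × Fin 2) ℂ :=
  ∑ j : Fin 2, ∑ k : Fin 2, ∑ l : Fin 2,
    MvPolynomial.C (Φ (i, j, k, l)) *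
      (MvPolynomial.X (0, j) * MvPolynomial.X (1, k) * MvPolynomial.X (2, l))

/-- The vector `(f_0, f_1, f_2, f_3)` at `(s, t, u) = (v 0, v 1, v 2)`. -/
def Tuple.value (Φ : Tuple) (v : Fin 3 → Fin 2 → ℂ) : Fin 4 → ℂ := fun i =>
  ∑ j : Fin 2, ∑ k : Fin 2, ∑ l : Fin 2, Φ (i, j, k, l) * (v 0 j * v 1 k * v 2 l)

/-- `f_0, …, f_3` have no common factor (in particular they do not all vanish), so that they
define a trilinear rational map `(ℙ¹)³ ⇢ ℙ³`. -/
def Tuple.IsTrilinearMap (Φ : Tuple) : Prop :=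
  ∀ g : MvPolynomial (Fin 3 × Fin 2) ℂ, (∀ i, g ∣ Φ.poly i) → IsUnit g

/-- The rational map `ℙ³ ⇢ (ℙ¹)³` whose `m`-th factor is `(ρ m 0 : ρ m 1)`, two forms of degree
`d m` without common factor, is inverse to the map given by `Φ`: both compositions are defined
and equal to the identity as rational maps. -/
structure Tuple.IsInverse (Φ : Tuple) (ρ : Fin 3 → Fin 2 → MvPolynomial (Fin 4) ℂ)
    (d : Fin 3 → ℕ) : Prop where
  homogeneous : ∀ m j, (ρ m j).IsHomogeneous (d m)
  coprime : ∀ m, IsRelPrime (ρ m 0) (ρ m 1)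
  left_defined : ∀ m, ∃ j, MvPolynomial.aeval Φ.poly (ρ m j) ≠ 0
  left_inv : ∀ m,
    MvPolynomial.aeval Φ.poly (ρ m 0) * MvPolynomial.X (m, 1) =
      MvPolynomial.aeval Φ.poly (ρ m 1) * MvPolynomial.X (m, 0)
  right_defined : ∃ i, MvPolynomial.aeval (fun mj : Fin 3 × Fin 2 => ρ mj.1 mj.2) (Φ.poly i) ≠ 0
  right_inv : ∀ i i',
    MvPolynomial.aeval (fun mj : Fin 3 × Fin 2 => ρ mj.1 mj.2) (Φ.poly i) * MvPolynomial.X i' =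
      MvPolynomial.aeval (fun mj : Fin 3 × Fin 2 => ρ mj.1 mj.2) (Φ.poly i') * MvPolynomial.X i

/-- The tuples that define a trilinear birational map of type `d`. -/
def birationalOfType (d : Fin 3 → ℕ) : Set Tuple :=
  {Φ | Φ.IsTrilinearMap ∧ ∃ ρ, Φ.IsInverse ρ d}

/-- The parametric lines in the direction of the `m`-th factor, as points of the Klein quadric:
the other two factors are fixed, and the line is spanned by the values at `(1 : 0)` and
`(0 : 1)` in the `m`-th factor. -/
def Tuple.parametricLines (Φ : Tuple) (m : Fin 3) : Set (Proj 6) :=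
  {x | ∃ (v : Fin 3 → Fin 2 → ℂ)
    (h : wedge (Φ.value (Function.update v m ![1, 0]))
      (Φ.value (Function.update v m ![0, 1])) ≠ 0), x = Projectivization.mk ℂ _ h}

/-- The parametric line congruences: `S`, `T`, `U` for `m = 0, 1, 2`. -/
def Tuple.congruence (Φ : Tuple) (m : Fin 3) : Set (Proj 6) :=
  projClosure (Φ.parametricLines m)

/-- `P` holds for a general point of `Y`: it holds at all points of some nonempty relatively
Zariski open subset of `Y` that is Zariski dense in `Y`. -/
def HoldsForGeneral {ι : Type} (Y : Set (ι → ℂ)) (P : (ι → ℂ) → Prop) : Prop :=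
  ∃ (I : Set (MvPolynomial ι ℂ)) (G : Set (ι → ℂ)),
    G = {y ∈ Y | ∃ q ∈ I, MvPolynomial.eval y q ≠ 0} ∧ G.Nonempty ∧
    (∀ q : MvPolynomial ι ℂ, (∀ y ∈ G, MvPolynomial.eval y q = 0) →
      ∀ y ∈ Y, MvPolynomial.eval y q = 0) ∧
    ∀ y ∈ G, P y

/-- The incidence and focal conditions on the lines `a, b, c, x, y`. -/
structure FocalConfiguration (Φ : Tuple) (a b c x y : Line) : Prop where
  skew_xy : Skew x y
  skew_ab : Skew a b
  skew_ac : Skew a c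
  skew_bc : Skew b c
  meet_x : Meet a x ∧ Meet b x ∧ Meet c x
  meet_y : Meet a y ∧ Meet b y ∧ Meet c y
  focal_S : focalLines (Φ.congruence 0) = {x, y}
  focal_T : focalLines (Φ.congruence 1) = {a, c}
  focal_U : focalLines (Φ.congruence 2) = {a, b}

end TrilinearLC

end

/-!
# Focal lines of general trilinear birational maps of type `(1, 2, 2)`

A general map of type `(1, 2, 2)` is, in suitable coordinates of `ℙ³` and of the three factors and
with respect to a basis `A` of `ℂ⁴`, the map `canon`,

  `s₀ t₀ (u₀ - u₁) A₀ + s₀ G A₁ + s₁ t₁ (u₀ - u₁) A₂ + s₁ G A₃`,  where `G = u₀ t₁ - t₀ u₁`.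

Its `s`-lines join a point of the line `x = ⟨A₀, A₁⟩` to a point of `y = ⟨A₂, A₃⟩`, and these points
are arbitrary. In the same way the `t`-lines are the lines meeting `a = ⟨A₀, A₂⟩` and
`c = ⟨A₀ + A₁, A₂ + A₃⟩`, and the `u`-lines are the lines meeting `a` and `b = ⟨A₁, A₃⟩`. The
congruence `join e` of the lines meeting two skew lines is a Segre quadric `ℙ¹ × ℙ¹` in a 3-plane of
`ℙ⁵`: its ideal is the kernel of `joinHom`, hence prime, and the dimension is computed from an
integral extension (`isLinearCongruence_join`). Its focal lines are the two given lines
(`focalLines_join`): a third line meeting all lines of the congruence would span at least a plane.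

It remains to see that the maps in normal form (`IsGeneralForm`), which are birational of type
`(1, 2, 2)` (`IsGeneralForm.mem_birationalOfType`), contain a dense open subset of all maps of this
type. Since the first factor of the inverse is linear, a map of type `(1, 2, 2)` has the components
`P`, `s₀ g`, `R`, `s₁ g` up to a coordinate change of `ℙ³` (`exists_baseData`). A count of dimensions
gives, for general `s`, a `2 × 2` matrix annihilated by `P(s)`, `g` and `R(s)`; it has rank one, as the
map is generically injective, so that the restriction to `{s} × ℙ¹ × ℙ¹` has a base point. The main
point is that this base point can be chosen independently of `s` (`BaseData.exists_base`): if the base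
points of `P` and `R` on the curve `g = 0` move with `s`, then `P`, `R` and `g` factor in such a way
that one of the quadratic factors of the inverse is given by linear forms. Hence all maps of type
`(1, 2, 2)` belong to the irreducible family `baseValue`. Three polynomials in the coefficients
(`genericity`), none of which vanishes identically on the family, detect the normal form
(`isGeneralForm_of_genericity`), and the general maps are dense since every parameter of the family is
joined by a line to a parameter with nonvanishing `genericity` (`eval_eq_zero_of_general`).
-/

noncomputable section

namespace TrilinearLC

/-! ### Krull dimension of integral extensions -/

lemma ringKrullDim_eq_of_isIntegral {R S : Type*} [CommRing R] [CommRing S] [IsDomain S]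
    [Algebra R S] [Algebra.IsIntegral R S] (hinj : Function.Injective (algebraMap R S)) :
    ringKrullDim S = ringKrullDim R := by
  apply le_antisymm
  · refine Order.krullDim_le_of_strictMono (PrimeSpectrum.comap (algebraMap R S)) ?_
    intro I J h
    exact Ideal.IsIntegral.comap_lt_comap (I := I.asIdeal) (J := J.asIdeal) h
  · refine iSup_le fun l => ?_
    have hker : RingHom.ker (algebraMap R S) ≤ l.head.asIdeal := by
      rw [(RingHom.injective_iff_ker_eq_bot _).1 hinj]; exact bot_le
    obtain ⟨P, hP, hPl⟩ := Ideal.exists_ideal_over_prime_of_isIntegral_of_isDomain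
      (S := S) l.head.asIdeal hker
    have : P.LiesOver l.head.asIdeal := ⟨hPl.symm⟩
    obtain ⟨L, hL, -⟩ := Ideal.exists_ltSeries_of_hasGoingUp (S := S) l P
    rw [← hL]
    exact Order.LTSeries.length_le_krullDim L

/-! ### The congruence of lines joining two skew lines -/

/-- The Plücker vectors `e i ∧ e (2 + j)` for `i, j ∈ {0, 1}`. -/
def joinVec (e : Fin 4 → Fin 4 → ℂ) (i j : Fin 2) : Fin 6 → ℂ :=
  wedge (e (![0, 1] i)) (e (![2, 3] j))

/-- The Plücker vector of the line joining the point of `⟨e 0, e 1⟩` with coordinates `p` and the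
point of `⟨e 2, e 3⟩` with coordinates `q`. -/
def joinPt (e : Fin 4 → Fin 4 → ℂ) (p q : Fin 2 → ℂ) : Fin 6 → ℂ :=
  wedge (p 0 • e 0 + p 1 • e 1) (q 0 • e 2 + q 1 • e 3)

/-- The lines joining a point of `⟨e 0, e 1⟩` and a point of `⟨e 2, e 3⟩`. -/
def join (e : Fin 4 → Fin 4 → ℂ) : Set (Proj 6) :=
  {x | ∃ (p q : Fin 2 → ℂ) (h : joinPt e p q ≠ 0), x = Projectivization.mk ℂ (joinPt e p q) h}

lemma joinPt_eq (e : Fin 4 → Fin 4 → ℂ) (p q : Fin 2 → ℂ) :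
    joinPt e p q = ∑ i, ∑ j, (p i * q j) • joinVec e i j := by
  ext k
  fin_cases k <;> simp [joinPt, joinVec, wedge, Fin.sum_univ_two] <;> ring

lemma joinPt_apply (e : Fin 4 → Fin 4 → ℂ) (p q : Fin 2 → ℂ) (k : Fin 6) :
    joinPt e p q k = ∑ i, ∑ j, (p i * q j) * joinVec e i j k := by
  simp [joinPt_eq, Finset.sum_apply]

lemma smul_joinPt (e : Fin 4 → Fin 4 → ℂ) (p q : Fin 2 → ℂ) (c : ℂ) :
    joinPt e (c • p) q = c • joinPt e p q := by
  simp only [joinPt_eq, Finset.smul_sum, smul_smul, Pi.smul_apply, smul_eq_mul, mul_assoc]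

/-- The determinant of four vectors of `ℂ⁴`. -/
def det4 (a b c d : Fin 4 → ℂ) : ℂ := (Matrix.of ![a, b, c, d]).det

lemma det4_eq (a b c d : Fin 4 → ℂ) : det4 a b c d =
    a 0 * (b 1 * (c 2 * d 3 - c 3 * d 2) - b 2 * (c 1 * d 3 - c 3 * d 1)
      + b 3 * (c 1 * d 2 - c 2 * d 1))
    - a 1 * (b 0 * (c 2 * d 3 - c 3 * d 2) - b 2 * (c 0 * d 3 - c 3 * d 0)
      + b 3 * (c 0 * d 2 - c 2 * d 0))
    + a 2 * (b 0 * (c 1 * d 3 - c 3 * d 1) - b 1 * (c 0 * d 3 - c 3 * d 0)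
      + b 3 * (c 0 * d 1 - c 1 * d 0))
    - a 3 * (b 0 * (c 1 * d 2 - c 2 * d 1) - b 1 * (c 0 * d 2 - c 2 * d 0)
      + b 2 * (c 0 * d 1 - c 1 * d 0)) := by
  simp [det4, Fin.sum_univ_succ, Matrix.det_succ_row_zero, Fin.succAbove]
  ring

lemma det4_ne_zero {e : Fin 4 → Fin 4 → ℂ} (he : LinearIndependent ℂ e) :
    det4 (e 0) (e 1) (e 2) (e 3) ≠ 0 := by
  have h : ![e 0, e 1, e 2, e 3] = e := by ext i; fin_cases i <;> rfl
  rw [det4, h]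
  have := (Matrix.linearIndependent_rows_iff_isUnit (A := Matrix.of e)).1 he
  exact ((Matrix.isUnit_iff_isUnit_det _).1 this).ne_zero

/-- The polarity of the Klein quadric: the pairing of two Plücker vectors is a determinant. -/
lemma sum_hodge_wedge (a b c d : Fin 4 → ℂ) :
    ∑ k, (![wedge a b 3, wedge a b 4, wedge a b 5, wedge a b 0, wedge a b 1, wedge a b 2] :
      Fin 6 → ℂ) k * wedge c d k = det4 c d a b := by
  simp [Fin.sum_univ_succ, wedge, det4_eq]
  ring

lemma exists_joinVec_dual {e : Fin 4 → Fin 4 → ℂ} (he : LinearIndependent ℂ e) :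
    ∃ z : Fin 2 → Fin 2 → Fin 6 → ℂ, ∀ i j i' j',
      ∑ k, z i j k * joinVec e i' j' k = if i = i' ∧ j = j' then 1 else 0 := by
  have hD := det4_ne_zero he
  -- the complementary edges of the tetrahedron `e 0, e 1, e 2, e 3`
  let y : Fin 2 → Fin 2 → Fin 6 → ℂ :=
    ![![wedge (e 3) (e 1), wedge (e 1) (e 2)], ![wedge (e 0) (e 3), wedge (e 2) (e 0)]]
  refine ⟨fun i j k => (det4 (e 0) (e 1) (e 2) (e 3))⁻¹ * (![y i j 3, y i j 4, y i j 5, y i j 0,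
    y i j 1, y i j 2] : Fin 6 → ℂ) k, fun i j i' j' => ?_⟩
  simp only [mul_assoc, ← Finset.mul_sum]
  rw [inv_mul_eq_iff_eq_mul₀ hD]
  fin_cases i <;> fin_cases j <;>
  · simp only [y, joinVec, Fin.mk_zero, Fin.mk_one, Fin.isValue,
      Matrix.cons_val_zero, Matrix.cons_val_one, sum_hodge_wedge]
    fin_cases i' <;> fin_cases j' <;>
    · simp [det4_eq]
      try ring

section Dual

variable {e : Fin 4 → Fin 4 → ℂ} {z : Fin 2 → Fin 2 → Fin 6 → ℂ}

lemma sum_dual_joinPt (hz : ∀ i j i' j',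
      ∑ k, z i j k * joinVec e i' j' k = if i = i' ∧ j = j' then 1 else 0)
    (p q : Fin 2 → ℂ) (i j : Fin 2) :
    ∑ k, z i j k * joinPt e p q k = p i * q j := by
  have h : ∑ k, z i j k * joinPt e p q k =
      ∑ i', ∑ j', (p i' * q j') * ∑ k, z i j k * joinVec e i' j' k := by
    simp only [joinPt_apply, Finset.mul_sum]
    rw [Finset.sum_comm]
    refine Finset.sum_congr rfl fun i' _ => ?_
    rw [Finset.sum_comm]
    refine Finset.sum_congr rfl fun j' _ => Finset.sum_congr rfl fun k _ => by ring
  rw [h]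
  simp only [hz]
  fin_cases i <;> fin_cases j <;> simp [Fin.sum_univ_two]

lemma joinPt_ne_zero (he : LinearIndependent ℂ e) {p q : Fin 2 → ℂ} (hp : p ≠ 0) (hq : q ≠ 0) :
    joinPt e p q ≠ 0 := by
  obtain ⟨z, hz⟩ := exists_joinVec_dual he
  intro h
  obtain ⟨i, hi⟩ := Function.ne_iff.1 hp
  obtain ⟨j, hj⟩ := Function.ne_iff.1 hq
  have := sum_dual_joinPt hz p q i j
  rw [h] at this
  simp only [Pi.zero_apply, mul_zero, Finset.sum_const_zero] at this
  exact mul_ne_zero hi hj this.symm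

lemma linearIndependent_joinVec (he : LinearIndependent ℂ e) :
    LinearIndependent ℂ (fun ij : Fin 2 × Fin 2 => joinVec e ij.1 ij.2) := by
  obtain ⟨z, hz⟩ := exists_joinVec_dual he
  rw [Fintype.linearIndependent_iff]
  intro g hg ij
  have h1 : ∑ k, z ij.1 ij.2 k * (∑ i, g i • joinVec e i.1 i.2) k = 0 := by rw [hg]; simp
  have h2 : ∑ k, z ij.1 ij.2 k * (∑ i, g i • joinVec e i.1 i.2) k =
      ∑ i, g i * ∑ k, z ij.1 ij.2 k * joinVec e i.1 i.2 k := by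
    simp only [Finset.sum_apply, Pi.smul_apply, smul_eq_mul, Finset.mul_sum]
    rw [Finset.sum_comm]
    refine Finset.sum_congr rfl fun _ _ => Finset.sum_congr rfl fun _ _ => by ring
  rw [h2] at h1
  simp only [hz] at h1
  rw [← h1, Finset.sum_eq_single ij]
  · simp
  · rintro ⟨i, j⟩ _ hne
    have : ¬ (ij.1 = i ∧ ij.2 = j) := fun h => hne (Prod.ext h.1.symm h.2.symm)
    simp [this]
  · simp

end Dual

/-- A vanishing `2 × 2` determinant means that the matrix is a product `p i * q j`. -/
lemma exists_factor_of_det_eq_zero {a b c d : ℂ} (h : a * d = b * c) :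
    ∃ p q : Fin 2 → ℂ, a = p 0 * q 0 ∧ b = p 0 * q 1 ∧ c = p 1 * q 0 ∧ d = p 1 * q 1 := by
  by_cases ha : a = 0
  · subst ha
    rcases mul_eq_zero.1 ((zero_mul d).symm.trans h).symm with hb | hc
    · exact ⟨![0, 1], ![c, d], by simp [hb]⟩
    · exact ⟨![b, d], ![0, 1], by simp [hc]⟩
  · refine ⟨![1, c / a], ![a, b], by simp, by simp, ?_, ?_⟩
    · simp [div_mul_cancel₀ _ ha]
    · simp; field_simp; linear_combination h

/-! ### The vanishing ideal of the join -/

open MvPolynomial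

/-- The comorphism `ℂ[ℙ⁵] → ℂ[p, q]` of the parametrization `joinPt e`. -/
def joinHom (e : Fin 4 → Fin 4 → ℂ) :
    MvPolynomial (Fin 6) ℂ →ₐ[ℂ] MvPolynomial (Fin 2 × Fin 2) ℂ :=
  aeval fun k => ∑ i, ∑ j, C (joinVec e i j k) * (X (0, i) * X (1, j))

lemma eval_joinHom (e : Fin 4 → Fin 4 → ℂ) (v : Fin 2 × Fin 2 → ℂ)
    (f : MvPolynomial (Fin 6) ℂ) :
    eval v (joinHom e f) = eval (joinPt e (fun i => v (0, i)) (fun j => v (1, j))) f := by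
  have : ((aeval v).comp (joinHom e)) =
      aeval (joinPt e (fun i => v (0, i)) (fun j => v (1, j))) := by
    ext k
    simp only [joinHom, AlgHom.coe_comp, Function.comp_apply, aeval_X, joinPt_apply]
    simp only [map_sum, map_mul, aeval_X, algHom_C, Algebra.algebraMap_self, RingHom.id_apply]
    refine Finset.sum_congr rfl fun _ _ => Finset.sum_congr rfl fun _ _ => by ring
  have h := DFunLike.congr_fun this f
  simpa [coe_aeval_eq_eval] using h

lemma joinHom_eq_zero_iff (e : Fin 4 → Fin 4 → ℂ) (f : MvPolynomial (Fin 6) ℂ) :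
    joinHom e f = 0 ↔ ∀ p q, eval (joinPt e p q) f = 0 := by
  constructor
  · intro h p q
    have := eval_joinHom e (fun ij => ![p, q] ij.1 ij.2) f
    rw [h] at this
    simpa using this.symm
  · intro h
    refine MvPolynomial.funext fun v => ?_
    rw [eval_joinHom, h, map_zero]

lemma mem_affineCone_join (e : Fin 4 → Fin 4 → ℂ) (v : Fin 6 → ℂ) :
    v ∈ affineCone (join e) ↔ ∃ p q, v = joinPt e p q := by
  constructor
  · intro h
    by_cases hv : v = 0
    · exact ⟨0, 0, by simp [hv, joinPt_eq]⟩
    · obtain ⟨p, q, hpq, h⟩ := h hv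
      obtain ⟨a, ha⟩ := (Projectivization.mk_eq_mk_iff' ℂ _ _ _ _).1 h
      exact ⟨a • p, q, by rw [smul_joinPt, ha]⟩
  · rintro ⟨p, q, rfl⟩ hv
    exact ⟨p, q, hv, rfl⟩

lemma homogeneousIdeal_join (e : Fin 4 → Fin 4 → ℂ) :
    homogeneousIdeal (join e) = RingHom.ker (joinHom e) := by
  ext f
  rw [homogeneousIdeal, mem_vanishingIdeal_iff, RingHom.mem_ker, joinHom_eq_zero_iff]
  simp only [mem_affineCone_join]
  constructor
  · intro h p q
    exact h _ ⟨p, q, rfl⟩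
  · rintro h _ ⟨p, q, rfl⟩
    exact h p q

lemma mem_iff_rep_mem_affineCone {n : ℕ} (Z : Set (Proj n)) (x : Proj n) :
    x ∈ Z ↔ x.rep ∈ affineCone Z := by
  constructor
  · intro h hv
    rwa [Projectivization.mk_rep]
  · intro h
    simpa [Projectivization.mk_rep] using h x.rep_nonzero

lemma isHomogeneous_linear {n : ℕ} (c : Fin n → ℂ) :
    (∑ k, C (c k) * X k : MvPolynomial (Fin n) ℂ).IsHomogeneous 1 :=
  IsHomogeneous.sum _ _ _ fun k _ => by
    simpa using (isHomogeneous_C (Fin n) (c k)).mul (isHomogeneous_X ℂ k)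

lemma isProjClosed_join {e : Fin 4 → Fin 4 → ℂ} (he : LinearIndependent ℂ e) :
    IsProjClosed (join e) := by
  obtain ⟨z, hz⟩ := exists_joinVec_dual he
  let Z : Fin 2 → Fin 2 → MvPolynomial (Fin 6) ℂ := fun i j => ∑ k, C (z i j k) * X k
  have hZ : ∀ v i j, eval v (Z i j) = ∑ k, z i j k * v k := fun v i j => by simp [Z]
  have hZh : ∀ i j, (Z i j).IsHomogeneous 1 := fun i j => isHomogeneous_linear _
  refine ⟨insert (Z 0 0 * Z 1 1 - Z 0 1 * Z 1 0)
    (Set.range fun k => X k - ∑ i, ∑ j, C (joinVec e i j k) * Z i j), ?_, ?_⟩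
  · rintro f (rfl | ⟨k, rfl⟩)
    · exact ⟨2, ((hZh _ _).mul (hZh _ _)).sub ((hZh _ _).mul (hZh _ _))⟩
    · refine ⟨1, (isHomogeneous_X ℂ k).sub (IsHomogeneous.sum _ _ _ fun i _ =>
        IsHomogeneous.sum _ _ _ fun j _ => ?_)⟩
      simpa using (isHomogeneous_C (Fin 6) (joinVec e i j k)).mul (hZh i j)
  · ext x
    rw [mem_iff_rep_mem_affineCone, mem_affineCone_join]
    constructor
    · rintro ⟨p, q, h⟩
      rw [Set.mem_ofPred_eq, h]
      rintro f (rfl | ⟨k, rfl⟩)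
      · simp only [map_sub, map_mul, hZ, sum_dual_joinPt hz]; ring
      · simp only [map_sub, map_sum, map_mul, hZ, eval_X, eval_C, sum_dual_joinPt hz]
        rw [joinPt_apply]
        simp only [mul_comm, sub_self]
    · intro h
      have h1 := h _ (Set.mem_insert _ _)
      simp only [map_sub, map_mul, hZ, sub_eq_zero] at h1
      obtain ⟨p, q, h00, h01, h10, h11⟩ := exists_factor_of_det_eq_zero h1
      refine ⟨p, q, ?_⟩
      ext k
      have h2 := h _ (Set.mem_insert_of_mem _ ⟨k, rfl⟩)
      simp only [map_sub, map_sum, map_mul, hZ, eval_X, eval_C, sub_eq_zero] at h2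
      rw [h2, joinPt_apply]
      simp only [Fin.sum_univ_two, h00, h01, h10, h11]
      ring

/-! ### The join of two skew lines is a linear congruence -/

lemma exists_sq_add_mul_add_eq_zero {c : ℂ} (hc : c ≠ 0) (b a : ℂ) :
    ∃ r, c * r ^ 2 + b * r + a = 0 := by
  obtain ⟨s, hs⟩ := IsAlgClosed.exists_pow_nat_eq (discrim c b a) (n := 2) (by norm_num)
  obtain ⟨r, hr⟩ := exists_quadratic_eq_zero hc ⟨s, by rw [← hs, sq]⟩
  exact ⟨r, by rw [← hr]; ring⟩

/-- Every binary quadratic form over `ℂ` is a product of two linear forms. -/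
lemma exists_mul_eq_quadratic (a b c : ℂ) :
    ∃ p q : Fin 2 → ℂ, p 0 * q 0 = a ∧ p 1 * q 1 = c ∧ p 0 * q 1 + p 1 * q 0 = b := by
  by_cases hc : c = 0
  · exact ⟨![1, 0], ![a, b], by simp [hc]⟩
  · obtain ⟨r, hr⟩ := exists_sq_add_mul_add_eq_zero hc b a
    refine ⟨![-r, 1], ![b + r * c, c], ?_, by simp, ?_⟩
    · simp; linear_combination -hr
    · simp

lemma joinHom_linear {e : Fin 4 → Fin 4 → ℂ} {z : Fin 2 → Fin 2 → Fin 6 → ℂ}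
    (hz : ∀ i j i' j', ∑ k, z i j k * joinVec e i' j' k = if i = i' ∧ j = j' then 1 else 0)
    (i j : Fin 2) : joinHom e (∑ k, C (z i j k) * X k) = X (0, i) * X (1, j) := by
  refine MvPolynomial.funext fun v => ?_
  rw [eval_joinHom]
  simp [sum_dual_joinPt hz]

/-- The coordinate ring of a join has dimension 3: it is integral over the polynomial ring in
`p₀q₀`, `p₁q₁` and `p₀q₁ + p₁q₀`. -/
lemma ringKrullDim_eq_three_of_ker_eq {e : Fin 4 → Fin 4 → ℂ} (he : LinearIndependent ℂ e)
    {Q : Type*} [CommRing Q] [IsDomain Q] [Algebra ℂ Q] (π : MvPolynomial (Fin 6) ℂ →ₐ[ℂ] Q)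
    (hπ : Function.Surjective π) (hker : ∀ f, π f = 0 ↔ joinHom e f = 0) :
    ringKrullDim Q = 3 := by
  obtain ⟨z, hz⟩ := exists_joinVec_dual he
  let Z : Fin 2 → Fin 2 → MvPolynomial (Fin 6) ℂ := fun i j => ∑ k, C (z i j k) * X k
  have hZ : ∀ i j, joinHom e (Z i j) = X (0, i) * X (1, j) := fun i j => joinHom_linear hz i j
  have hπeq : ∀ f g, joinHom e f = joinHom e g → π f = π g := fun f g h => by
    rw [← sub_eq_zero, ← map_sub, hker, map_sub, h, sub_self]
  have hy : π (Z 0 0) * π (Z 1 1) = π (Z 0 1) * π (Z 1 0) := by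
    rw [← map_mul, ← map_mul]
    apply hπeq
    simp only [map_mul, hZ]; ring
  let g : MvPolynomial (Fin 3) ℂ →ₐ[ℂ] MvPolynomial (Fin 6) ℂ :=
    aeval ![Z 0 0, Z 1 1, Z 0 1 + Z 1 0]
  have hg0 : g (X 0) = Z 0 0 := by simp [g]
  have hg1 : g (X 1) = Z 1 1 := by simp [g]
  have hg2 : g (X 2) = Z 0 1 + Z 1 0 := by simp [g]
  let _ : Algebra (MvPolynomial (Fin 3) ℂ) Q := (π.comp g).toRingHom.toAlgebra
  have hψ : ∀ r, algebraMap (MvPolynomial (Fin 3) ℂ) Q r = π (g r) := fun _ => rfl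
  have him : ∀ r, IsIntegral (MvPolynomial (Fin 3) ℂ) (π (g r)) := fun r => by
    rw [← hψ]; exact isIntegral_algebraMap
  have h00 : IsIntegral (MvPolynomial (Fin 3) ℂ) (π (Z 0 0)) := hg0 ▸ him (X 0)
  have h11 : IsIntegral (MvPolynomial (Fin 3) ℂ) (π (Z 1 1)) := hg1 ▸ him (X 1)
  have h01 : IsIntegral (MvPolynomial (Fin 3) ℂ) (π (Z 0 1)) := by
    refine ⟨Polynomial.X ^ 2 + (Polynomial.C (X 0 * X 1) - Polynomial.C (X 2) * Polynomial.X),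
      Polynomial.monic_X_pow_add ?_, ?_⟩
    · compute_degree!
    simp only [Polynomial.eval₂_add, Polynomial.eval₂_sub, Polynomial.eval₂_mul,
      Polynomial.eval₂_pow, Polynomial.eval₂_X, Polynomial.eval₂_C, hψ, map_mul, hg0, hg1, hg2,
      map_add]
    linear_combination hy
  have h10 : IsIntegral (MvPolynomial (Fin 3) ℂ) (π (Z 1 0)) := by
    have h := (him (X 2)).sub h01
    rwa [hg2, map_add, add_sub_cancel_left] at h
  have hyint : ∀ i j, IsIntegral (MvPolynomial (Fin 3) ℂ) (π (Z i j)) :=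
    Fin.forall_fin_two.2 ⟨Fin.forall_fin_two.2 ⟨h00, h01⟩, Fin.forall_fin_two.2 ⟨h10, h11⟩⟩
  have hC : ∀ c : ℂ, IsIntegral (MvPolynomial (Fin 3) ℂ) (π (C c)) := by
    intro c
    have h := him (C c)
    have hgc : g (C c) = C c := by simp only [g, algHom_C]; rfl
    rwa [hgc] at h
  have hX : ∀ k, IsIntegral (MvPolynomial (Fin 3) ℂ) (π (X k)) := by
    intro k
    have : π (X k) = ∑ i, ∑ j, π (C (joinVec e i j k)) * π (Z i j) := by
      simp only [← map_mul, ← map_sum]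
      apply hπeq
      simp only [map_mul, map_sum, hZ]
      simp only [joinHom, aeval_X, algHom_C]
      simp
    rw [this]
    exact IsIntegral.sum _ fun i _ => IsIntegral.sum _ fun j _ => (hC _).mul (hyint i j)
  have : Algebra.IsIntegral (MvPolynomial (Fin 3) ℂ) Q := by
    refine ⟨fun x => ?_⟩
    obtain ⟨f, rfl⟩ := hπ x
    induction f using MvPolynomial.induction_on with
    | C a => exact hC a
    | add p q hp hq => rw [map_add]; exact hp.add hq
    | mul_X p n hp => rw [map_mul]; exact hp.mul (hX n)
  have hinj : Function.Injective (algebraMap (MvPolynomial (Fin 3) ℂ) Q) := by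
    rw [injective_iff_map_eq_zero]
    intro f hf
    rw [hψ, hker] at hf
    refine MvPolynomial.funext fun v => ?_
    obtain ⟨p, q, ha, hc, hb⟩ := exists_mul_eq_quadratic (v 0) (v 2) (v 1)
    have hev : (aeval (fun ij : Fin 2 × Fin 2 => (![p, q] : Fin 2 → Fin 2 → ℂ) ij.1 ij.2)).comp
        ((joinHom e).comp g) = aeval v := by
      ext i
      fin_cases i
      · simp [g, hZ, ha]
      · simp [g, hZ, hc]
      · simp [g, hZ, hb]
    have := DFunLike.congr_fun hev f
    rw [AlgHom.comp_apply, AlgHom.comp_apply, hf, map_zero] at this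
    simpa [coe_aeval_eq_eval] using this.symm
  rw [ringKrullDim_eq_of_isIntegral hinj, MvPolynomial.ringKrullDim_of_isNoetherianRing,
    ringKrullDim_eq_zero_of_field]
  simp

lemma ringKrullDim_join {e : Fin 4 → Fin 4 → ℂ} (he : LinearIndependent ℂ e) :
    ringKrullDim (MvPolynomial (Fin 6) ℂ ⧸ RingHom.ker (joinHom e)) = 3 := by
  have : (RingHom.ker (joinHom e)).IsPrime := RingHom.ker_isPrime _
  refine ringKrullDim_eq_three_of_ker_eq he (Ideal.Quotient.mkₐ ℂ _)
    (Ideal.Quotient.mkₐ_surjective ℂ _) fun f => ?_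
  rw [Ideal.Quotient.mkₐ_eq_mk, Ideal.Quotient.eq_zero_iff_mem, RingHom.mem_ker]

theorem isLinearCongruence_join {e : Fin 4 → Fin 4 → ℂ} (he : LinearIndependent ℂ e) :
    IsLinearCongruence (join e) := by
  refine ⟨⟨⟨isProjClosed_join he, ?_, ?_⟩, ?_⟩, ?_⟩
  · rw [homogeneousIdeal_join]; exact RingHom.ker_isPrime _
  · rw [homogeneousIdeal_join]; exact ringKrullDim_join he
  · rintro _ ⟨p, q, h, rfl⟩
    exact ⟨_, _, h, rfl⟩
  · refine ⟨Submodule.span ℂ (Set.range fun ij : Fin 2 × Fin 2 => joinVec e ij.1 ij.2), ?_, ?_⟩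
    · rw [finrank_span_eq_card (linearIndependent_joinVec he)]; simp
    · rintro _ ⟨p, q, h, rfl⟩
      rw [Projectivization.submodule_mk, Submodule.span_singleton_le_iff_mem, joinPt_eq]
      exact Submodule.sum_mem _ fun i _ => Submodule.sum_mem _ fun j _ =>
        Submodule.smul_mem _ _ (Submodule.subset_span ⟨(i, j), rfl⟩)

lemma projClosure_subset_of_isProjClosed {n : ℕ} {Z W : Set (Proj n)} (hW : IsProjClosed W)
    (h : Z ⊆ W) : projClosure Z ⊆ W := by
  obtain ⟨F, hF, rfl⟩ := hW
  intro x hx f hf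
  obtain ⟨d, hd⟩ := hF f hf
  exact hx f d hd fun z hz => h hz f hf

lemma eval_smul_of_isHomogeneous {n d : ℕ} {f : MvPolynomial (Fin n) ℂ} (hf : f.IsHomogeneous d)
    (c : ℂ) (v : Fin n → ℂ) : eval (c • v) f = c ^ d * eval v f := by
  rw [eval_eq', eval_eq', Finset.mul_sum]
  refine Finset.sum_congr rfl fun m hm => ?_
  have hd : ∑ i, m i = d := by
    rw [← hf (mem_support_iff.1 hm), Finsupp.weight_apply, Finsupp.sum_fintype _ _ (by simp)]
    simp
  simp only [Pi.smul_apply, smul_eq_mul, mul_pow, Finset.prod_mul_distrib,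
    Finset.prod_pow_eq_pow_sum, hd]
  ring

lemma eval_rep_eq_zero_iff {n d : ℕ} {f : MvPolynomial (Fin n) ℂ} (hf : f.IsHomogeneous d)
    {v : Fin n → ℂ} (hv : v ≠ 0) :
    eval (Projectivization.mk ℂ v hv).rep f = 0 ↔ eval v f = 0 := by
  obtain ⟨a, ha⟩ := Projectivization.exists_smul_eq_mk_rep ℂ v hv
  rw [← ha]
  change eval ((a : ℂ) • v) f = 0 ↔ _
  rw [eval_smul_of_isHomogeneous hf]
  simp

/-- A set of lines of a join is Zariski dense in it as soon as it contains the lines with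
parameters outside a hypersurface. -/
theorem projClosure_eq_join {e : Fin 4 → Fin 4 → ℂ} (he : LinearIndependent ℂ e)
    {Z : Set (Proj 6)} (hZ : Z ⊆ join e) {χ : MvPolynomial (Fin 2 × Fin 2) ℂ} (hχ : χ ≠ 0)
    (h : ∀ p q, eval (fun ij : Fin 2 × Fin 2 => (![p, q] : Fin 2 → Fin 2 → ℂ) ij.1 ij.2) χ ≠ 0 →
      ∀ hne : joinPt e p q ≠ 0, Projectivization.mk ℂ _ hne ∈ Z) :
    projClosure Z = join e := by
  refine (projClosure_subset_of_isProjClosed (isProjClosed_join he) hZ).antisymm ?_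
  rintro _ ⟨p, q, hpq, rfl⟩ f d hf hfZ
  rw [eval_rep_eq_zero_iff hf]
  suffices hj : joinHom e f = 0 from (joinHom_eq_zero_iff e f).1 hj p q
  have hprod : joinHom e f * (χ * (X (0, 0) * X (1, 0))) = 0 := by
    refine MvPolynomial.funext fun v => ?_
    rw [map_mul, map_zero, eval_joinHom]
    by_cases hv : eval v (χ * (X (0, 0) * X (1, 0))) = 0
    · rw [hv, mul_zero]
    · simp only [map_mul, eval_X, mul_eq_zero, not_or] at hv
      have hne : joinPt e (fun i => v (0, i)) (fun j => v (1, j)) ≠ 0 :=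
        joinPt_ne_zero he (fun h => hv.2.1 (congrFun h 0)) (fun h => hv.2.2 (congrFun h 0))
      have hv' : (fun ij : Fin 2 × Fin 2 =>
          (![fun i => v (0, i), fun j => v (1, j)] : Fin 2 → Fin 2 → ℂ) ij.1 ij.2) = v := by
        ext ⟨i, j⟩; fin_cases i <;> rfl
      have := hfZ _ (h (fun i => v (0, i)) (fun j => v (1, j)) (by rw [hv']; exact hv.1) hne)
      rw [eval_rep_eq_zero_iff hf] at this
      rw [this, zero_mul]
  exact (mul_eq_zero.1 hprod).resolve_right
    (mul_ne_zero hχ (mul_ne_zero (X_ne_zero _) (X_ne_zero _)))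

/-! ### Lines spanned by two vectors -/

/-- The line spanned by two linearly independent vectors. -/
def lineOf (p q : Fin 4 → ℂ) (h : LinearIndependent ℂ ![p, q]) : Line :=
  ⟨Submodule.span ℂ (Set.range ![p, q]), by simpa using finrank_span_eq_card h⟩

lemma mem_lineOf {p q : Fin 4 → ℂ} {h : LinearIndependent ℂ ![p, q]} {v : Fin 4 → ℂ} :
    v ∈ (lineOf p q h).1 ↔ ∃ a b : ℂ, a • p + b • q = v := by
  change v ∈ Submodule.span ℂ (Set.range ![p, q]) ↔ _
  rw [Matrix.range_cons, Matrix.range_cons, Matrix.range_empty, Set.union_empty,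
    Set.singleton_union, Submodule.mem_span_pair]

lemma mk_mem_points {l : Line} {v : Fin 4 → ℂ} (hv : v ≠ 0) :
    Projectivization.mk ℂ v hv ∈ l.points ↔ v ∈ l.1 := by
  rw [Line.points, Set.mem_ofPred_eq, Projectivization.submodule_mk,
    Submodule.span_singleton_le_iff_mem]

lemma meet_iff {l m : Line} : Meet l m ↔ ∃ v ≠ 0, v ∈ l.1 ∧ v ∈ m.1 := by
  constructor
  · rintro ⟨x, hl, hm⟩
    refine ⟨x.rep, x.rep_nonzero, ?_, ?_⟩
    · rw [← mk_mem_points x.rep_nonzero, Projectivization.mk_rep]; exact hl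
    · rw [← mk_mem_points x.rep_nonzero, Projectivization.mk_rep]; exact hm
  · rintro ⟨v, hv, hl, hm⟩
    exact ⟨_, (mk_mem_points hv).2 hl, (mk_mem_points hv).2 hm⟩

lemma skew_iff {l m : Line} : Skew l m ↔ ∀ v, v ∈ l.1 → v ∈ m.1 → v = 0 := by
  have : Skew l m ↔ ¬ Meet l m := by
    rw [Skew, Meet, Set.disjoint_iff_inter_eq_empty, Set.not_nonempty_iff_eq_empty]
  rw [this, meet_iff]
  push Not
  exact ⟨fun h v hl hm => by_contra fun hv => h v hv hl hm, fun h v hv hl hm => hv (h v hl hm)⟩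

lemma isProjClosed_points (l : Line) : IsProjClosed l.points := by
  refine ⟨{f | ∃ φ : (Fin 4 → ℂ) →ₗ[ℂ] ℂ, l.1 ≤ LinearMap.ker φ ∧
    f = ∑ k, C (φ (Pi.single k 1)) * X k}, ?_, ?_⟩
  · rintro f ⟨φ, -, rfl⟩
    exact ⟨1, isHomogeneous_linear _⟩
  · have hev : ∀ (φ : (Fin 4 → ℂ) →ₗ[ℂ] ℂ) v,
        eval v (∑ k, C (φ (Pi.single k 1)) * X k) = φ v := by
      intro φ v
      conv_rhs => rw [LinearMap.pi_apply_eq_sum_univ φ v]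
      simp only [map_sum, map_mul, eval_C, eval_X, smul_eq_mul]
      refine Finset.sum_congr rfl fun k _ => ?_
      rw [mul_comm]
      congr 2
      ext j; simp [Pi.single_apply, eq_comm]
    ext x
    have hx : x ∈ l.points ↔ x.rep ∈ l.1 := by
      conv_lhs => rw [← x.mk_rep]
      exact mk_mem_points x.rep_nonzero
    rw [hx]
    constructor
    · rintro h f ⟨φ, hφ, rfl⟩
      rw [hev]; exact hφ h
    · intro h
      by_contra hn
      obtain ⟨φ, hφ, hle⟩ := Submodule.exists_le_ker_of_notMem hn
      exact hφ ((hev φ _).symm.trans (h _ ⟨φ, hle, rfl⟩))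

lemma exists_mk_rep_eq {V : Type*} [AddCommGroup V] [Module ℂ V] (x : ℙ ℂ V) :
    ∃ (v : V) (hv : v ≠ 0), x = Projectivization.mk ℂ v hv :=
  ⟨x.rep, x.rep_nonzero, x.mk_rep.symm⟩

/-- The span of two vectors is determined by their Plücker vector. -/
lemma mem_span_pair_iff_of_wedge_ne_zero {p q : Fin 4 → ℂ} (h : wedge p q ≠ 0) (v : Fin 4 → ℂ) :
    v ∈ Submodule.span ℂ {p, q} ↔
      ∀ i j k, v i * (p j * q k - p k * q j) - v j * (p i * q k - p k * q i)
        + v k * (p i * q j - p j * q i) = 0 := by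
  rw [Submodule.mem_span_pair]
  constructor
  · rintro ⟨a, b, rfl⟩ i j k
    simp only [Pi.add_apply, Pi.smul_apply, smul_eq_mul]; ring
  · intro hv
    have : ∃ j k, p j * q k - p k * q j ≠ 0 := by
      by_contra hn
      push Not at hn
      apply h
      ext i
      fin_cases i <;> simp [wedge, hn]
    obtain ⟨j, k, hjk⟩ := this
    refine ⟨(v j * q k - v k * q j) / (p j * q k - p k * q j),
      (p j * v k - p k * v j) / (p j * q k - p k * q j), ?_⟩
    ext i
    simp only [Pi.add_apply, Pi.smul_apply, smul_eq_mul]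
    rw [div_mul_eq_mul_div, div_mul_eq_mul_div, ← add_div, div_eq_iff hjk]
    linear_combination -(hv i j k)

lemma span_pair_eq_of_mk_wedge_eq {p q p' q' : Fin 4 → ℂ} (h : wedge p q ≠ 0)
    (h' : wedge p' q' ≠ 0)
    (heq : Projectivization.mk ℂ (wedge p q) h = Projectivization.mk ℂ (wedge p' q') h') :
    Submodule.span ℂ {p, q} = Submodule.span ℂ {p', q'} := by
  obtain ⟨a, ha⟩ := (Projectivization.mk_eq_mk_iff' ℂ _ _ _ _).1 heq
  have ha0 : a ≠ 0 := by rintro rfl; exact h (by rw [← ha, zero_smul])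
  have hij : ∀ i j, p i * q j - p j * q i = a * (p' i * q' j - p' j * q' i) := by
    have hk := fun k => congrFun ha.symm k
    intro i j
    have h0 := hk 0
    have h1 := hk 1
    have h2 := hk 2
    have h3 := hk 3
    have h4 := hk 4
    have h5 := hk 5
    simp [wedge] at h0 h1 h2 h3 h4 h5
    fin_cases i <;> fin_cases j <;> simp only [Fin.mk_zero, Fin.mk_one, Fin.reduceFinMk,
      Fin.isValue] <;>
    first
      | ring1
      | linear_combination h0
      | linear_combination -h0
      | linear_combination h1
      | linear_combination -h1
      | linear_combination h2
      | linear_combination -h2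
      | linear_combination h3
      | linear_combination -h3
      | linear_combination h4
      | linear_combination -h4
      | linear_combination h5
      | linear_combination -h5
  ext v
  rw [mem_span_pair_iff_of_wedge_ne_zero h, mem_span_pair_iff_of_wedge_ne_zero h']
  refine forall_congr' fun i => forall_congr' fun j => forall_congr' fun k => ?_
  rw [hij, hij, hij]
  constructor
  · intro hv
    have : a * (v i * (p' j * q' k - p' k * q' j) - v j * (p' i * q' k - p' k * q' i)
        + v k * (p' i * q' j - p' j * q' i)) = 0 := by linear_combination hv
    exact (mul_eq_zero.1 this).resolve_left ha0
  · intro hv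
    linear_combination a * hv

/-- A subspace meets every line of a join as soon as it meets the lines joining two points. -/
lemma meetsEveryLine_join_iff (e : Fin 4 → Fin 4 → ℂ) (V : Set (Proj 4)) :
    MeetsEveryLine V (join e) ↔ ∀ p q : Fin 2 → ℂ, joinPt e p q ≠ 0 →
      ∃ v ∈ V, v.submodule ≤
        Submodule.span ℂ {p 0 • e 0 + p 1 • e 1, q 0 • e 2 + q 1 • e 3} := by
  constructor
  · intro h p q hpq
    exact h _ _ hpq ⟨p, q, hpq, rfl⟩
  · rintro h p' q' hne ⟨p, q, hpq, heq⟩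
    rw [span_pair_eq_of_mk_wedge_eq hne hpq heq]
    exact h p q hpq

/-! ### The focal lines of a join -/

lemma linearIndependent_fin_four_iff {e : Fin 4 → Fin 4 → ℂ} : LinearIndependent ℂ e ↔
    ∀ a b c d : ℂ, a • e 0 + b • e 1 + c • e 2 + d • e 3 = 0 →
      a = 0 ∧ b = 0 ∧ c = 0 ∧ d = 0 := by
  rw [Fintype.linearIndependent_iff]
  constructor
  · intro h a b c d habcd
    have := h ![a, b, c, d] (by rw [Fin.sum_univ_four]; exact habcd)
    exact ⟨this 0, this 1, this 2, this 3⟩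
  · intro h g hg i
    rw [Fin.sum_univ_four] at hg
    obtain ⟨h0, h1, h2, h3⟩ := h _ _ _ _ hg
    fin_cases i <;> assumption

lemma linearIndependent_swap {e : Fin 4 → Fin 4 → ℂ} (he : LinearIndependent ℂ e) :
    LinearIndependent ℂ ![e 2, e 3, e 0, e 1] := by
  rw [linearIndependent_fin_four_iff] at he ⊢
  intro a b c d h
  obtain ⟨h0, h1, h2, h3⟩ := he c d a b (by
    rw [← h]; simp only [Matrix.cons_val]; abel)
  exact ⟨h2, h3, h0, h1⟩

lemma linearIndependent_pair_fst {e : Fin 4 → Fin 4 → ℂ} (he : LinearIndependent ℂ e) :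
    LinearIndependent ℂ ![e 0, e 1] := by
  rw [LinearIndependent.pair_iff]
  intro a b h
  obtain ⟨h0, h1, -, -⟩ := linearIndependent_fin_four_iff.1 he a b 0 0 (by simpa using h)
  exact ⟨h0, h1⟩

lemma linearIndependent_pair_snd {e : Fin 4 → Fin 4 → ℂ} (he : LinearIndependent ℂ e) :
    LinearIndependent ℂ ![e 2, e 3] := by
  rw [LinearIndependent.pair_iff]
  intro a b h
  obtain ⟨-, -, h2, h3⟩ := linearIndependent_fin_four_iff.1 he 0 0 a b (by simpa using h)
  exact ⟨h2, h3⟩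

lemma wedge_swap (p q : Fin 4 → ℂ) : wedge q p = -wedge p q := by
  ext k; fin_cases k <;> simp [wedge] <;> ring

lemma join_subset_join_swap (e : Fin 4 → Fin 4 → ℂ) : join e ⊆ join ![e 2, e 3, e 0, e 1] := by
  rintro _ ⟨p, q, h, rfl⟩
  have hw : joinPt ![e 2, e 3, e 0, e 1] q p = -joinPt e p q := wedge_swap _ _
  refine ⟨q, p, by rw [hw]; exact neg_ne_zero.2 h, ?_⟩
  rw [Projectivization.mk_eq_mk_iff']
  exact ⟨-1, by rw [hw]; simp⟩

lemma join_swap (e : Fin 4 → Fin 4 → ℂ) : join ![e 2, e 3, e 0, e 1] = join e := by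
  refine Set.Subset.antisymm ?_ (join_subset_join_swap e)
  have h := join_subset_join_swap ![e 2, e 3, e 0, e 1]
  have he : ![(![e 2, e 3, e 0, e 1] : Fin 4 → Fin 4 → ℂ) 2,
      (![e 2, e 3, e 0, e 1] : Fin 4 → Fin 4 → ℂ) 3,
      (![e 2, e 3, e 0, e 1] : Fin 4 → Fin 4 → ℂ) 0,
      (![e 2, e 3, e 0, e 1] : Fin 4 → Fin 4 → ℂ) 1] = e := by
    ext i; fin_cases i <;> rfl
  rwa [he] at h

lemma isFocalVariety_fst {e : Fin 4 → Fin 4 → ℂ} (he : LinearIndependent ℂ e)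
    (h : LinearIndependent ℂ ![e 0, e 1]) :
    IsFocalVariety (lineOf (e 0) (e 1) h).points (join e) := by
  refine ⟨isProjClosed_points _, ?_, ?_⟩
  · rw [meetsEveryLine_join_iff]
    intro p q hpq
    have hp : p 0 • e 0 + p 1 • e 1 ≠ 0 := by
      intro h0
      apply hpq
      rw [joinPt, h0]
      ext k
      fin_cases k <;> simp [wedge]
    refine ⟨Projectivization.mk ℂ _ hp, (mk_mem_points hp).2 (mem_lineOf.2 ⟨_, _, rfl⟩), ?_⟩
    rw [Projectivization.submodule_mk, Submodule.span_singleton_le_iff_mem]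
    exact Submodule.subset_span (Set.mem_insert _ _)
  · intro W _ hW hmeet
    refine hW.antisymm ?_
    rintro x hx
    obtain ⟨v, hv, rfl⟩ := exists_mk_rep_eq x
    rw [mk_mem_points, mem_lineOf] at hx
    obtain ⟨a, b, rfl⟩ := hx
    have hab : (![a, b] : Fin 2 → ℂ) ≠ 0 := by
      intro h0
      apply hv
      have ha := congrFun h0 0
      have hb := congrFun h0 1
      simp at ha hb
      simp [ha, hb]
    obtain ⟨y, hyW, hy⟩ := (meetsEveryLine_join_iff e W).1 hmeet ![a, b] ![1, 0]
      (joinPt_ne_zero he hab (fun h0 => by simpa using congrFun h0 0))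
    have hyl := hW hyW
    obtain ⟨v, hv', rfl⟩ := exists_mk_rep_eq y
    rw [mk_mem_points, mem_lineOf] at hyl
    rw [Projectivization.submodule_mk, Submodule.span_singleton_le_iff_mem,
      Submodule.mem_span_pair] at hy
    obtain ⟨c, d, rfl⟩ := hyl
    obtain ⟨r, s, hrs⟩ := hy
    simp only [Matrix.cons_val_zero, Matrix.cons_val_one, one_smul, zero_smul, add_zero] at hrs
    obtain ⟨h0, h1, -, -⟩ := linearIndependent_fin_four_iff.1 he (r * a - c) (r * b - d) s 0 (by
      rw [← sub_eq_zero] at hrs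
      rw [← hrs]; module)
    convert hyW using 1
    rw [Projectivization.mk_eq_mk_iff']
    have hr : r ≠ 0 := by
      rintro rfl
      apply hv'
      rw [zero_mul, zero_sub, neg_eq_zero] at h0 h1
      simp [h0, h1]
    refine ⟨r⁻¹, ?_⟩
    rw [← sub_eq_zero.1 h0, ← sub_eq_zero.1 h1, smul_add, smul_smul, smul_smul,
      inv_mul_cancel_left₀ hr, inv_mul_cancel_left₀ hr]

lemma isFocalVariety_snd {e : Fin 4 → Fin 4 → ℂ} (he : LinearIndependent ℂ e)
    (h : LinearIndependent ℂ ![e 2, e 3]) :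
    IsFocalVariety (lineOf (e 2) (e 3) h).points (join e) := by
  rw [← join_swap]
  exact isFocalVariety_fst (linearIndependent_swap he) h

/-- A line different from `⟨p, q⟩` misses two independent vectors of `⟨p, q⟩`. -/
lemma exists_basis_notMem {p q : Fin 4 → ℂ} {h : LinearIndependent ℂ ![p, q]} {k : Line}
    (hk : k ≠ lineOf p q h) : ∃ a b : Fin 2 → ℂ, a 0 * b 1 - a 1 * b 0 ≠ 0 ∧
      a 0 • p + a 1 • q ∉ k.1 ∧ b 0 • p + b 1 • q ∉ k.1 := by
  have hnot : ¬ (p ∈ k.1 ∧ q ∈ k.1) := by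
    rintro ⟨hp, hq⟩
    apply hk
    have hle : (lineOf p q h).1 ≤ k.1 := by
      intro v hv
      obtain ⟨a, b, rfl⟩ := mem_lineOf.1 hv
      exact k.1.add_mem (k.1.smul_mem _ hp) (k.1.smul_mem _ hq)
    exact (Subtype.ext (Submodule.eq_of_le_of_finrank_eq hle
      ((lineOf p q h).2.trans k.2.symm))).symm
  by_cases hp : p ∈ k.1
  · have hq : q ∉ k.1 := fun hq => hnot ⟨hp, hq⟩
    exact ⟨![0, 1], ![1, 1], by simp, by simpa using hq, by
      simpa using fun hpq => hq ((k.1.add_mem_iff_right hp).1 hpq)⟩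
  · by_cases hq : q ∈ k.1
    · exact ⟨![1, 0], ![1, 1], by simp, by simpa using hp, by
        simpa using fun hpq => hp ((k.1.add_mem_iff_left hq).1 hpq)⟩
    · exact ⟨![1, 0], ![0, 1], by simp, by simpa using hp, by simpa using hq⟩

/-- The focal lines of the join of two skew lines are these two lines: a line `k` different from
both would contain, for independent `P, P'` on the first line and `Q, Q'` on the second, vectors
`P + λ Q`, `P' + λ' Q` and `P + μ Q'`, which are linearly independent. -/
theorem focalLines_join {e : Fin 4 → Fin 4 → ℂ} (he : LinearIndependent ℂ e) :
    focalLines (join e) = {lineOf (e 0) (e 1) (linearIndependent_pair_fst he),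
      lineOf (e 2) (e 3) (linearIndependent_pair_snd he)} := by
  apply Set.Subset.antisymm
  · intro k hk
    by_contra hne
    simp only [Set.mem_insert_iff, Set.mem_singleton_iff, not_or] at hne
    obtain ⟨p, p', hp, hpk, hpk'⟩ := exists_basis_notMem hne.1
    obtain ⟨q, q', hq, hqk, hqk'⟩ := exists_basis_notMem hne.2
    have key : ∀ p q : Fin 2 → ℂ, p 0 • e 0 + p 1 • e 1 ∉ k.1 → q 0 • e 2 + q 1 • e 3 ∉ k.1 →
        ∃ c : ℂ, c ≠ 0 ∧ (p 0 • e 0 + p 1 • e 1) + c • (q 0 • e 2 + q 1 • e 3) ∈ k.1 := by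
      intro p q hp hq
      obtain ⟨y, hyk, hy⟩ := (meetsEveryLine_join_iff e _).1 hk.2.1 p q
        (joinPt_ne_zero he (by rintro rfl; simp at hp) (by rintro rfl; simp at hq))
      obtain ⟨v, hv, rfl⟩ := exists_mk_rep_eq y
      rw [mk_mem_points] at hyk
      rw [Projectivization.submodule_mk, Submodule.span_singleton_le_iff_mem,
        Submodule.mem_span_pair] at hy
      obtain ⟨r, s, rfl⟩ := hy
      have hr : r ≠ 0 := by
        rintro rfl
        have hs : s ≠ 0 := by rintro rfl; simp at hv
        rw [zero_smul, zero_add] at hyk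
        exact hq ((k.1.smul_mem_iff hs).1 hyk)
      have hs : s ≠ 0 := by
        rintro rfl
        rw [zero_smul, add_zero] at hyk
        exact hp ((k.1.smul_mem_iff hr).1 hyk)
      refine ⟨r⁻¹ * s, mul_ne_zero (inv_ne_zero hr) hs, ?_⟩
      have := k.1.smul_mem r⁻¹ hyk
      rwa [smul_add, inv_smul_smul₀ hr, smul_smul] at this
    obtain ⟨c, hc, h1⟩ := key p q hpk hqk
    obtain ⟨c', hc', h2⟩ := key p' q hpk' hqk
    obtain ⟨d, hd, h3⟩ := key p q' hpk hqk'
    have hli : LinearIndependent ℂ (![⟨_, h1⟩, ⟨_, h2⟩, ⟨_, h3⟩] : Fin 3 → k.1) := by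
      rw [Fintype.linearIndependent_iff]
      intro g hg
      have hg' := congrArg Subtype.val hg
      simp only [Fin.sum_univ_three, Matrix.cons_val, Submodule.coe_add, Submodule.coe_smul,
        Submodule.coe_zero] at hg'
      obtain ⟨k0, k1, k2, k3⟩ := linearIndependent_fin_four_iff.1 he
        ((g 0 + g 2) * p 0 + g 1 * p' 0) ((g 0 + g 2) * p 1 + g 1 * p' 1)
        ((g 0 * c + g 1 * c') * q 0 + g 2 * d * q' 0)
        ((g 0 * c + g 1 * c') * q 1 + g 2 * d * q' 1) (by rw [← hg']; module)
      have g1 : g 1 = 0 := by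
        have : g 1 * (p 0 * p' 1 - p 1 * p' 0) = 0 := by linear_combination p 0 * k1 - p 1 * k0
        exact (mul_eq_zero.1 this).resolve_right hp
      have g2 : g 2 = 0 := by
        have : g 2 * d * (q 0 * q' 1 - q 1 * q' 0) = 0 := by
          linear_combination q 0 * k3 - q 1 * k2
        exact (mul_eq_zero.1 ((mul_eq_zero.1 this).resolve_right hq)).resolve_right hd
      have g0 : g 0 = 0 := by
        have : (g 0 + g 2) * (p 0 * p' 1 - p 1 * p' 0) = 0 := by
          linear_combination p' 1 * k0 - p' 0 * k1
        have := (mul_eq_zero.1 this).resolve_right hp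
        rwa [g2, add_zero] at this
      intro i
      fin_cases i <;> assumption
    have := hli.fintype_card_le_finrank
    rw [k.2, Fintype.card_fin] at this
    omega
  · rintro k (rfl | rfl)
    · exact isFocalVariety_fst he _
    · exact isFocalVariety_snd he _

/-! ### The normal form of a general map and its congruences -/

/-- The normal form of a general trilinear birational map of type `(1, 2, 2)`, with respect to the
basis `A` of `ℂ⁴`. -/
def canon (A : Fin 4 → Fin 4 → ℂ) (s t u : Fin 2 → ℂ) : Fin 4 → ℂ :=
  (s 0 * t 0 * (u 0 - u 1)) • A 0 + (s 0 * (u 0 * t 1 - t 0 * u 1)) • A 1 +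
    (s 1 * t 1 * (u 0 - u 1)) • A 2 + (s 1 * (u 0 * t 1 - t 0 * u 1)) • A 3

open Matrix in
/-- `Φ` is the normal form `canon`, up to coordinate changes in `ℙ³` and in the three factors. -/
def IsGeneralForm (Φ : Tuple) : Prop :=
  ∃ (A : Fin 4 → Fin 4 → ℂ) (gs gt gu : Matrix (Fin 2) (Fin 2) ℂ),
    LinearIndependent ℂ A ∧ gs.det ≠ 0 ∧ gt.det ≠ 0 ∧ gu.det ≠ 0 ∧
    ∀ v, Φ.value v = canon A (gs *ᵥ v 0) (gt *ᵥ v 1) (gu *ᵥ v 2)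

lemma wedge_comb (V W : Fin 4 → ℂ) (a b c d : ℂ) :
    wedge (a • V + b • W) (c • V + d • W) = (a * d - b * c) • wedge V W := by
  ext k; fin_cases k <;> simp [wedge] <;> ring

open Matrix in
/-- For a bilinear `F`, replacing the two basis vectors by their images under `g` multiplies the
wedge product by `det g`. -/
lemma wedge_mulVec {F : (Fin 2 → ℂ) → Fin 4 → ℂ} {V W : Fin 4 → ℂ}
    (hF : ∀ w, F w = w 0 • V + w 1 • W) (g : Matrix (Fin 2) (Fin 2) ℂ) :
    wedge (F (g *ᵥ ![1, 0])) (F (g *ᵥ ![0, 1])) = g.det • wedge V W := by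
  rw [hF, hF, wedge_comb, Matrix.det_fin_two]
  congr 1
  simp [Matrix.mulVec, dotProduct, Fin.sum_univ_two]
  ring

section General

open Matrix

variable {Φ : Tuple} {A : Fin 4 → Fin 4 → ℂ} {gs gt gu : Matrix (Fin 2) (Fin 2) ℂ}

lemma wedge_value_zero (hΦ : ∀ v, Φ.value v = canon A (gs *ᵥ v 0) (gt *ᵥ v 1) (gu *ᵥ v 2))
    (v : Fin 3 → Fin 2 → ℂ) (t u : Fin 2 → ℂ) (ht : gt *ᵥ v 1 = t) (hu : gu *ᵥ v 2 = u) :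
    wedge (Φ.value (Function.update v 0 ![1, 0])) (Φ.value (Function.update v 0 ![0, 1])) =
      gs.det • joinPt A ![t 0 * (u 0 - u 1), u 0 * t 1 - t 0 * u 1]
        ![t 1 * (u 0 - u 1), u 0 * t 1 - t 0 * u 1] := by
  rw [hΦ, hΦ]
  simp only [Function.update_self, ne_eq, Fin.isValue, one_ne_zero, not_false_eq_true,
    Function.update_of_ne, show (2 : Fin 3) ≠ 0 by decide, ht, hu]
  rw [wedge_mulVec (F := fun s => canon A s t u)
    (V := (t 0 * (u 0 - u 1)) • A 0 + (u 0 * t 1 - t 0 * u 1) • A 1)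
    (W := (t 1 * (u 0 - u 1)) • A 2 + (u 0 * t 1 - t 0 * u 1) • A 3)
    (fun s => by simp only [canon]; module)]
  rfl

lemma wedge_value_one (hΦ : ∀ v, Φ.value v = canon A (gs *ᵥ v 0) (gt *ᵥ v 1) (gu *ᵥ v 2))
    (v : Fin 3 → Fin 2 → ℂ) (s u : Fin 2 → ℂ) (hs : gs *ᵥ v 0 = s) (hu : gu *ᵥ v 2 = u) :
    wedge (Φ.value (Function.update v 1 ![1, 0])) (Φ.value (Function.update v 1 ![0, 1])) =
      (gt.det * (u 0 - u 1)) • joinPt ![A 0, A 2, A 0 + A 1, A 2 + A 3]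
        ![s 0 * u 0, s 1 * u 1] s := by
  rw [hΦ, hΦ]
  simp only [Function.update_self, ne_eq, Fin.isValue, not_false_eq_true,
    Function.update_of_ne, show (2 : Fin 3) ≠ 1 by decide, show (0 : Fin 3) ≠ 1 by decide, hs, hu]
  rw [wedge_mulVec (F := fun t => canon A s t u)
    (V := (s 0 * (u 0 - u 1)) • A 0 + (-(s 0 * u 1)) • A 1 + (-(s 1 * u 1)) • A 3)
    (W := (s 0 * u 0) • A 1 + (s 1 * (u 0 - u 1)) • A 2 + (s 1 * u 0) • A 3)
    (fun t => by simp only [canon]; module), mul_smul gt.det]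
  congr 1
  ext k
  fin_cases k <;> simp [wedge, joinPt] <;> ring

lemma wedge_value_two (hΦ : ∀ v, Φ.value v = canon A (gs *ᵥ v 0) (gt *ᵥ v 1) (gu *ᵥ v 2))
    (v : Fin 3 → Fin 2 → ℂ) (s t : Fin 2 → ℂ) (hs : gs *ᵥ v 0 = s) (ht : gt *ᵥ v 1 = t) :
    wedge (Φ.value (Function.update v 2 ![1, 0])) (Φ.value (Function.update v 2 ![0, 1])) =
      (gu.det * (t 1 - t 0)) • joinPt ![A 0, A 2, A 1, A 3] ![s 0 * t 0, s 1 * t 1] s := by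
  rw [hΦ, hΦ]
  simp only [Function.update_self, ne_eq, Fin.isValue, not_false_eq_true,
    Function.update_of_ne, show (1 : Fin 3) ≠ 2 by decide, show (0 : Fin 3) ≠ 2 by decide, hs, ht]
  rw [wedge_mulVec (F := fun u => canon A s t u)
    (V := (s 0 * t 0) • A 0 + (s 0 * t 1) • A 1 + (s 1 * t 1) • A 2 + (s 1 * t 1) • A 3)
    (W := (-(s 0 * t 0)) • A 0 + (-(s 0 * t 0)) • A 1 + (-(s 1 * t 1)) • A 2 +
      (-(s 1 * t 0)) • A 3)
    (fun u => by simp only [canon]; module), mul_smul gu.det]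
  congr 1
  ext k
  fin_cases k <;> simp [wedge, joinPt] <;> ring

/-- A parametric congruence is the join of two skew lines as soon as its Plücker vectors are those
of the join at parameters `P v`, `Q v`, and almost all parameters occur up to scaling. -/
lemma congruence_eq_join {Φ : Tuple} {m : Fin 3} {e : Fin 4 → Fin 4 → ℂ}
    (he : LinearIndependent ℂ e) (c : (Fin 3 → Fin 2 → ℂ) → ℂ)
    (P Q : (Fin 3 → Fin 2 → ℂ) → Fin 2 → ℂ)
    (hw : ∀ v, wedge (Φ.value (Function.update v m ![1, 0]))
      (Φ.value (Function.update v m ![0, 1])) = c v • joinPt e (P v) (Q v))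
    {χ : MvPolynomial (Fin 2 × Fin 2) ℂ} (hχ : χ ≠ 0)
    (h : ∀ p q : Fin 2 → ℂ,
      eval (fun ij : Fin 2 × Fin 2 => (![p, q] : Fin 2 → Fin 2 → ℂ) ij.1 ij.2) χ ≠ 0 →
      ∃ v, ∃ r : ℂ, r ≠ 0 ∧ c v • joinPt e (P v) (Q v) = r • joinPt e p q) :
    Φ.congruence m = join e := by
  refine projClosure_eq_join he ?_ hχ ?_
  · rintro _ ⟨v, hv, rfl⟩
    have hne : joinPt e (P v) (Q v) ≠ 0 := by
      intro h0; apply hv; rw [hw, h0, smul_zero]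
    refine ⟨_, _, hne, ?_⟩
    rw [Projectivization.mk_eq_mk_iff']
    exact ⟨c v, (hw v).symm⟩
  · intro p q hpq hne
    obtain ⟨v, r, hr, hv⟩ := h p q hpq
    refine ⟨v, by rw [hw, hv]; exact smul_ne_zero hr hne, ?_⟩
    rw [Projectivization.mk_eq_mk_iff']
    exact ⟨r⁻¹, by rw [hw, hv, inv_smul_smul₀ hr]⟩

lemma exists_mulVec_eq {g : Matrix (Fin 2) (Fin 2) ℂ} (hg : g.det ≠ 0) (w : Fin 2 → ℂ) :
    ∃ v, g *ᵥ v = w :=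
  ⟨g⁻¹ *ᵥ w, by rw [mulVec_mulVec, mul_nonsing_inv _ (isUnit_iff_ne_zero.2 hg), one_mulVec]⟩

lemma sub_ne_zero_aux : (X (0, 0) * X (1, 1) - X (0, 1) * X (1, 0) :
    MvPolynomial (Fin 2 × Fin 2) ℂ) ≠ 0 := by
  intro h
  have := congrArg (eval fun ij : Fin 2 × Fin 2 => if ij.1 = ij.2 then (1 : ℂ) else 0) h
  simp at this

lemma congruence_zero (hA : LinearIndependent ℂ A) (hs : gs.det ≠ 0) (ht : gt.det ≠ 0)
    (hu : gu.det ≠ 0) (hΦ : ∀ v, Φ.value v = canon A (gs *ᵥ v 0) (gt *ᵥ v 1) (gu *ᵥ v 2)) :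
    Φ.congruence 0 = join A := by
  refine congruence_eq_join hA _ _ _ (fun v => wedge_value_zero hΦ v _ _ rfl rfl)
    (χ := X (0, 1) * X (1, 1) * (X (0, 0) * X (1, 1) - X (0, 1) * X (1, 0)))
    (mul_ne_zero (mul_ne_zero (X_ne_zero _) (X_ne_zero _)) sub_ne_zero_aux) ?_
  intro p q hpq
  simp only [map_mul, map_sub, eval_X, cons_val_zero, cons_val_one, mul_ne_zero_iff] at hpq
  obtain ⟨⟨hp, hq⟩, hδ⟩ := hpq
  -- the inverse of the parametrization of the congruence
  obtain ⟨v1, hv1⟩ := exists_mulVec_eq ht ![p 0 * q 1, p 1 * q 0]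
  obtain ⟨v2, hv2⟩ := exists_mulVec_eq hu ![(p 0 - p 1) * q 1, (q 0 - q 1) * p 1]
  refine ⟨![0, v1, v2], gs.det * (p 1 * q 1 * (p 0 * q 1 - p 1 * q 0) ^ 2),
    mul_ne_zero hs (mul_ne_zero (mul_ne_zero hp hq) (pow_ne_zero _ hδ)), ?_⟩
  have e1 : (![0, v1, v2] : Fin 3 → Fin 2 → ℂ) 1 = v1 := rfl
  have e2 : (![0, v1, v2] : Fin 3 → Fin 2 → ℂ) 2 = v2 := rfl
  rw [e1, e2, hv1, hv2, mul_smul]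
  congr 1
  simp only [joinPt_eq, Fin.sum_univ_two, cons_val_zero, cons_val_one]
  module

lemma linearIndependent_ac (hA : LinearIndependent ℂ A) :
    LinearIndependent ℂ ![A 0, A 2, A 0 + A 1, A 2 + A 3] := by
  rw [linearIndependent_fin_four_iff] at hA ⊢
  intro a b c d h
  simp only [cons_val] at h
  obtain ⟨h0, h1, h2, h3⟩ := hA (a + c) c (b + d) d (by rw [← h]; module)
  subst h1 h3
  exact ⟨by simpa using h0, by simpa using h2, rfl, rfl⟩

lemma linearIndependent_ab (hA : LinearIndependent ℂ A) :
    LinearIndependent ℂ ![A 0, A 2, A 1, A 3] := by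
  rw [linearIndependent_fin_four_iff] at hA ⊢
  intro a b c d h
  simp only [cons_val] at h
  obtain ⟨h0, h1, h2, h3⟩ := hA a c b d (by rw [← h]; module)
  exact ⟨h0, h2, h1, h3⟩

lemma linearIndependent_bc (hA : LinearIndependent ℂ A) :
    LinearIndependent ℂ ![A 1, A 3, A 0 + A 1, A 2 + A 3] := by
  rw [linearIndependent_fin_four_iff] at hA ⊢
  intro a b c d h
  simp only [cons_val] at h
  obtain ⟨h0, h1, h2, h3⟩ := hA c (a + c) d (b + d) (by rw [← h]; module)
  subst h0 h2
  exact ⟨by simpa using h1, by simpa using h3, rfl, rfl⟩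

lemma congruence_one (hA : LinearIndependent ℂ A) (hs : gs.det ≠ 0) (ht : gt.det ≠ 0)
    (hu : gu.det ≠ 0) (hΦ : ∀ v, Φ.value v = canon A (gs *ᵥ v 0) (gt *ᵥ v 1) (gu *ᵥ v 2)) :
    Φ.congruence 1 = join ![A 0, A 2, A 0 + A 1, A 2 + A 3] := by
  refine congruence_eq_join (linearIndependent_ac hA) _ _ _
    (fun v => wedge_value_one hΦ v _ _ rfl rfl)
    (χ := X (1, 0) * X (1, 1) * (X (0, 0) * X (1, 1) - X (0, 1) * X (1, 0)))
    (mul_ne_zero (mul_ne_zero (X_ne_zero _) (X_ne_zero _)) sub_ne_zero_aux) ?_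
  intro p q hpq
  simp only [map_mul, map_sub, eval_X, cons_val_zero, cons_val_one, mul_ne_zero_iff] at hpq
  obtain ⟨⟨hp, hq⟩, hδ⟩ := hpq
  obtain ⟨v0, hv0⟩ := exists_mulVec_eq hs q
  obtain ⟨v2, hv2⟩ := exists_mulVec_eq hu ![p 0 * q 1, p 1 * q 0]
  refine ⟨![v0, 0, v2], gt.det * (p 0 * q 1 - p 1 * q 0) * (q 0 * q 1),
    mul_ne_zero (mul_ne_zero ht hδ) (mul_ne_zero hp hq), ?_⟩
  have e1 : (![v0, 0, v2] : Fin 3 → Fin 2 → ℂ) 0 = v0 := rfl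
  have e2 : (![v0, 0, v2] : Fin 3 → Fin 2 → ℂ) 2 = v2 := rfl
  rw [e1, e2, hv0, hv2, mul_smul _ (q 0 * q 1)]
  congr 1
  simp only [joinPt_eq, Fin.sum_univ_two, cons_val_zero, cons_val_one]
  module

lemma congruence_two (hA : LinearIndependent ℂ A) (hs : gs.det ≠ 0) (ht : gt.det ≠ 0)
    (hu : gu.det ≠ 0) (hΦ : ∀ v, Φ.value v = canon A (gs *ᵥ v 0) (gt *ᵥ v 1) (gu *ᵥ v 2)) :
    Φ.congruence 2 = join ![A 0, A 2, A 1, A 3] := by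
  refine congruence_eq_join (linearIndependent_ab hA) _ _ _
    (fun v => wedge_value_two hΦ v _ _ rfl rfl)
    (χ := X (1, 0) * X (1, 1) * (X (0, 0) * X (1, 1) - X (0, 1) * X (1, 0)))
    (mul_ne_zero (mul_ne_zero (X_ne_zero _) (X_ne_zero _)) sub_ne_zero_aux) ?_
  intro p q hpq
  simp only [map_mul, map_sub, eval_X, cons_val_zero, cons_val_one, mul_ne_zero_iff] at hpq
  obtain ⟨⟨hp, hq⟩, hδ⟩ := hpq
  obtain ⟨v0, hv0⟩ := exists_mulVec_eq hs q
  obtain ⟨v1, hv1⟩ := exists_mulVec_eq ht ![p 0 * q 1, p 1 * q 0]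
  refine ⟨![v0, v1, 0], gu.det * (p 1 * q 0 - p 0 * q 1) * (q 0 * q 1),
    mul_ne_zero (mul_ne_zero hu fun h0 => hδ (by linear_combination -h0)) (mul_ne_zero hp hq), ?_⟩
  have e1 : (![v0, v1, 0] : Fin 3 → Fin 2 → ℂ) 0 = v0 := rfl
  have e2 : (![v0, v1, 0] : Fin 3 → Fin 2 → ℂ) 1 = v1 := rfl
  rw [e1, e2, hv0, hv1, mul_smul _ (q 0 * q 1)]
  congr 1
  simp only [joinPt_eq, Fin.sum_univ_two, cons_val_zero, cons_val_one]
  module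

lemma skew_lineOf {a b c d : Fin 4 → ℂ} (he : LinearIndependent ℂ ![a, b, c, d])
    (h : LinearIndependent ℂ ![a, b]) (h' : LinearIndependent ℂ ![c, d]) :
    Skew (lineOf a b h) (lineOf c d h') := by
  rw [skew_iff]
  intro v h1 h2
  obtain ⟨x, y, rfl⟩ := mem_lineOf.1 h1
  obtain ⟨z, w, h⟩ := mem_lineOf.1 h2
  obtain ⟨h0, h1, -, -⟩ := linearIndependent_fin_four_iff.1 he x y (-z) (-w) (by
    rw [← sub_eq_zero] at h
    rw [← neg_eq_zero, ← h]
    simp only [cons_val]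
    module)
  simp [h0, h1]

lemma linearIndependent_fst_of_vecs {a b c d : Fin 4 → ℂ}
    (he : LinearIndependent ℂ ![a, b, c, d]) : LinearIndependent ℂ ![a, b] := by
  have := linearIndependent_pair_fst he
  exact this

lemma linearIndependent_snd_of_vecs {a b c d : Fin 4 → ℂ}
    (he : LinearIndependent ℂ ![a, b, c, d]) : LinearIndependent ℂ ![c, d] := by
  have := linearIndependent_pair_snd he
  exact this

lemma focalLines_join_vecs {a b c d : Fin 4 → ℂ} (he : LinearIndependent ℂ ![a, b, c, d])
    (h : LinearIndependent ℂ ![a, b]) (h' : LinearIndependent ℂ ![c, d]) :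
    focalLines (join ![a, b, c, d]) = {lineOf a b h, lineOf c d h'} :=
  focalLines_join he

lemma Skew.ne {l m : Line} (h : Skew l m) : l ≠ m := by
  rintro rfl
  rw [skew_iff] at h
  have hb : l.1 = ⊥ := (Submodule.eq_bot_iff _).2 fun v hv => h v hv hv
  have := l.2
  rw [hb, finrank_bot] at this
  omega

lemma FocalConfiguration.unique {Φ : Tuple} {a b c x y a' b' c' x' y' : Line}
    (h : FocalConfiguration Φ a b c x y) (h' : FocalConfiguration Φ a' b' c' x' y') :
    a' = a ∧ b' = b ∧ c' = c ∧ ((x' = x ∧ y' = y) ∨ (x' = y ∧ y' = x)) := by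
  have hS := h'.focal_S.symm.trans h.focal_S
  have hT := h'.focal_T.symm.trans h.focal_T
  have hU := h'.focal_U.symm.trans h.focal_U
  rw [Set.pair_eq_pair_iff] at hS hT hU
  have hac := h.skew_ac.ne
  have hbc := h.skew_bc.ne
  rcases hT with ⟨ha, hc⟩ | ⟨ha, hc⟩
  · rcases hU with ⟨-, hb⟩ | ⟨ha', hb⟩
    · exact ⟨ha, hb, hc, hS⟩
    · exact absurd (ha.symm.trans ha') h.skew_ab.ne
  · rcases hU with ⟨ha', -⟩ | ⟨ha', -⟩
    · exact absurd (ha'.symm.trans ha) hac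
    · exact absurd (ha'.symm.trans ha) hbc

theorem IsGeneralForm.exists_focalConfiguration (h : IsGeneralForm Φ) :
    ∃ a b c x y : Line, FocalConfiguration Φ a b c x y := by
  obtain ⟨A, gs, gt, gu, hA, hs, ht, hu, hΦ⟩ := h
  have hac := linearIndependent_ac hA
  have hab := linearIndependent_ab hA
  have hbc := linearIndependent_bc hA
  have h0 := hA.ne_zero 0
  have h1 := hA.ne_zero 1
  have h2 := hA.ne_zero 2
  have h3 := hA.ne_zero 3
  have h01 : A 0 + A 1 ≠ 0 := hac.ne_zero 2
  have h23 : A 2 + A 3 ≠ 0 := hac.ne_zero 3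
  have ha : LinearIndependent ℂ ![A 0, A 2] := linearIndependent_fst_of_vecs hac
  have hb : LinearIndependent ℂ ![A 1, A 3] := linearIndependent_fst_of_vecs hbc
  have hc : LinearIndependent ℂ ![A 0 + A 1, A 2 + A 3] := linearIndependent_snd_of_vecs hac
  have hx : LinearIndependent ℂ ![A 0, A 1] := linearIndependent_pair_fst hA
  have hy : LinearIndependent ℂ ![A 2, A 3] := linearIndependent_pair_snd hA
  have hA' : ![A 0, A 1, A 2, A 3] = A := by ext i; fin_cases i <;> rfl
  have hmem0 : ∀ (p q : Fin 4 → ℂ) (h : LinearIndependent ℂ ![p, q]), p ∈ (lineOf p q h).1 :=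
    fun p q h => mem_lineOf.2 ⟨1, 0, by simp⟩
  have hmem1 : ∀ (p q : Fin 4 → ℂ) (h : LinearIndependent ℂ ![p, q]), q ∈ (lineOf p q h).1 :=
    fun p q h => mem_lineOf.2 ⟨0, 1, by simp⟩
  have hmem2 : ∀ (p q : Fin 4 → ℂ) (h : LinearIndependent ℂ ![p, q]),
      p + q ∈ (lineOf p q h).1 := fun p q h => mem_lineOf.2 ⟨1, 1, by simp⟩
  exact ⟨lineOf _ _ ha, lineOf _ _ hb, lineOf _ _ hc, lineOf _ _ hx, lineOf _ _ hy,
    { skew_xy := skew_lineOf (by rwa [hA']) _ _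
      skew_ab := skew_lineOf hab _ _
      skew_ac := skew_lineOf hac _ _
      skew_bc := skew_lineOf hbc _ _
      meet_x := ⟨meet_iff.2 ⟨_, h0, hmem0 _ _ _, hmem0 _ _ _⟩,
        meet_iff.2 ⟨_, h1, hmem0 _ _ _, hmem1 _ _ _⟩,
        meet_iff.2 ⟨_, h01, hmem0 _ _ _, hmem2 _ _ _⟩⟩
      meet_y := ⟨meet_iff.2 ⟨_, h2, hmem1 _ _ _, hmem0 _ _ _⟩,
        meet_iff.2 ⟨_, h3, hmem1 _ _ _, hmem1 _ _ _⟩,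
        meet_iff.2 ⟨_, h23, hmem1 _ _ _, hmem2 _ _ _⟩⟩
      focal_S := by rw [congruence_zero hA hs ht hu hΦ, focalLines_join hA]
      focal_T := by
        rw [congruence_one hA hs ht hu hΦ, focalLines_join_vecs hac ha hc]
      focal_U := by
        rw [congruence_two hA hs ht hu hΦ, focalLines_join_vecs hab ha hb] }⟩

theorem IsGeneralForm.isLinearCongruence (h : IsGeneralForm Φ) (m : Fin 3) :
    IsLinearCongruence (Φ.congruence m) := by
  obtain ⟨A, gs, gt, gu, hA, hs, ht, hu, hΦ⟩ := h
  fin_cases m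
  · exact (congruence_zero hA hs ht hu hΦ).symm ▸ isLinearCongruence_join hA
  · exact (congruence_one hA hs ht hu hΦ).symm ▸ isLinearCongruence_join (linearIndependent_ac hA)
  · exact (congruence_two hA hs ht hu hΦ).symm ▸ isLinearCongruence_join (linearIndependent_ab hA)

end General

/-! ### Maps in normal form are birational of type `(1, 2, 2)` -/

lemma irreducible_of_isHomogeneous_one {σ : Type*} {f : MvPolynomial σ ℂ}
    (hf : f.IsHomogeneous 1) (hne : f ≠ 0) : Irreducible f := by
  refine irreducible_of_totalDegree_eq_one (hf.totalDegree hne) fun x hx => ?_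
  rw [isUnit_iff_ne_zero]
  rintro rfl
  exact hne (MvPolynomial.ext _ _ fun i => by simpa using hx i)

/-- A linear form dividing `P` forces `P` to vanish on its hyperplane. -/
lemma not_dvd_of_eval {σ : Type*} {π f P : MvPolynomial σ ℂ} (hπ : Irreducible π)
    (hf : Irreducible f) (hπf : π ∣ f) {x : σ → ℂ} (hx : eval x f = 0) (hP : eval x P ≠ 0) :
    ¬ π ∣ P := by
  intro h
  have hfP : f ∣ P := (hπ.associated_of_dvd hf hπf).symm.dvd.trans h
  obtain ⟨r, rfl⟩ := hfP
  exact hP (by rw [map_mul, hx, zero_mul])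

lemma isRelPrime_of_irreducible_not_dvd {σ : Type*} {f g : MvPolynomial σ ℂ}
    (hf : f ≠ 0) (h : ∀ π, Irreducible π → π ∣ f → ¬ π ∣ g) : IsRelPrime f g := by
  intro d hdf hdg
  by_contra hd
  obtain ⟨π, hπ, hπd⟩ := WfDvdMonoid.exists_irreducible_factor hd (ne_zero_of_dvd_ne_zero hf hdf)
  exact h π hπ (hπd.trans hdf) (hπd.trans hdg)

lemma isRelPrime_mul_of_eval {σ : Type*} {a b P : MvPolynomial σ ℂ} (ha : Irreducible a)
    (hb : Irreducible b) {x y : σ → ℂ} (hx : eval x a = 0) (hxP : eval x P ≠ 0)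
    (hy : eval y b = 0) (hyP : eval y P ≠ 0) : IsRelPrime (a * b) P := by
  refine isRelPrime_of_irreducible_not_dvd (mul_ne_zero ha.ne_zero hb.ne_zero) fun π hπ h => ?_
  rcases hπ.prime.dvd_or_dvd h with h | h
  · exact not_dvd_of_eval hπ ha h hx hxP
  · exact not_dvd_of_eval hπ hb h hy hyP

lemma eval_poly (Φ : Tuple) (v : Fin 3 × Fin 2 → ℂ) (i : Fin 4) :
    eval v (Φ.poly i) = Φ.value (fun m j => v (m, j)) i := by
  simp [Tuple.poly, Tuple.value]

lemma eval_aeval_poly (Φ : Tuple) (v : Fin 3 × Fin 2 → ℂ) (r : MvPolynomial (Fin 4) ℂ) :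
    eval v (aeval Φ.poly r) = eval (Φ.value fun m j => v (m, j)) r := by
  have : (aeval v).comp (aeval Φ.poly) = aeval (R := ℂ) (Φ.value fun m j => v (m, j)) := by
    ext i
    simp only [AlgHom.comp_apply, aeval_X]
    exact eval_poly Φ v i
  have h := DFunLike.congr_fun this r
  simpa [coe_aeval_eq_eval] using h

lemma eval_aeval_inverse (Φ : Tuple) (ρ : Fin 3 → Fin 2 → MvPolynomial (Fin 4) ℂ)
    (x : Fin 4 → ℂ) (i : Fin 4) :
    eval x (aeval (fun mj : Fin 3 × Fin 2 => ρ mj.1 mj.2) (Φ.poly i)) =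
      Φ.value (fun m j => eval x (ρ m j)) i := by
  have : (aeval x).comp (aeval fun mj : Fin 3 × Fin 2 => ρ mj.1 mj.2) =
      aeval (R := ℂ) (fun mj : Fin 3 × Fin 2 => eval x (ρ mj.1 mj.2)) := by
    ext i
    simp only [AlgHom.comp_apply, aeval_X]
    simp
  have h := DFunLike.congr_fun this (Φ.poly i)
  rw [AlgHom.comp_apply] at h
  exact h.trans (eval_poly Φ _ i)

open Matrix

/-- Coordinates with respect to a basis of `ℂ⁴`. -/
lemma exists_coordinates {A : Fin 4 → Fin 4 → ℂ} (hA : LinearIndependent ℂ A) :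
    ∃ c : Fin 4 → Fin 4 → ℂ,
      (∀ x : Fin 4 → ℂ, (∑ k, c 0 k * x k) • A 0 + (∑ k, c 1 k * x k) • A 1 +
        (∑ k, c 2 k * x k) • A 2 + (∑ k, c 3 k * x k) • A 3 = x) ∧
      ∀ z0 z1 z2 z3 : ℂ, ∀ i,
        ∑ k, c i k * (z0 • A 0 + z1 • A 1 + z2 • A 2 + z3 • A 3) k = ![z0, z1, z2, z3] i := by
  have hU : IsUnit (Matrix.of A).det :=
    (Matrix.isUnit_iff_isUnit_det _).1
      ((Matrix.linearIndependent_rows_iff_isUnit (A := Matrix.of A)).1 hA)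
  refine ⟨fun i k => (Matrix.of A)⁻¹ k i, fun x => ?_, fun z0 z1 z2 z3 i => ?_⟩
  · have h : (x ᵥ* (Matrix.of A)⁻¹) ᵥ* Matrix.of A = x := by
      rw [vecMul_vecMul, nonsing_inv_mul _ hU, vecMul_one]
    conv_rhs => rw [← h]
    ext l
    simp [vecMul, dotProduct, Fin.sum_univ_four, mul_comm]
  · have h : (![z0, z1, z2, z3] ᵥ* Matrix.of A) ᵥ* (Matrix.of A)⁻¹ = ![z0, z1, z2, z3] := by
      rw [vecMul_vecMul, mul_nonsing_inv _ hU, vecMul_one]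
    conv_rhs => rw [← h]
    simp [vecMul, dotProduct, Fin.sum_univ_four, mul_comm]

/-- The pair of polynomials `g W`, for a `2 × 2` matrix `g` of complex numbers. -/
def polyMulVec {σ : Type*} (g : Matrix (Fin 2) (Fin 2) ℂ) (W : Fin 2 → MvPolynomial σ ℂ)
    (j : Fin 2) : MvPolynomial σ ℂ :=
  C (g j 0) * W 0 + C (g j 1) * W 1

lemma eval_polyMulVec {σ : Type*} (g : Matrix (Fin 2) (Fin 2) ℂ) (W : Fin 2 → MvPolynomial σ ℂ)
    (x : σ → ℂ) (j : Fin 2) :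
    eval x (polyMulVec g W j) = (g *ᵥ fun k => eval x (W k)) j := by
  simp [polyMulVec, mulVec, dotProduct, Fin.sum_univ_two]

lemma polyMulVec_polyMulVec_inv {σ : Type*} {g : Matrix (Fin 2) (Fin 2) ℂ} (hg : g.det ≠ 0)
    (W : Fin 2 → MvPolynomial σ ℂ) : polyMulVec g (polyMulVec g⁻¹ W) = W := by
  ext1 j
  refine MvPolynomial.funext fun x => ?_
  have h : (fun k => eval x (polyMulVec g⁻¹ W k)) = g⁻¹ *ᵥ fun k => eval x (W k) :=
    _root_.funext fun k => eval_polyMulVec _ _ _ _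
  rw [eval_polyMulVec, h, mulVec_mulVec, mul_nonsing_inv _ (isUnit_iff_ne_zero.2 hg), one_mulVec]

lemma IsRelPrime.polyMulVec_inv {σ : Type*} {g : Matrix (Fin 2) (Fin 2) ℂ} (hg : g.det ≠ 0)
    {W : Fin 2 → MvPolynomial σ ℂ} (hW : IsRelPrime (W 0) (W 1)) :
    IsRelPrime (polyMulVec g⁻¹ W 0) (polyMulVec g⁻¹ W 1) := by
  intro d h0 h1
  have h : ∀ j, d ∣ W j := fun j => by
    rw [← polyMulVec_polyMulVec_inv hg W]
    exact (h0.mul_left _).add (h1.mul_left _)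
  exact hW (h 0) (h 1)

lemma isHomogeneous_polyMulVec {σ : Type*} {g : Matrix (Fin 2) (Fin 2) ℂ} {n : ℕ}
    {W : Fin 2 → MvPolynomial σ ℂ} (hW : ∀ j, (W j).IsHomogeneous n) (j : Fin 2) :
    (polyMulVec g W j).IsHomogeneous n := by
  refine IsHomogeneous.add ?_ ?_
  · simpa using (isHomogeneous_C σ (g j 0)).mul (hW 0)
  · simpa using (isHomogeneous_C σ (g j 1)).mul (hW 1)

/-- The linear forms in the variables of the `m`-th factor given by the rows of `g`. -/
abbrev factorForm (g : Matrix (Fin 2) (Fin 2) ℂ) (m : Fin 3) (j : Fin 2) :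
    MvPolynomial (Fin 3 × Fin 2) ℂ :=
  polyMulVec g (fun k => X (m, k)) j

lemma eval_factorForm (g : Matrix (Fin 2) (Fin 2) ℂ) (m : Fin 3) (j : Fin 2)
    (v : Fin 3 × Fin 2 → ℂ) : eval v (factorForm g m j) = (g *ᵥ fun k => v (m, k)) j := by
  rw [eval_polyMulVec]; simp

lemma ne_zero_of_eval {σ : Type*} {f : MvPolynomial σ ℂ} {x : σ → ℂ} (h : eval x f ≠ 0) : f ≠ 0 :=
  fun h0 => h (by rw [h0, map_zero])

section

variable {Φ : Tuple} {A : Fin 4 → Fin 4 → ℂ} {gs gt gu : Matrix (Fin 2) (Fin 2) ℂ}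

lemma isTrilinearMap_of_canon (hA : LinearIndependent ℂ A) (hs : gs.det ≠ 0) (ht : gt.det ≠ 0)
    (hu : gu.det ≠ 0) (hΦ : ∀ v, Φ.value v = canon A (gs *ᵥ v 0) (gt *ᵥ v 1) (gu *ᵥ v 2)) :
    Φ.IsTrilinearMap := by
  intro d hd
  obtain ⟨c, -, hc⟩ := exists_coordinates hA
  have hpt : ∀ s t u : Fin 2 → ℂ, ∃ v : Fin 3 × Fin 2 → ℂ,
      (∀ j, eval v (factorForm gs 0 j) = s j) ∧ (∀ j, eval v (factorForm gt 1 j) = t j) ∧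
      (∀ j, eval v (factorForm gu 2 j) = u j) := by
    intro s t u
    obtain ⟨v0, h0⟩ := exists_mulVec_eq hs s
    obtain ⟨v1, h1⟩ := exists_mulVec_eq ht t
    obtain ⟨v2, h2⟩ := exists_mulVec_eq hu u
    refine ⟨fun mj => (![v0, v1, v2] : Fin 3 → Fin 2 → ℂ) mj.1 mj.2, fun j => ?_, fun j => ?_,
      fun j => ?_⟩ <;> rw [eval_factorForm]
    · exact congrFun h0 j
    · exact congrFun h1 j
    · exact congrFun h2 j
  set S := factorForm gs 0
  set T := factorForm gt 1
  set U := factorForm gu 2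
  -- the coordinates of `Φ` with respect to the basis `A`
  have hdvd : ∀ i, d ∣ (![S 0 * T 0 * (U 0 - U 1), S 0 * (U 0 * T 1 - T 0 * U 1),
      S 1 * T 1 * (U 0 - U 1), S 1 * (U 0 * T 1 - T 0 * U 1)] :
        Fin 4 → MvPolynomial (Fin 3 × Fin 2) ℂ) i := by
    intro i
    have h : (![S 0 * T 0 * (U 0 - U 1), S 0 * (U 0 * T 1 - T 0 * U 1),
      S 1 * T 1 * (U 0 - U 1), S 1 * (U 0 * T 1 - T 0 * U 1)] :
        Fin 4 → MvPolynomial (Fin 3 × Fin 2) ℂ) i = ∑ k, C (c i k) * Φ.poly k := by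
      refine MvPolynomial.funext fun v => ?_
      simp only [map_sum, map_mul, eval_C, eval_poly]
      rw [hΦ]
      simp only [canon, hc, ← eval_factorForm]
      fin_cases i <;> simp [S, T, U]
    rw [h]
    exact Finset.dvd_sum fun k _ => (hd k).mul_left _
  have hd0 := hdvd 0
  have hd1 := hdvd 1
  have hd3 := hdvd 3
  simp only [cons_val] at hd0 hd1 hd3
  have hS : ∀ j, (S j).IsHomogeneous 1 := isHomogeneous_polyMulVec fun k => isHomogeneous_X _ _
  have hT : ∀ j, (T j).IsHomogeneous 1 := isHomogeneous_polyMulVec fun k => isHomogeneous_X _ _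
  have hU : ∀ j, (U j).IsHomogeneous 1 := isHomogeneous_polyMulVec fun k => isHomogeneous_X _ _
  obtain ⟨v, hvS, hvT, hvU⟩ := hpt ![1, 1] ![1, 1] ![1, 0]
  have hS0 : Irreducible (S 0) := irreducible_of_isHomogeneous_one (hS 0)
    (ne_zero_of_eval (x := v) (by simp [hvS]))
  have hS1 : Irreducible (S 1) := irreducible_of_isHomogeneous_one (hS 1)
    (ne_zero_of_eval (x := v) (by simp [hvS]))
  have hT0 : Irreducible (T 0) := irreducible_of_isHomogeneous_one (hT 0)
    (ne_zero_of_eval (x := v) (by simp [hvT]))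
  have hD : Irreducible (U 0 - U 1) := irreducible_of_isHomogeneous_one ((hU 0).sub (hU 1))
    (ne_zero_of_eval (x := v) (by simp [hvU]))
  by_contra hunit
  obtain ⟨π, hπ, hπd⟩ := WfDvdMonoid.exists_irreducible_factor hunit
    (ne_zero_of_dvd_ne_zero (mul_ne_zero (mul_ne_zero hS0.ne_zero hT0.ne_zero) hD.ne_zero) hd0)
  obtain ⟨x, hxS, hxT, hxU⟩ := hpt ![0, 1] ![0, 1] ![1, 0]
  obtain ⟨y, hyS, hyT, hyU⟩ := hpt ![0, 1] ![0, 1] ![1, 1]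
  by_cases hG : π ∣ U 0 * T 1 - T 0 * U 1
  · rcases hπ.prime.dvd_or_dvd (hπd.trans hd0) with h | h
    · rcases hπ.prime.dvd_or_dvd h with h | h
      · exact not_dvd_of_eval hπ hS0 h (x := x) (by simp [hxS]) (by simp [hxT, hxU]) hG
      · exact not_dvd_of_eval hπ hT0 h (x := x) (by simp [hxT]) (by simp [hxT, hxU]) hG
    · exact not_dvd_of_eval hπ hD h (x := y) (by simp [hyU]) (by simp [hyT, hyU]) hG
  · exact not_dvd_of_eval hπ hS0 ((hπ.prime.dvd_or_dvd (hπd.trans hd1)).resolve_right hG)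
      (x := x) (by simp [hxS]) (by simp [hxS])
      ((hπ.prime.dvd_or_dvd (hπd.trans hd3)).resolve_right hG)

theorem isInverse_of_canon (hA : LinearIndependent ℂ A) (hs : gs.det ≠ 0) (ht : gt.det ≠ 0)
    (hu : gu.det ≠ 0) (hΦ : ∀ v, Φ.value v = canon A (gs *ᵥ v 0) (gt *ᵥ v 1) (gu *ᵥ v 2)) :
    ∃ ρ, Φ.IsInverse ρ ![1, 2, 2] := by
  obtain ⟨c, hcx, hcz⟩ := exists_coordinates hA
  let z : Fin 4 → MvPolynomial (Fin 4) ℂ := fun i => ∑ k, C (c i k) * X k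
  have hz : ∀ i, (z i).IsHomogeneous 1 := fun i => isHomogeneous_linear _
  have hze : ∀ x i, eval x (z i) = ∑ k, c i k * x k := fun x i => by simp [z]
  let W : Fin 3 → Fin 2 → MvPolynomial (Fin 4) ℂ :=
    ![![z 1, z 3], ![z 0 * z 3, z 1 * z 2], ![(z 0 - z 1) * z 3, (z 2 - z 3) * z 1]]
  let g : Fin 3 → Matrix (Fin 2) (Fin 2) ℂ := ![gs, gt, gu]
  have hg : ∀ m, (g m).det ≠ 0 := by intro m; fin_cases m <;> assumption
  have hpt : ∀ z0 z1 z2 z3 : ℂ, ∃ x : Fin 4 → ℂ, ∀ i, eval x (z i) = ![z0, z1, z2, z3] i :=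
    fun z0 z1 z2 z3 => ⟨z0 • A 0 + z1 • A 1 + z2 • A 2 + z3 • A 3, fun i => by
      rw [hze, hcz]⟩
  -- the value of `W m` at `Φ v` is a multiple of `g m *ᵥ v m`
  obtain ⟨κ, hκ, hκ0⟩ : ∃ κ : Fin 3 → (Fin 3 → Fin 2 → ℂ) → ℂ,
      (∀ m v, (fun j => eval (Φ.value v) (W m j)) = κ m v • (g m *ᵥ v m)) ∧
      ∃ v, ∀ m, κ m v ≠ 0 ∧ ∃ j, v m j ≠ 0 := by
    refine ⟨fun m v => (![(gu *ᵥ v 2) 0 * (gt *ᵥ v 1) 1 - (gt *ᵥ v 1) 0 * (gu *ᵥ v 2) 1,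
      (gs *ᵥ v 0) 0 * (gs *ᵥ v 0) 1 *
        ((gu *ᵥ v 2) 0 * (gt *ᵥ v 1) 1 - (gt *ᵥ v 1) 0 * (gu *ᵥ v 2) 1) *
        ((gu *ᵥ v 2) 0 - (gu *ᵥ v 2) 1),
      (gs *ᵥ v 0) 0 * (gs *ᵥ v 0) 1 *
        ((gu *ᵥ v 2) 0 * (gt *ᵥ v 1) 1 - (gt *ᵥ v 1) 0 * (gu *ᵥ v 2) 1) *
        ((gt *ᵥ v 1) 0 - (gt *ᵥ v 1) 1)] : Fin 3 → ℂ) m, ?_, ?_⟩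
    · intro m v
      ext j
      fin_cases m <;> fin_cases j <;>
      · simp only [W, g, Fin.mk_zero, Fin.mk_one, Fin.reduceFinMk, Fin.isValue, cons_val,
          cons_val_zero, cons_val_one, map_mul, map_sub, hze, hΦ, canon, hcz, Pi.smul_apply,
          smul_eq_mul]
        ring
    · obtain ⟨v0, h0⟩ := exists_mulVec_eq hs ![1, 1]
      obtain ⟨v1, h1⟩ := exists_mulVec_eq ht ![1, 0]
      obtain ⟨v2, h2⟩ := exists_mulVec_eq hu ![2, 1]
      have hne : ∀ (g : Matrix (Fin 2) (Fin 2) ℂ) (v w : Fin 2 → ℂ), g *ᵥ v = w → w 0 ≠ 0 →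
          ∃ j, v j ≠ 0 := by
        intro g v w h hw
        by_contra hv
        push Not at hv
        have : v = 0 := _root_.funext hv
        rw [this, mulVec_zero] at h
        exact hw (by rw [← h]; rfl)
      refine ⟨![v0, v1, v2], fun m => ?_⟩
      fin_cases m
      · refine ⟨?_, hne _ _ _ h0 (by simp)⟩
        simp [h1, h2]
      · refine ⟨?_, hne _ _ _ h1 (by simp)⟩
        simp [h0, h1, h2]; norm_num
      · refine ⟨?_, hne _ _ _ h2 (by simp)⟩
        simp [h0, h1, h2]
  have hleft : ∀ m v j, eval (Φ.value v) (polyMulVec (g m)⁻¹ (W m) j) = κ m v * v m j := by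
    intro m v j
    rw [eval_polyMulVec, hκ, mulVec_smul, mulVec_mulVec,
      nonsing_inv_mul _ (isUnit_iff_ne_zero.2 (hg m)), one_mulVec]
    rfl
  have hright : ∀ x i, Φ.value (fun m j => eval x (polyMulVec (g m)⁻¹ (W m) j)) i =
      eval x (z 1 * z 3 * (z 0 * z 3 - z 1 * z 2)) * x i := by
    intro x i
    have hgW : ∀ m, g m *ᵥ (fun j => eval x (polyMulVec (g m)⁻¹ (W m) j)) =
        fun j => eval x (W m j) := by
      intro m
      have h : (fun j => eval x (polyMulVec (g m)⁻¹ (W m) j)) =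
        (g m)⁻¹ *ᵥ fun k => eval x (W m k) := _root_.funext fun k => eval_polyMulVec _ _ _ _
      rw [h, mulVec_mulVec, mul_nonsing_inv _ (isUnit_iff_ne_zero.2 (hg m)), one_mulVec]
    have e0 := hgW 0
    have e1 := hgW 1
    have e2 := hgW 2
    rw [hΦ, show gs = g 0 from rfl, show gt = g 1 from rfl, show gu = g 2 from rfl, e0, e1, e2]
    rw [← congrFun (hcx x) i]
    simp only [← hze]
    simp only [W, canon, Fin.isValue, cons_val, cons_val_zero, cons_val_one, map_mul, map_sub,
      Pi.add_apply, Pi.smul_apply, smul_eq_mul]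
    generalize eval x (z 0) = y0
    generalize eval x (z 1) = y1
    generalize eval x (z 2) = y2
    generalize eval x (z 3) = y3
    ring
  have hright' : ∀ x i, eval x (aeval (fun mj : Fin 3 × Fin 2 =>
      polyMulVec (g mj.1)⁻¹ (W mj.1) mj.2) (Φ.poly i)) =
        eval x (z 1 * z 3 * (z 0 * z 3 - z 1 * z 2)) * x i := fun x i =>
    (eval_aeval_inverse Φ (fun m => polyMulVec (g m)⁻¹ (W m)) x i).trans (hright x i)
  have hirr : ∀ i, Irreducible (z i) := fun i => by
    obtain ⟨x, hx⟩ := hpt 1 1 1 1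
    refine irreducible_of_isHomogeneous_one (hz i) (ne_zero_of_eval (x := x) ?_)
    rw [hx]; fin_cases i <;> simp
  have hirr01 : Irreducible (z 0 - z 1) := by
    obtain ⟨x, hx⟩ := hpt 1 0 0 0
    exact irreducible_of_isHomogeneous_one ((hz 0).sub (hz 1))
      (ne_zero_of_eval (x := x) (by simp [hx]))
  refine ⟨fun m => polyMulVec (g m)⁻¹ (W m), ?_, ?_, ?_, ?_, ?_, ?_⟩
  · intro m j
    refine isHomogeneous_polyMulVec (fun j => ?_) j
    fin_cases m <;> fin_cases j
    · exact hz 1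
    · exact hz 3
    · exact (hz 0).mul (hz 3)
    · exact (hz 1).mul (hz 2)
    · exact ((hz 0).sub (hz 1)).mul (hz 3)
    · exact ((hz 2).sub (hz 3)).mul (hz 1)
  · intro m
    refine IsRelPrime.polyMulVec_inv (hg m) ?_
    fin_cases m
    · obtain ⟨x, hx⟩ := hpt 0 0 0 1
      exact isRelPrime_of_irreducible_not_dvd (hirr 1).ne_zero fun π hπ h =>
        not_dvd_of_eval hπ (hirr 1) h (x := x) (by simp [hx]) (by simp [W, hx])
    · obtain ⟨x, hx⟩ := hpt 0 1 1 1
      obtain ⟨y, hy⟩ := hpt 1 1 1 0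
      exact isRelPrime_mul_of_eval (hirr 0) (hirr 3) (x := x) (y := y) (by simp [hx])
        (by simp [W, hx]) (by simp [hy]) (by simp [W, hy])
    · obtain ⟨x, hx⟩ := hpt 1 1 1 0
      exact isRelPrime_mul_of_eval hirr01 (hirr 3) (x := x) (y := x) (by simp [hx])
        (by simp [W, hx]) (by simp [hx]) (by simp [W, hx])
  · intro m
    obtain ⟨v, hv⟩ := hκ0
    obtain ⟨hκm, j, hj⟩ := hv m
    refine ⟨j, ne_zero_of_eval (x := fun mj => v mj.1 mj.2) ?_⟩
    rw [eval_aeval_poly, hleft]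
    exact mul_ne_zero hκm hj
  · intro m
    refine MvPolynomial.funext fun v => ?_
    simp only [map_mul, eval_aeval_poly, hleft, eval_X]
    ring
  · obtain ⟨x, hx⟩ := hpt 1 1 0 1
    obtain ⟨i, hi⟩ : ∃ i, x i ≠ 0 := by
      by_contra h
      push Not at h
      have := hx 1
      rw [hze] at this
      simp [h] at this
    refine ⟨i, ne_zero_of_eval (x := x) ?_⟩
    rw [hright']
    exact mul_ne_zero (by simp [hx]) hi
  · intro i i'
    refine MvPolynomial.funext fun x => ?_
    simp only [map_mul, hright', eval_X]
    ring

theorem IsGeneralForm.mem_birationalOfType (h : IsGeneralForm Φ) :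
    Φ ∈ birationalOfType ![1, 2, 2] := by
  obtain ⟨A, gs, gt, gu, hA, hs, ht, hu, hΦ⟩ := h
  exact ⟨isTrilinearMap_of_canon hA hs ht hu hΦ, isInverse_of_canon hA hs ht hu hΦ⟩

end

/-! ### Spans of trilinear forms and degenerate restrictions -/

/-- The trilinear form with coefficients `a`. -/
def tri (a : Fin 2 → Fin 2 → Fin 2 → ℂ) (s t u : Fin 2 → ℂ) : ℂ :=
  ∑ j, ∑ k, ∑ l, a j k l * (s j * t k * u l)

/-- The bilinear form with coefficients `g`. -/
def bil (g : Fin 2 → Fin 2 → ℂ) (t u : Fin 2 → ℂ) : ℂ :=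
  ∑ k, ∑ l, g k l * (t k * u l)

/-- `L` is a linear combination of the trilinear forms `P`, `R`, `s₀ g`, `s₁ g`. -/
def InSpan (P R : Fin 2 → Fin 2 → Fin 2 → ℂ) (g : Fin 2 → Fin 2 → ℂ)
    (L : (Fin 2 → ℂ) → (Fin 2 → ℂ) → (Fin 2 → ℂ) → ℂ) : Prop :=
  ∃ α β γ₀ γ₁ : ℂ, ∀ s t u,
    L s t u = α * tri P s t u + β * tri R s t u + (γ₀ * s 0 + γ₁ * s 1) * bil g t u

/-- What is used of a trilinear birational map `(P, s₀ g, R, s₁ g)` of type `(1, 2, 2)`: the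
components are linearly independent, the second and third factor of the inverse are not given by
linear forms, and for general `s` the restriction to `{s} × ℙ¹ × ℙ¹` has a base point. -/
structure BaseData (P R : Fin 2 → Fin 2 → Fin 2 → ℂ) (g : Fin 2 → Fin 2 → ℂ)
    (c : MvPolynomial (Fin 2) ℂ) : Prop where
  indep : ∀ α β γ₀ γ₁ : ℂ,
    (∀ s t u, α * tri P s t u + β * tri R s t u + (γ₀ * s 0 + γ₁ * s 1) * bil g t u = 0) →
    α = 0 ∧ β = 0 ∧ γ₀ = 0 ∧ γ₁ = 0
  not_linear_t : ∀ b : (Fin 2 → ℂ) → (Fin 2 → ℂ) → ℂ,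
    InSpan P R g (fun s t u => b s u * t 0) → InSpan P R g (fun s t u => b s u * t 1) →
    ∀ s u, b s u = 0
  not_linear_u : ∀ b : (Fin 2 → ℂ) → (Fin 2 → ℂ) → ℂ,
    InSpan P R g (fun s t u => b s t * u 0) → InSpan P R g (fun s t u => b s t * u 1) →
    ∀ s t, b s t = 0
  ne_zero : c ≠ 0
  base : ∀ s, eval s c ≠ 0 → ∃ m n : Fin 2 → ℂ, m ≠ 0 ∧ n ≠ 0 ∧
    tri P s m n = 0 ∧ tri R s m n = 0 ∧ bil g m n = 0

lemma tri_swap (a : Fin 2 → Fin 2 → Fin 2 → ℂ) (s t u : Fin 2 → ℂ) :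
    tri (fun j k l => a j l k) s t u = tri a s u t := by
  simp only [tri, Fin.sum_univ_two]; ring

lemma bil_swap (g : Fin 2 → Fin 2 → ℂ) (t u : Fin 2 → ℂ) :
    bil (fun k l => g l k) t u = bil g u t := by
  simp only [bil, Fin.sum_univ_two]; ring

section

variable {P R : Fin 2 → Fin 2 → Fin 2 → ℂ} {g : Fin 2 → Fin 2 → ℂ}
  {c : MvPolynomial (Fin 2) ℂ}

lemma InSpan.swap {L : (Fin 2 → ℂ) → (Fin 2 → ℂ) → (Fin 2 → ℂ) → ℂ}
    (h : InSpan (fun j k l => P j l k) (fun j k l => R j l k) (fun k l => g l k) L) :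
    InSpan P R g (fun s t u => L s u t) := by
  obtain ⟨α, β, γ₀, γ₁, h⟩ := h
  refine ⟨α, β, γ₀, γ₁, fun s t u => ?_⟩
  simp only [h, tri_swap, bil_swap]

lemma InSpan.comb {L M : (Fin 2 → ℂ) → (Fin 2 → ℂ) → (Fin 2 → ℂ) → ℂ}
    (hL : InSpan P R g L) (hM : InSpan P R g M) (x y : ℂ) :
    InSpan P R g (fun s t u => x * L s t u + y * M s t u) := by
  obtain ⟨α, β, γ₀, γ₁, hL⟩ := hL
  obtain ⟨α', β', γ₀', γ₁', hM⟩ := hM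
  refine ⟨x * α + y * α', x * β + y * β', x * γ₀ + y * γ₀', x * γ₁ + y * γ₁', fun s t u => ?_⟩
  simp only [hL, hM]; ring

lemma BaseData.swap (h : BaseData P R g c) :
    BaseData (fun j k l => P j l k) (fun j k l => R j l k) (fun k l => g l k) c where
  indep α β γ₀ γ₁ h0 := h.indep α β γ₀ γ₁ fun s t u => by
    have := h0 s u t
    simpa only [tri_swap, bil_swap] using this
  not_linear_t b h0 h1 := h.not_linear_u b h0.swap h1.swap
  not_linear_u b h0 h1 := h.not_linear_t b h0.swap h1.swap
  ne_zero := h.ne_zero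
  base s hs := by
    obtain ⟨m, n, hm, hn, h1, h2, h3⟩ := h.base s hs
    exact ⟨n, m, hn, hm, by rwa [tri_swap], by rwa [tri_swap], by rwa [bil_swap]⟩

/-- A polynomial that vanishes outside a hypersurface vanishes everywhere. -/
lemma eval_eq_zero_of_generic {σ : Type*} {c E : MvPolynomial σ ℂ} (hc : c ≠ 0)
    (h : ∀ s, eval s c ≠ 0 → eval s E = 0) : E = 0 := by
  have : E * c = 0 := by
    refine MvPolynomial.funext fun s => ?_
    rw [map_mul, map_zero]
    by_cases hs : eval s c = 0
    · rw [hs, mul_zero]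
    · rw [h s hs, zero_mul]
  exact (mul_eq_zero.1 this).resolve_right hc

lemma exists_smul_of_det_eq_zero {a b : Fin 2 → ℂ} (ha : a ≠ 0) (h : a 0 * b 1 = a 1 * b 0) :
    ∃ μ : ℂ, b = μ • a := by
  by_cases h0 : a 0 = 0
  · have h1 : a 1 ≠ 0 := fun h1 => ha (by ext i; fin_cases i <;> assumption)
    refine ⟨b 1 / a 1, ?_⟩
    ext i
    fin_cases i
    · have : b 0 = 0 := by
        rw [h0, zero_mul] at h
        exact (mul_eq_zero.1 h.symm).resolve_left h1
      simp [h0, this]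
    · simp [h1]
  · refine ⟨b 0 / a 0, ?_⟩
    ext i
    fin_cases i
    · simp [h0]
    · simp; field_simp; linear_combination h

lemma linear_mul_linear_eq_zero {a e : Fin 2 → ℂ} (ha : a ≠ 0)
    (h : ∀ s : Fin 2 → ℂ, (a 0 * s 0 + a 1 * s 1) * (e 0 * s 0 + e 1 * s 1) = 0) : e = 0 := by
  have h0 := h ![1, 0]
  have h1 := h ![0, 1]
  have h2 := h ![1, 1]
  simp only [Matrix.cons_val_zero, Matrix.cons_val_one, mul_one, mul_zero, add_zero, zero_add]
    at h0 h1 h2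
  by_cases ha0 : a 0 = 0
  · have ha1 : a 1 ≠ 0 := fun h1 => ha (by ext i; fin_cases i <;> assumption)
    have he1 : e 1 = 0 := (mul_eq_zero.1 h1).resolve_left ha1
    rw [ha0, he1, zero_add, add_zero] at h2
    ext i
    fin_cases i
    · exact (mul_eq_zero.1 h2).resolve_left ha1
    · exact he1
  · have he0 : e 0 = 0 := (mul_eq_zero.1 h0).resolve_left ha0
    have : a 0 * e 1 = 0 := by rw [he0] at h2; linear_combination h2 - h1
    ext i
    fin_cases i
    · exact he0
    · exact (mul_eq_zero.1 this).resolve_left ha0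

/-- A `2 × 2` matrix of linear forms in two variables with vanishing determinant has constantly
dependent rows or constantly dependent columns. -/
lemma rows_or_columns_dependent {a b d e : Fin 2 → ℂ}
    (h : ∀ s : Fin 2 → ℂ, (a 0 * s 0 + a 1 * s 1) * (e 0 * s 0 + e 1 * s 1) =
      (b 0 * s 0 + b 1 * s 1) * (d 0 * s 0 + d 1 * s 1)) :
    (∃ α β : ℂ, (α ≠ 0 ∨ β ≠ 0) ∧ α • a + β • d = 0 ∧ α • b + β • e = 0) ∨
    (∃ n : Fin 2 → ℂ, n ≠ 0 ∧ n 0 • a + n 1 • b = 0 ∧ n 0 • d + n 1 • e = 0) := by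
  by_cases ha : a = 0
  · subst ha
    by_cases hb : b = 0
    · subst hb
      exact Or.inl ⟨1, 0, by simp⟩
    · have hd : d = 0 := linear_mul_linear_eq_zero hb fun s => by rw [← h]; simp
      subst hd
      exact Or.inr ⟨![1, 0], fun h => by simpa using congrFun h 0, by simp, by simp⟩
  · have hs := h ![a 1, -a 0]
    simp only [Matrix.cons_val_zero, Matrix.cons_val_one] at hs
    have hprod : (a 0 * b 1 - a 1 * b 0) * (a 0 * d 1 - a 1 * d 0) = 0 := by
      linear_combination -hs
    rcases mul_eq_zero.1 hprod with hb | hd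
    · obtain ⟨μ, rfl⟩ := exists_smul_of_det_eq_zero ha (sub_eq_zero.1 hb)
      have he : e - μ • d = 0 := linear_mul_linear_eq_zero ha fun s => by
        have := h s
        simp only [Pi.sub_apply, Pi.smul_apply, smul_eq_mul] at this ⊢
        linear_combination this
      refine Or.inr ⟨![μ, -1], fun h => by simpa using congrFun h 1, by simp, ?_⟩
      rw [sub_eq_zero.1 he]; simp
    · obtain ⟨ν, rfl⟩ := exists_smul_of_det_eq_zero ha (sub_eq_zero.1 hd)
      have he : e - ν • b = 0 := linear_mul_linear_eq_zero ha fun s => by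
        have := h s
        simp only [Pi.sub_apply, Pi.smul_apply, smul_eq_mul] at this ⊢
        linear_combination this
      refine Or.inl ⟨ν, -1, by simp, by simp, ?_⟩
      rw [sub_eq_zero.1 he]; simp

lemma exists_det_eq_one {m : Fin 2 → ℂ} (hm : m ≠ 0) :
    ∃ m' : Fin 2 → ℂ, m' 0 * m 1 - m' 1 * m 0 = 1 := by
  by_cases hm0 : m 0 = 0
  · have hm1 : m 1 ≠ 0 := fun h1 => hm (by ext i; fin_cases i <;> assumption)
    exact ⟨![(m 1)⁻¹, 0], by simp [hm1]⟩
  · exact ⟨![0, -(m 0)⁻¹], by simp [hm0]⟩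

/-- A linear form vanishing at `m` is a multiple of `t ↦ t₀ m₁ - t₁ m₀`. -/
lemma linear_eq_mul {m m' : Fin 2 → ℂ} (hm' : m' 0 * m 1 - m' 1 * m 0 = 1) {x y : ℂ}
    (h : x * m 0 + y * m 1 = 0) (t : Fin 2 → ℂ) :
    x * t 0 + y * t 1 = (t 0 * m 1 - t 1 * m 0) * (x * m' 0 + y * m' 1) := by
  linear_combination -(x * t 0 + y * t 1) * hm' + (t 1 * m' 0 - t 0 * m' 1) * h

/-- If `g` vanishes on the line `t = m` and the restriction of the map to it is degenerate for all
`s`, there is a constant base point: otherwise some combination `αP + βR` vanishes on `t = m` as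
well, and then the `u`-coordinate of the inverse would be given by linear forms. -/
lemma BaseData.exists_base_of_degenerate (h : BaseData P R g c) {m : Fin 2 → ℂ} (hm : m ≠ 0)
    (hg : ∀ u, bil g m u = 0)
    (hdet : ∀ s, tri P s m ![1, 0] * tri R s m ![0, 1] = tri P s m ![0, 1] * tri R s m ![1, 0]) :
    ∃ m n : Fin 2 → ℂ, m ≠ 0 ∧ n ≠ 0 ∧ bil g m n = 0 ∧
      ∀ s, tri P s m n = 0 ∧ tri R s m n = 0 := by
  have hdet' := rows_or_columns_dependent
    (a := fun j => P j 0 0 * m 0 + P j 1 0 * m 1) (b := fun j => P j 0 1 * m 0 + P j 1 1 * m 1)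
    (d := fun j => R j 0 0 * m 0 + R j 1 0 * m 1) (e := fun j => R j 0 1 * m 0 + R j 1 1 * m 1)
    (fun s => by
      have := hdet s
      simp only [tri, Fin.sum_univ_two, Matrix.cons_val_zero, Matrix.cons_val_one] at this
      linear_combination this)
  rcases hdet' with ⟨α, β, hαβ, h0, h1⟩ | ⟨n, hn, h0, h1⟩
  · exfalso
    -- `g` and `αP + βR` are divisible by the linear form `t₀ m₁ - t₁ m₀`
    obtain ⟨m', hm'⟩ := exists_det_eq_one hm
    have hg0 := hg ![1, 0]
    have hg1 := hg ![0, 1]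
    simp only [bil, Fin.sum_univ_two, Matrix.cons_val_zero, Matrix.cons_val_one, mul_one, mul_zero,
      add_zero, zero_add] at hg0 hg1
    obtain ⟨g₂, hg₂⟩ : ∃ g₂ : Fin 2 → ℂ, ∀ t u,
        bil g t u = (t 0 * m 1 - t 1 * m 0) * (g₂ 0 * u 0 + g₂ 1 * u 1) := by
      refine ⟨fun l => g 0 l * m' 0 + g 1 l * m' 1, fun t u => ?_⟩
      simp only [bil, Fin.sum_univ_two]
      linear_combination u 0 * linear_eq_mul hm' hg0 t + u 1 * linear_eq_mul hm' hg1 t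
    obtain ⟨r, hr⟩ : ∃ r : Fin 2 → Fin 2 → ℂ, ∀ s t u,
        α * tri P s t u + β * tri R s t u = (t 0 * m 1 - t 1 * m 0) * bil r s u := by
      refine ⟨fun j l => α * (P j 0 l * m' 0 + P j 1 l * m' 1) +
        β * (R j 0 l * m' 0 + R j 1 l * m' 1), fun s t u => ?_⟩
      simp only [tri, bil, Fin.sum_univ_two]
      have key : ∀ j l, (α * P j 0 l + β * R j 0 l) * m 0 + (α * P j 1 l + β * R j 1 l) * m 1 = 0 := by
        intro j
        have e0 := congrFun h0 j
        have e1 := congrFun h1 j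
        simp only [Pi.add_apply, Pi.smul_apply, smul_eq_mul, Pi.zero_apply] at e0 e1
        exact Fin.forall_fin_two.2 ⟨by linear_combination e0, by linear_combination e1⟩
      linear_combination s 0 * u 0 * linear_eq_mul hm' (key 0 0) t +
        s 0 * u 1 * linear_eq_mul hm' (key 0 1) t + s 1 * u 0 * linear_eq_mul hm' (key 1 0) t +
        s 1 * u 1 * linear_eq_mul hm' (key 1 1) t
    -- with `r = r₀(s) u₀ + r₁(s) u₁`, the form `b = (t₀ m₁ - t₁ m₀) (r₀ g₂₁ - r₁ g₂₀)` is such that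
    -- `u₀ b` and `u₁ b` are combinations of `αP + βR` and `s₀ g`, `s₁ g`
    have hb := h.not_linear_u
      (fun s t => (t 0 * m 1 - t 1 * m 0) * bil r s ![g₂ 1, -g₂ 0])
      ⟨g₂ 1 * α, g₂ 1 * β, -r 0 1, -r 1 1, fun s t u => by
        have e1 := hr s t u
        have e2 := hg₂ t u
        simp only [bil, Fin.sum_univ_two, Matrix.cons_val_zero, Matrix.cons_val_one] at e1 e2 ⊢
        linear_combination -g₂ 1 * e1 + (r 0 1 * s 0 + r 1 1 * s 1) * e2⟩
      ⟨-g₂ 0 * α, -g₂ 0 * β, r 0 0, r 1 0, fun s t u => by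
        have e1 := hr s t u
        have e2 := hg₂ t u
        simp only [bil, Fin.sum_univ_two, Matrix.cons_val_zero, Matrix.cons_val_one] at e1 e2 ⊢
        linear_combination g₂ 0 * e1 - (r 0 0 * s 0 + r 1 0 * s 1) * e2⟩
    have i1 := h.indep (g₂ 1 * α) (g₂ 1 * β) (-r 0 1) (-r 1 1) fun s t u => by
      have e1 := hr s t u
      have e2 := hg₂ t u
      have e3 := hb s t
      simp only [bil, Fin.sum_univ_two, Matrix.cons_val_zero, Matrix.cons_val_one] at e1 e2 e3 ⊢
      linear_combination g₂ 1 * e1 - (r 0 1 * s 0 + r 1 1 * s 1) * e2 + u 0 * e3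
    have i0 := h.indep (-g₂ 0 * α) (-g₂ 0 * β) (r 0 0) (r 1 0) fun s t u => by
      have e1 := hr s t u
      have e2 := hg₂ t u
      have e3 := hb s t
      simp only [bil, Fin.sum_univ_two, Matrix.cons_val_zero, Matrix.cons_val_one] at e1 e2 e3 ⊢
      linear_combination -g₂ 0 * e1 + (r 0 0 * s 0 + r 1 0 * s 1) * e2 + u 1 * e3
    have hg₂0 : g₂ 0 = 0 ∧ g₂ 1 = 0 := by
      rcases hαβ with hα | hβ
      · exact ⟨by simpa [hα] using i0.1, by simpa [hα] using i1.1⟩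
      · exact ⟨by simpa [hβ] using i0.2.1, by simpa [hβ] using i1.2.1⟩
    have := (h.indep 0 0 1 0 fun s t u => by rw [hg₂, hg₂0.1, hg₂0.2]; ring).2.2.1
    exact one_ne_zero this
  · refine ⟨m, n, hm, hn, hg n, fun s => ⟨?_, ?_⟩⟩
    · have e0 := congrFun h0 0
      have e1 := congrFun h0 1
      simp only [Pi.add_apply, Pi.smul_apply, smul_eq_mul, Pi.zero_apply] at e0 e1
      simp only [tri, Fin.sum_univ_two]
      linear_combination s 0 * e0 + s 1 * e1
    · have e0 := congrFun h1 0
      have e1 := congrFun h1 1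
      simp only [Pi.add_apply, Pi.smul_apply, smul_eq_mul, Pi.zero_apply] at e0 e1
      simp only [tri, Fin.sum_univ_two]
      linear_combination s 0 * e0 + s 1 * e1

end

/-! ### Pencils of binary quadratic forms with a common root -/

/-- The linear form `a₀ t₀ + a₁ t₁`. -/
def linPoly (a : Fin 2 → ℂ) : MvPolynomial (Fin 2) ℂ := C (a 0) * X 0 + C (a 1) * X 1

/-- The binary quadratic form `bil q t t`. -/
def diagPoly (q : Fin 2 → Fin 2 → ℂ) : MvPolynomial (Fin 2) ℂ :=
  ∑ k, ∑ l, C (q k l) * (X k * X l)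

@[simp] lemma eval_linPoly (a t : Fin 2 → ℂ) : eval t (linPoly a) = a 0 * t 0 + a 1 * t 1 := by
  simp [linPoly]

@[simp] lemma eval_diagPoly (q : Fin 2 → Fin 2 → ℂ) (t : Fin 2 → ℂ) :
    eval t (diagPoly q) = bil q t t := by
  simp [diagPoly, bil]

lemma linPoly_smul (x : ℂ) (a : Fin 2 → ℂ) : linPoly (x • a) = C x * linPoly a := by
  simp [linPoly]; ring

lemma linPoly_ne_zero {a : Fin 2 → ℂ} (ha : a ≠ 0) : linPoly a ≠ 0 := by
  intro h
  apply ha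
  have h0 := congrArg (eval ![1, 0]) h
  have h1 := congrArg (eval ![0, 1]) h
  simp at h0 h1
  ext i
  fin_cases i <;> assumption

/-- The zero of the linear form with coefficients `a`. -/
def linRoot (a : Fin 2 → ℂ) : Fin 2 → ℂ := ![a 1, -a 0]

lemma linRoot_ne_zero {a : Fin 2 → ℂ} (ha : a ≠ 0) : linRoot a ≠ 0 := by
  intro h
  apply ha
  have h0 := congrFun h 0
  have h1 := congrFun h 1
  simp [linRoot] at h0 h1
  ext i
  fin_cases i <;> assumption

lemma linPoly_dvd_linPoly {a b : Fin 2 → ℂ} (ha : a ≠ 0) (h : eval (linRoot a) (linPoly b) = 0) :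
    ∃ μ, linPoly b = C μ * linPoly a := by
  simp [linRoot] at h
  obtain ⟨μ, rfl⟩ := exists_smul_of_det_eq_zero (b := b) ha (by linear_combination -h)
  exact ⟨μ, linPoly_smul μ a⟩

lemma linPoly_dvd_diagPoly {a : Fin 2 → ℂ} (ha : a ≠ 0) {q : Fin 2 → Fin 2 → ℂ}
    (h : eval (linRoot a) (diagPoly q) = 0) : ∃ b, diagPoly q = linPoly a * linPoly b := by
  obtain ⟨m', hm'⟩ := exists_det_eq_one (linRoot_ne_zero ha)
  simp only [linRoot, eval_diagPoly, bil, Fin.sum_univ_two, Matrix.cons_val_zero,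
    Matrix.cons_val_one] at h hm'
  -- expand at `t = -(a₀ t₀ + a₁ t₁) m' + (m'₀ t₁ - m'₁ t₀) m`, where `m` is the root of `a`
  let z : ℂ := bil q m' m'
  let y : ℂ := bil q m' (linRoot a) + bil q (linRoot a) m'
  refine ⟨![a 0 * z + m' 1 * y, a 1 * z - m' 0 * y], MvPolynomial.funext fun t => ?_⟩
  have h0 : t 0 = -(a 0 * t 0 + a 1 * t 1) * m' 0 + (m' 0 * t 1 - m' 1 * t 0) * a 1 := by
    linear_combination -t 0 * hm'
  have h1 : t 1 = -(a 0 * t 0 + a 1 * t 1) * m' 1 - (m' 0 * t 1 - m' 1 * t 0) * a 0 := by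
    linear_combination -t 1 * hm'
  rw [map_mul, eval_linPoly, eval_linPoly, eval_diagPoly]
  simp only [z, y, bil, linRoot, Fin.sum_univ_two, Matrix.cons_val_zero, Matrix.cons_val_one]
  generalize hx : a 0 * t 0 + a 1 * t 1 = x at h0 h1 ⊢
  generalize hw : m' 0 * t 1 - m' 1 * t 0 = w at h0 h1
  have e : ∀ z y : ℂ, (a 0 * z + m' 1 * y) * t 0 + (a 1 * z - m' 0 * y) * t 1 = x * z - w * y := by
    intro z y; rw [← hx, ← hw]; ring
  rw [e, h0, h1]
  linear_combination w ^ 2 * h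

lemma exists_diagPoly_eq (q : Fin 2 → Fin 2 → ℂ) :
    ∃ a b, diagPoly q = linPoly a * linPoly b := by
  obtain ⟨a, b, h0, h1, h2⟩ := exists_mul_eq_quadratic (q 0 0) (q 0 1 + q 1 0) (q 1 1)
  refine ⟨a, b, MvPolynomial.funext fun t => ?_⟩
  simp only [eval_diagPoly, map_mul, eval_linPoly, bil, Fin.sum_univ_two]
  linear_combination -t 0 ^ 2 * h0 - t 1 ^ 2 * h1 - t 0 * t 1 * h2

lemma tri_eq_sum (a : Fin 2 → Fin 2 → Fin 2 → ℂ) (s t u : Fin 2 → ℂ) :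
    tri a s t u = s 0 * bil (a 0) t u + s 1 * bil (a 1) t u := by
  simp only [tri, bil, Fin.sum_univ_two]; ring

lemma bil_smul_smul (q : Fin 2 → Fin 2 → ℂ) (x : ℂ) (t : Fin 2 → ℂ) :
    bil q (x • t) (x • t) = x ^ 2 * bil q t t := by
  simp [bil]; ring

section

variable {a b : Fin 2 → Fin 2 → Fin 2 → ℂ} {c : MvPolynomial (Fin 2) ℂ}

lemma common_root_of_det_ne_zero (hc : c ≠ 0)
    (h : ∀ s, eval s c ≠ 0 → ∃ m : Fin 2 → ℂ, m ≠ 0 ∧ tri a s m m = 0 ∧ tri b s m m = 0)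
    (hdet : diagPoly (a 0) * diagPoly (b 1) ≠ diagPoly (a 1) * diagPoly (b 0)) :
    ∃ m : Fin 2 → ℂ, m ≠ 0 ∧ ∀ s, tri a s m m = 0 ∧ tri b s m m = 0 := by
  classical
  by_contra! hcon
  set E : MvPolynomial (Fin 2) ℂ :=
    diagPoly (a 0) * diagPoly (b 1) - diagPoly (a 1) * diagPoly (b 0) with hE
  have hE0 : E ≠ 0 := sub_ne_zero.2 hdet
  have hEt : ∀ t, eval t E = bil (a 0) t t * bil (b 1) t t - bil (a 1) t t * bil (b 0) t t :=
    fun t => by simp [hE]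
  have hEs : ∀ (x : ℂ) t, eval (x • t) E = x ^ 4 * eval t E := fun x t => by
    simp only [hEt, bil_smul_smul]; ring
  let e : Polynomial ℂ := aeval ![1, Polynomial.X] E
  have he : ∀ x, e.eval x = eval ![1, x] E := fun x => by
    have : (Polynomial.evalRingHom x).comp (aeval ![1, Polynomial.X] :
        MvPolynomial (Fin 2) ℂ →ₐ[ℂ] Polynomial ℂ).toRingHom = eval ![1, x] := by
      apply MvPolynomial.ringHom_ext
      · intro r; simp
      · intro i; fin_cases i <;> simp
    exact congrArg (fun f => f E) this
  have he0 : e ≠ 0 := by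
    intro h0
    refine hE0 (eval_eq_zero_of_generic (X_ne_zero (0 : Fin 2)) fun t ht => ?_)
    rw [eval_X] at ht
    have : t = t 0 • ![1, t 1 / t 0] := by
      ext i; fin_cases i <;> simp; field_simp
    rw [this, hEs, ← he, h0]; simp
  let M : Finset (Fin 2 → ℂ) := insert ![0, 1] (e.roots.toFinset.image fun x => ![1, x])
  have hM : ∀ m ∈ M, m ≠ 0 := by
    intro m hm
    simp only [M, Finset.mem_insert, Finset.mem_image] at hm
    rcases hm with rfl | ⟨x, -, rfl⟩
    · exact fun h => by simpa using congrFun h 1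
    · exact fun h => by simpa using congrFun h 0
  -- every point of `M` is excluded by a nonzero linear form in `s`
  have key : ∀ m : Fin 2 → ℂ, m ≠ 0 → ∃ f : MvPolynomial (Fin 2) ℂ, f ≠ 0 ∧
      ∀ s, tri a s m m = 0 → tri b s m m = 0 → eval s f = 0 := by
    intro m hm
    obtain ⟨s, hs⟩ := hcon m hm
    by_cases h1 : tri a s m m = 0
    · refine ⟨linPoly ![bil (b 0) m m, bil (b 1) m m], fun h0 => hs h1 ?_, fun s _ h => ?_⟩
      · have := congrArg (eval s) h0
        simp at this
        rw [tri_eq_sum]; linear_combination this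
      · rw [tri_eq_sum] at h; simp; linear_combination h
    · refine ⟨linPoly ![bil (a 0) m m, bil (a 1) m m], fun h0 => h1 ?_, fun s h _ => ?_⟩
      · have := congrArg (eval s) h0
        simp at this
        rw [tri_eq_sum]; linear_combination this
      · rw [tri_eq_sum] at h; simp; linear_combination h
  choose f hf0 hf using key
  have hprod : c * X 0 * ∏ m : M, f m.1 (hM _ m.2) = 0 := by
    refine MvPolynomial.funext fun s => ?_
    rw [map_mul, map_mul, map_prod, map_zero, eval_X]
    by_cases hs : eval s c = 0
    · simp [hs]
    by_cases hs0 : s 0 = 0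
    · simp [hs0]
    obtain ⟨m, hm, h1, h2⟩ := h s hs
    have hEm : eval m E = 0 := by
      rw [tri_eq_sum] at h1 h2
      rw [hEt]
      refine mul_left_cancel₀ hs0 ?_
      linear_combination bil (b 1) m m * h1 - bil (a 1) m m * h2
    obtain ⟨x, m', hx, hm', rfl⟩ : ∃ (x : ℂ) (m' : Fin 2 → ℂ), x ≠ 0 ∧ m' ∈ M ∧ m = x • m' := by
      by_cases hm0 : m 0 = 0
      · have hm1 : m 1 ≠ 0 := fun h1 => hm (by ext i; fin_cases i <;> assumption)
        refine ⟨m 1, ![0, 1], hm1, Finset.mem_insert_self _ _, ?_⟩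
        ext i; fin_cases i <;> simp [hm0]
      · have : m = m 0 • ![1, m 1 / m 0] := by
          ext i; fin_cases i <;> simp; field_simp
        refine ⟨m 0, ![1, m 1 / m 0], hm0, Finset.mem_insert_of_mem ?_, this⟩
        refine Finset.mem_image.2 ⟨m 1 / m 0, ?_, rfl⟩
        rw [Multiset.mem_toFinset, Polynomial.mem_roots he0, Polynomial.IsRoot.def, he]
        rw [this, hEs] at hEm
        exact (mul_eq_zero.1 hEm).resolve_left (pow_ne_zero 4 hm0)
    have hz : eval s (f m' (hM m' hm')) = 0 := by
      have e : ∀ q : Fin 2 → Fin 2 → Fin 2 → ℂ, tri q s (x • m') (x • m') =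
          x ^ 2 * tri q s m' m' := fun q => by
        simp only [tri_eq_sum, bil_smul_smul]; ring
      rw [e] at h1 h2
      exact hf _ _ s ((mul_eq_zero.1 h1).resolve_left (pow_ne_zero 2 hx))
        ((mul_eq_zero.1 h2).resolve_left (pow_ne_zero 2 hx))
    exact mul_eq_zero_of_right _ (Finset.prod_eq_zero (Finset.mem_univ ⟨m', hm'⟩) hz)
  exact mul_ne_zero (mul_ne_zero hc (X_ne_zero _)) (Finset.prod_ne_zero_iff.2 fun m _ => hf0 _ _)
    hprod

/-- Two families of binary quadratic forms, depending linearly on `s`, that have a common root for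
general `s` have a constant common root, or are linearly dependent, or have a common factor that is
linear in `s` and in `t`. -/
lemma common_root_cases (hc : c ≠ 0)
    (h : ∀ s, eval s c ≠ 0 → ∃ m : Fin 2 → ℂ, m ≠ 0 ∧ tri a s m m = 0 ∧ tri b s m m = 0) :
    (∃ m : Fin 2 → ℂ, m ≠ 0 ∧ ∀ s, tri a s m m = 0 ∧ tri b s m m = 0) ∨
    (∃ α β : ℂ, (α ≠ 0 ∨ β ≠ 0) ∧ ∀ s t, α * tri a s t t + β * tri b s t t = 0) ∨
    (∃ (d : Fin 2 → Fin 2 → ℂ) (β γ : Fin 2 → ℂ), ∀ s t,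
      tri a s t t = bil d s t * (β 0 * t 0 + β 1 * t 1) ∧
      tri b s t t = bil d s t * (γ 0 * t 0 + γ 1 * t 1)) := by
  by_cases hdet : diagPoly (a 0) * diagPoly (b 1) = diagPoly (a 1) * diagPoly (b 0)
  swap
  · exact Or.inl (common_root_of_det_ne_zero hc h hdet)
  -- a common factor depending only on `s`
  have hs : ∀ (x y : ℂ) (p q : Fin 2 → Fin 2 → ℂ), (x ≠ 0 ∨ y ≠ 0) →
      (∀ s t, tri a s t t = (x * s 0 + y * s 1) * bil p t t) →
      (∀ s t, tri b s t t = (x * s 0 + y * s 1) * bil q t t) →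
      ∃ m : Fin 2 → ℂ, m ≠ 0 ∧ ∀ s, tri a s m m = 0 ∧ tri b s m m = 0 := by
    intro x y p q hxy h1 h2
    have hl : linPoly ![x, y] ≠ 0 := linPoly_ne_zero fun h0 => by
      have e0 := congrFun h0 0
      have e1 := congrFun h0 1
      simp at e0 e1
      tauto
    obtain ⟨s, hs⟩ : ∃ s, eval s (c * linPoly ![x, y]) ≠ 0 := by
      by_contra! hcon
      exact mul_ne_zero hc hl (MvPolynomial.funext fun s => by rw [hcon, map_zero])
    rw [map_mul, eval_linPoly] at hs
    simp only [Matrix.cons_val_zero, Matrix.cons_val_one] at hs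
    obtain ⟨m, hm, e1, e2⟩ := h s (left_ne_zero_of_mul hs)
    rw [h1] at e1
    rw [h2] at e2
    refine ⟨m, hm, fun s' => ?_⟩
    rw [h1, h2, (mul_eq_zero.1 e1).resolve_left (right_ne_zero_of_mul hs),
      (mul_eq_zero.1 e2).resolve_left (right_ne_zero_of_mul hs), mul_zero]
    exact ⟨rfl, rfl⟩
  have toEval : ∀ {p q : MvPolynomial (Fin 2) ℂ}, p = q → ∀ t, eval t p = eval t q :=
    fun h t => by rw [h]
  by_cases ha : diagPoly (a 0) = 0
  · rw [ha, zero_mul] at hdet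
    have ha' := toEval ha
    simp only [eval_diagPoly, map_zero] at ha'
    rcases mul_eq_zero.1 hdet.symm with h1 | h1
    · have h1' := toEval h1
      simp only [eval_diagPoly, map_zero] at h1'
      exact Or.inr (Or.inl ⟨1, 0, by simp, fun s t => by simp [tri_eq_sum, ha', h1']⟩)
    · have h1' := toEval h1
      simp only [eval_diagPoly, map_zero] at h1'
      exact Or.inl (hs 0 1 (a 1) (b 1) (by simp) (fun s t => by simp [tri_eq_sum, ha'])
        fun s t => by simp [tri_eq_sum, h1'])
  obtain ⟨a₁, a₂, ha12⟩ := exists_diagPoly_eq (a 0)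
  rw [ha12] at ha
  have ha₁ : a₁ ≠ 0 := by rintro rfl; simp [linPoly] at ha
  have ha₂ : a₂ ≠ 0 := by rintro rfl; simp [linPoly] at ha
  have e0 := toEval hdet (linRoot a₁)
  rw [ha12, map_mul, map_mul, map_mul] at e0
  have hroot : ∀ p : Fin 2 → ℂ, eval (linRoot p) (linPoly p) = 0 := fun p => by
    simp [linRoot]; ring
  rw [hroot, zero_mul, zero_mul] at e0
  have hA := toEval ha12
  simp only [eval_diagPoly, map_mul, eval_linPoly] at hA
  rcases mul_eq_zero.1 e0.symm with h1 | h1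
  · obtain ⟨b₁, hb₁⟩ := linPoly_dvd_diagPoly ha₁ h1
    have hB := toEval hb₁
    simp only [eval_diagPoly, map_mul, eval_linPoly] at hB
    have h2 : linPoly a₂ * diagPoly (b 1) = linPoly b₁ * diagPoly (b 0) := by
      refine mul_left_cancel₀ (linPoly_ne_zero ha₁) ?_
      rw [← mul_assoc, ← mul_assoc, ← ha12, ← hb₁, hdet]
    have e1 := toEval h2 (linRoot a₂)
    rw [map_mul, map_mul, hroot, zero_mul] at e1
    rcases mul_eq_zero.1 e1.symm with h3 | h3
    · obtain ⟨μ, hμ⟩ := linPoly_dvd_linPoly ha₂ h3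
      have hD : diagPoly (b 1) = C μ * diagPoly (b 0) := by
        refine mul_left_cancel₀ (linPoly_ne_zero ha₂) ?_
        rw [h2, hμ]; ring
      have hμ' := toEval hμ
      have hD' := toEval hD
      simp only [eval_diagPoly, map_mul, eval_linPoly, eval_C] at hμ' hD'
      refine Or.inl (hs 1 μ (a 0) (b 0) (by simp) (fun s t => ?_) fun s t => ?_)
      · rw [tri_eq_sum, hB, hA, hμ']; ring
      · rw [tri_eq_sum, hD']; ring
    · obtain ⟨e, he⟩ := linPoly_dvd_diagPoly ha₂ h3
      have hD : diagPoly (b 1) = linPoly b₁ * linPoly e := by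
        refine mul_left_cancel₀ (linPoly_ne_zero ha₂) ?_
        rw [h2, he]; ring
      have hC' := toEval he
      have hD' := toEval hD
      simp only [eval_diagPoly, map_mul, eval_linPoly] at hC' hD'
      refine Or.inr (Or.inr ⟨![a₂, b₁], a₁, e, fun s t => ⟨?_, ?_⟩⟩)
      · rw [tri_eq_sum, hB, hA]; simp [bil]; ring
      · rw [tri_eq_sum, hC', hD']; simp [bil]; ring
  · obtain ⟨e, he⟩ := linPoly_dvd_diagPoly ha₁ h1
    have hC' := toEval he
    simp only [eval_diagPoly, map_mul, eval_linPoly] at hC'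
    have h2 : linPoly a₂ * diagPoly (b 1) = diagPoly (a 1) * linPoly e := by
      refine mul_left_cancel₀ (linPoly_ne_zero ha₁) ?_
      rw [← mul_assoc, ← ha12, hdet, he]; ring
    have e1 := toEval h2 (linRoot a₂)
    rw [map_mul, map_mul, hroot, zero_mul] at e1
    rcases mul_eq_zero.1 e1.symm with h3 | h3
    · obtain ⟨b₁, hb₁⟩ := linPoly_dvd_diagPoly ha₂ h3
      have hD : diagPoly (b 1) = linPoly b₁ * linPoly e := by
        refine mul_left_cancel₀ (linPoly_ne_zero ha₂) ?_
        rw [h2, hb₁]; ring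
      have hB := toEval hb₁
      have hD' := toEval hD
      simp only [eval_diagPoly, map_mul, eval_linPoly] at hB hD'
      refine Or.inr (Or.inr ⟨![a₁, b₁], a₂, e, fun s t => ⟨?_, ?_⟩⟩)
      · rw [tri_eq_sum, hB, hA]; simp [bil]; ring
      · rw [tri_eq_sum, hC', hD']; simp [bil]; ring
    · obtain ⟨μ, hμ⟩ := linPoly_dvd_linPoly ha₂ h3
      have hD : diagPoly (b 1) = C μ * diagPoly (a 1) := by
        refine mul_left_cancel₀ (linPoly_ne_zero ha₂) ?_
        rw [h2, hμ]; ring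
      have hμ' := toEval hμ
      have hD' := toEval hD
      simp only [eval_diagPoly, map_mul, eval_linPoly, eval_C] at hμ' hD'
      refine Or.inr (Or.inl ⟨μ, -1, by simp, fun s t => ?_⟩)
      rw [tri_eq_sum, tri_eq_sum, hD', hC', hA, hμ']; ring

end

/-! ### The base points of the restrictions to `{s} × ℙ¹ × ℙ¹` are constant -/

section

variable {P R : Fin 2 → Fin 2 → Fin 2 → ℂ} {g : Fin 2 → Fin 2 → ℂ}
  {c : MvPolynomial (Fin 2) ℂ}

/-- The condition that `P` and `R` be linearly dependent on `{s} × {m} × ℙ¹` is polynomial in `s`.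
It holds if they have a common zero there. -/
lemma exists_degenerate_poly (P R : Fin 2 → Fin 2 → Fin 2 → ℂ) (m : Fin 2 → ℂ) :
    ∃ D : MvPolynomial (Fin 2) ℂ, (∀ s, eval s D =
      tri P s m ![1, 0] * tri R s m ![0, 1] - tri P s m ![0, 1] * tri R s m ![1, 0]) ∧
      ∀ s (x : ℂ) n, x ≠ 0 → n ≠ 0 → tri P s (x • m) n = 0 → tri R s (x • m) n = 0 →
        eval s D = 0 := by
  have lin : ∀ (a : Fin 2 → Fin 2 → Fin 2 → ℂ) (n : Fin 2 → ℂ),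
      ∀ s, eval s (linPoly ![bil (a 0) m n, bil (a 1) m n]) = tri a s m n := fun a n s => by
    rw [tri_eq_sum]; simp; ring
  refine ⟨linPoly ![bil (P 0) m ![1, 0], bil (P 1) m ![1, 0]] *
      linPoly ![bil (R 0) m ![0, 1], bil (R 1) m ![0, 1]] -
    linPoly ![bil (P 0) m ![0, 1], bil (P 1) m ![0, 1]] *
      linPoly ![bil (R 0) m ![1, 0], bil (R 1) m ![1, 0]], fun s => by simp only [map_sub, map_mul,
        lin], ?_⟩
  intro s x n hx hn h1 h2
  simp only [map_sub, map_mul, lin]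
  have e : ∀ a : Fin 2 → Fin 2 → Fin 2 → ℂ,
      tri a s (x • m) n = x * (n 0 * tri a s m ![1, 0] + n 1 * tri a s m ![0, 1]) := fun a => by
    simp [tri]; ring
  rw [e] at h1 h2
  replace h1 := (mul_eq_zero.1 h1).resolve_left hx
  replace h2 := (mul_eq_zero.1 h2).resolve_left hx
  by_cases hn0 : n 0 = 0
  · have hn1 : n 1 ≠ 0 := fun h1 => hn (by ext i; fin_cases i <;> assumption)
    refine mul_left_cancel₀ hn1 ?_
    linear_combination tri P s m ![1, 0] * h2 - tri R s m ![1, 0] * h1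
  · refine mul_left_cancel₀ hn0 ?_
    linear_combination tri R s m ![0, 1] * h1 - tri P s m ![0, 1] * h2

lemma BaseData.exists_base_of_det_eq_zero (h : BaseData P R g c)
    (hg : g 0 0 * g 1 1 = g 0 1 * g 1 0) :
    ∃ m n : Fin 2 → ℂ, m ≠ 0 ∧ n ≠ 0 ∧ bil g m n = 0 ∧ ∀ s, tri P s m n = 0 ∧ tri R s m n = 0 := by
  obtain ⟨p, q, h00, h01, h10, h11⟩ := exists_factor_of_det_eq_zero hg
  have hgpq : ∀ t u, bil g t u = (p 0 * t 0 + p 1 * t 1) * (q 0 * u 0 + q 1 * u 1) := fun t u => by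
    simp only [bil, Fin.sum_univ_two, h00, h01, h10, h11]; ring
  have hp : p ≠ 0 := by
    rintro rfl
    exact one_ne_zero (h.indep 0 0 1 0 fun s t u => by rw [hgpq]; simp).2.2.1
  have hq : q ≠ 0 := by
    rintro rfl
    exact one_ne_zero (h.indep 0 0 1 0 fun s t u => by rw [hgpq]; simp).2.2.1
  have hp0 : ∀ u, bil g (linRoot p) u = 0 := fun u => by
    rw [hgpq]; simp only [linRoot, Matrix.cons_val_zero, Matrix.cons_val_one]; ring
  have hq0 : ∀ t, bil g t (linRoot q) = 0 := fun t => by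
    rw [hgpq]; simp only [linRoot, Matrix.cons_val_zero, Matrix.cons_val_one]; ring
  obtain ⟨D, hD, hD0⟩ := exists_degenerate_poly P R (linRoot p)
  obtain ⟨D', hD', hD0'⟩ := exists_degenerate_poly (fun j k l => P j l k) (fun j k l => R j l k)
    (linRoot q)
  have hDD : D * D' = 0 := by
    refine eval_eq_zero_of_generic h.ne_zero fun s hs => ?_
    obtain ⟨m, n, hm, hn, h1, h2, h3⟩ := h.base s hs
    rw [hgpq] at h3
    rw [map_mul]
    rcases mul_eq_zero.1 h3 with h3 | h3
    · obtain ⟨x, rfl⟩ := exists_smul_of_det_eq_zero (b := m) (linRoot_ne_zero hp) (by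
        simp [linRoot]; linear_combination h3)
      rw [hD0 s x n (fun hx => hm (by rw [hx, zero_smul])) hn h1 h2, zero_mul]
    · obtain ⟨x, rfl⟩ := exists_smul_of_det_eq_zero (b := n) (linRoot_ne_zero hq) (by
        simp [linRoot]; linear_combination h3)
      rw [hD0' s x m (fun hx => hn (by rw [hx, zero_smul])) hm (by rwa [tri_swap])
        (by rwa [tri_swap]), mul_zero]
  rcases mul_eq_zero.1 hDD with h0 | h0
  · refine h.exists_base_of_degenerate (linRoot_ne_zero hp) hp0 fun s => ?_
    rw [← sub_eq_zero, ← hD, h0, map_zero]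
  · obtain ⟨n, m, hn, hm, h1, h2⟩ := h.swap.exists_base_of_degenerate (linRoot_ne_zero hq)
      (fun u => by rw [bil_swap]; exact hq0 u) fun s => by rw [← sub_eq_zero, ← hD', h0, map_zero]
    refine ⟨m, n, hm, hn, (bil_swap g n m).symm.trans (h1), fun s => ?_⟩
    exact ⟨(tri_swap P s n m).symm.trans (h2 s).1, (tri_swap R s n m).symm.trans (h2 s).2⟩

/-- A trilinear form in `(s, t, w)` is determined by its values at `t = w` up to a multiple of
`t₀ w₁ - t₁ w₀`. -/
lemma tri_eq_of_diag {a : Fin 2 → Fin 2 → Fin 2 → ℂ} {d : Fin 2 → Fin 2 → ℂ} {β : Fin 2 → ℂ}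
    (h : ∀ s t, tri a s t t = bil d s t * (β 0 * t 0 + β 1 * t 1)) :
    ∃ x y : ℂ, ∀ s t w, tri a s t w =
      bil d s t * (β 0 * w 0 + β 1 * w 1) + (x * s 0 + y * s 1) * (t 0 * w 1 - t 1 * w 0) := by
  refine ⟨a 0 0 1 - d 0 0 * β 1, a 1 0 1 - d 1 0 * β 1, fun s t w => ?_⟩
  have e1 := h ![1, 0] ![1, 0]
  have e2 := h ![1, 0] ![0, 1]
  have e3 := h ![1, 0] ![1, 1]
  have e4 := h ![0, 1] ![1, 0]
  have e5 := h ![0, 1] ![0, 1]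
  have e6 := h ![0, 1] ![1, 1]
  simp [tri, bil] at e1 e2 e3 e4 e5 e6
  simp only [tri, bil, Fin.sum_univ_two]
  linear_combination s 0 * t 0 * w 0 * e1 + s 0 * t 1 * w 1 * e2 + s 0 * t 1 * w 0 * (e3 - e1 - e2)
    + s 1 * t 0 * w 0 * e4 + s 1 * t 1 * w 1 * e5 + s 1 * t 1 * w 0 * (e6 - e4 - e5)

lemma BaseData.exists_base_of_det_ne_zero (h : BaseData P R g c)
    (hg : g 0 0 * g 1 1 - g 0 1 * g 1 0 ≠ 0) :
    ∃ m n : Fin 2 → ℂ, m ≠ 0 ∧ n ≠ 0 ∧ bil g m n = 0 ∧ ∀ s, tri P s m n = 0 ∧ tri R s m n = 0 := by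
  -- `g = 0` is the graph of the isomorphism `G`
  let G : (Fin 2 → ℂ) → Fin 2 → ℂ := fun w =>
    ![g 0 1 * w 0 + g 1 1 * w 1, -(g 0 0 * w 0 + g 1 0 * w 1)]
  set δ := g 0 0 * g 1 1 - g 0 1 * g 1 0 with hδ
  have hG : ∀ t w, bil g t (G w) = δ * (t 0 * w 1 - t 1 * w 0) := fun t w => by
    simp [bil, G, hδ]; ring
  have hGw : ∀ w, w ≠ 0 → G w ≠ 0 := fun w hw h0 => by
    have h1 := congrFun h0 0
    have h2 := congrFun h0 1
    simp [G] at h1 h2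
    apply hw
    ext i
    fin_cases i
    · refine mul_left_cancel₀ hg ?_
      simp only [Pi.zero_apply, Fin.zero_eta, mul_zero]; rw [hδ]
      linear_combination -g 1 1 * h2 - g 1 0 * h1
    · refine mul_left_cancel₀ hg ?_
      simp only [Pi.zero_apply, Fin.mk_one, mul_zero]; rw [hδ]
      linear_combination g 0 0 * h1 + g 0 1 * h2
  have hGsurj : ∀ u, ∃ w, u = G w := fun u => by
    refine ⟨![(-g 1 0 * u 0 - g 1 1 * u 1) / δ, (g 0 0 * u 0 + g 0 1 * u 1) / δ], ?_⟩
    ext i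
    fin_cases i
    · simp [G]; field_simp; rw [hδ]; ring
    · simp [G]; field_simp; rw [hδ]; ring
  let q : (Fin 2 → Fin 2 → Fin 2 → ℂ) → Fin 2 → Fin 2 → Fin 2 → ℂ := fun a j k l =>
    a j k 0 * g l 1 - a j k 1 * g l 0
  have hq : ∀ a s t w, tri (q a) s t w = tri a s t (G w) := fun a s t w => by
    simp [tri, q, G]; ring
  -- a combination of `P` and `R` vanishing on the graph is a combination of `s₀ g` and `s₁ g`
  have hdep : ∀ α β : ℂ, (∀ s t, α * tri (q P) s t t + β * tri (q R) s t t = 0) →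
      α = 0 ∧ β = 0 := by
    intro α β h0
    obtain ⟨x, y, hxy⟩ := tri_eq_of_diag (a := fun j k l => α * q P j k l + β * q R j k l) (d := 0)
      (β := 0) fun s t => by
        have := h0 s t
        simp [tri, bil] at this ⊢
        linear_combination this
    have := h.indep α β (-x / δ) (-y / δ) fun s t u => by
      obtain ⟨w, rfl⟩ := hGsurj u
      have e := hxy s t w
      rw [hG, ← hq, ← hq]
      field_simp
      simp [tri, bil] at e ⊢
      linear_combination e
    exact ⟨this.1, this.2.1⟩
  rcases common_root_cases (a := q P) (b := q R) h.ne_zero fun s hs => by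
    obtain ⟨m, n, hm, hn, h1, h2, h3⟩ := h.base s hs
    obtain ⟨w, rfl⟩ := hGsurj n
    have hw : w ≠ 0 := by
      rintro rfl
      apply hn; ext i; fin_cases i <;> simp [G]
    rw [hG] at h3
    obtain ⟨x, rfl⟩ := exists_smul_of_det_eq_zero (b := m) hw (by
      linear_combination -(mul_eq_zero.1 h3).resolve_left hg)
    have hx : x ≠ 0 := fun hx => hm (by rw [hx, zero_smul])
    have e : ∀ a : Fin 2 → Fin 2 → Fin 2 → ℂ,
        tri a s (x • w) (G w) = x * tri (q a) s w w := fun a => by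
      simp [tri, q, G]; ring
    rw [e] at h1 h2
    exact ⟨w, hw, (mul_eq_zero.1 h1).resolve_left hx, (mul_eq_zero.1 h2).resolve_left hx⟩
    with ⟨m, hm, h1⟩ | ⟨α, β, hαβ, h1⟩ | ⟨d, β, γ, h1⟩
  · refine ⟨m, G m, hm, hGw m hm, by rw [hG]; ring, fun s => ?_⟩
    rw [← hq, ← hq]
    exact h1 s
  · have := hdep α β h1
    tauto
  · exfalso
    have hβγ : β 0 * γ 1 - β 1 * γ 0 ≠ 0 := by
      intro h0
      by_cases hβ : β = 0
      · exact one_ne_zero (hdep 1 0 fun s t => by rw [(h1 s t).1, hβ]; simp).1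
      · obtain ⟨μ, rfl⟩ := exists_smul_of_det_eq_zero (b := γ) hβ (by linear_combination h0)
        have := hdep μ (-1) fun s t => by
          rw [(h1 s t).1, (h1 s t).2]; simp; ring
        simpa using this.2
    obtain ⟨x, y, hxy⟩ := tri_eq_of_diag fun s t => (h1 s t).1
    obtain ⟨x', y', hxy'⟩ := tri_eq_of_diag fun s t => (h1 s t).2
    -- every linear form in `u = G w` is a combination `zβ + z'γ`
    have hspan : ∀ v : Fin 2 → ℂ, InSpan P R g fun s t u => bil d s t * (v 0 * u 0 + v 1 * u 1) := by
      intro v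
      obtain ⟨z, z', hz⟩ : ∃ z z' : ℂ, ∀ w, v 0 * G w 0 + v 1 * G w 1 =
          z * (β 0 * w 0 + β 1 * w 1) + z' * (γ 0 * w 0 + γ 1 * w 1) := by
        let k0 := v 0 * g 0 1 - v 1 * g 0 0
        let k1 := v 0 * g 1 1 - v 1 * g 1 0
        refine ⟨(k0 * γ 1 - k1 * γ 0) / (β 0 * γ 1 - β 1 * γ 0),
          (k1 * β 0 - k0 * β 1) / (β 0 * γ 1 - β 1 * γ 0), fun w => ?_⟩
        rw [div_mul_eq_mul_div, div_mul_eq_mul_div, ← add_div, eq_div_iff hβγ]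
        simp [G, k0, k1]; ring
      refine ⟨z, z', -(z * x + z' * x') / δ, -(z * y + z' * y') / δ, fun s t u => ?_⟩
      obtain ⟨w, rfl⟩ := hGsurj u
      have e1 := hxy s t w
      have e2 := hxy' s t w
      rw [hq] at e1 e2
      beta_reduce
      rw [hz, hG, e1, e2]
      field_simp
      ring
    have hd := h.not_linear_u (fun s t => bil d s t)
      (by simpa using hspan ![1, 0]) (by simpa using hspan ![0, 1])
    exact one_ne_zero (hdep 1 0 fun s t => by rw [(h1 s t).1, hd]; simp).1

/-- All components of a trilinear birational map of type `(1, 2, 2)` vanish on a line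
`ℙ¹ × {m} × {n}`. -/
theorem BaseData.exists_base (h : BaseData P R g c) :
    ∃ m n : Fin 2 → ℂ, m ≠ 0 ∧ n ≠ 0 ∧ bil g m n = 0 ∧ ∀ s, tri P s m n = 0 ∧ tri R s m n = 0 := by
  by_cases hg : g 0 0 * g 1 1 = g 0 1 * g 1 0
  · exact h.exists_base_of_det_eq_zero hg
  · exact h.exists_base_of_det_ne_zero (sub_ne_zero.2 hg)

end

/-! ### The structure of a trilinear birational map of type `(1, 2, 2)` -/

section

variable {Φ : Tuple} {ρ : Fin 3 → Fin 2 → MvPolynomial (Fin 4) ℂ} {d : Fin 3 → ℕ}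

/-- A birational map is dominant: no nonzero form vanishes on its image. -/
lemma Tuple.IsInverse.eq_zero_of_eval_value (h : Φ.IsInverse ρ d) {n : ℕ}
    {f : MvPolynomial (Fin 4) ℂ} (hf : f.IsHomogeneous n)
    (h0 : ∀ v, eval (Φ.value v) f = 0) : f = 0 := by
  obtain ⟨i, hi⟩ := h.right_defined
  set F := fun i => aeval (fun mj : Fin 3 × Fin 2 => ρ mj.1 mj.2) (Φ.poly i) with hF
  have : F i ^ n * f = 0 := by
    refine MvPolynomial.funext fun x => ?_
    have e : x i • (Φ.value fun m j => eval x (ρ m j)) = eval x (F i) • x := by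
      ext i'
      have := congrArg (eval x) (h.right_inv i i')
      rw [map_mul, map_mul, eval_X, eval_X, eval_aeval_inverse Φ ρ x i'] at this
      simp only [Pi.smul_apply, smul_eq_mul, hF]
      linear_combination -this
    rw [map_mul, map_pow, map_zero, ← eval_smul_of_isHomogeneous hf, ← e,
      eval_smul_of_isHomogeneous hf, h0, mul_zero]
  exact (mul_eq_zero.1 this).resolve_left (pow_ne_zero n hi)

lemma Tuple.IsInverse.eval_left_inv (h : Φ.IsInverse ρ d) (m : Fin 3) (v : Fin 3 → Fin 2 → ℂ) :
    eval (Φ.value v) (ρ m 0) * v m 1 = eval (Φ.value v) (ρ m 1) * v m 0 := by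
  have := congrArg (eval fun mj : Fin 3 × Fin 2 => v mj.1 mj.2) (h.left_inv m)
  rwa [map_mul, map_mul, eval_X, eval_X, eval_aeval_poly, eval_aeval_poly] at this

lemma Tuple.IsInverse.ne_zero (h : Φ.IsInverse ρ d) {m : Fin 3} (hd : d m ≠ 0) (j : Fin 2) :
    ρ m j ≠ 0 := by
  have hunit : ∀ j, ¬ IsUnit (ρ m j) := fun j hu => by
    have h1 := hu.map (eval (0 : Fin 4 → ℂ))
    have h2 := eval_smul_of_isHomogeneous (h.homogeneous m j) 0 0
    rw [zero_pow hd, zero_mul, smul_zero] at h2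
    rw [h2] at h1
    exact not_isUnit_zero h1
  intro h0
  have hc := h.coprime m
  revert j
  refine Fin.forall_fin_two.2 ⟨fun h0 => ?_, fun h0 => ?_⟩
  · exact hunit 1 (hc (h0 ▸ dvd_zero _) dvd_rfl)
  · exact hunit 0 (hc dvd_rfl (h0 ▸ dvd_zero _))

lemma eq_zero_of_dvd_of_isHomogeneous {σ : Type*} {f g : MvPolynomial σ ℂ} {m n : ℕ}
    (hf : f.IsHomogeneous m) (hg : g.IsHomogeneous n) (hnm : n < m) (h : f ∣ g) : g = 0 := by
  by_contra hg0
  have := totalDegree_le_of_dvd_of_isDomain h hg0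
  rw [hf.totalDegree (ne_zero_of_dvd_ne_zero hg0 h), hg.totalDegree hg0] at this
  omega

/-- A factor of the inverse of degree greater than one is not given by two linear forms. -/
lemma Tuple.IsInverse.not_linear (h : Φ.IsInverse ρ d) {m : Fin 3} (hd : 1 < d m)
    {l₀ l₁ : MvPolynomial (Fin 4) ℂ} (hl₀ : l₀.IsHomogeneous 1) (hl₁ : l₁.IsHomogeneous 1)
    (hl : ∀ v, eval (Φ.value v) l₀ * v m 1 = eval (Φ.value v) l₁ * v m 0) : l₀ = 0 ∧ l₁ = 0 := by
  have key : l₀ * ρ m 1 = l₁ * ρ m 0 := by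
    rw [← sub_eq_zero]
    refine h.eq_zero_of_eval_value ((hl₀.mul (h.homogeneous m 1)).sub
      (hl₁.mul (h.homogeneous m 0))) fun v => ?_
    have hE : aeval Φ.poly (l₀ * ρ m 1 - l₁ * ρ m 0) = 0 := by
      refine eval_eq_zero_of_generic (X_ne_zero ((m, 0) : Fin 3 × Fin 2)) fun w hw => ?_
      rw [eval_X] at hw
      have e1 := hl fun m j => w (m, j)
      have e2 := h.eval_left_inv m fun m j => w (m, j)
      rw [eval_aeval_poly]
      refine mul_left_cancel₀ hw ?_
      rw [map_sub, map_mul, map_mul, mul_zero]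
      linear_combination
        eval (Φ.value fun m j => w (m, j)) (ρ m 0) * e1 -
        eval (Φ.value fun m j => w (m, j)) l₀ * e2
    rw [← eval_aeval_poly Φ (fun mj => v mj.1 mj.2), hE, map_zero]
  have h0 : ρ m 0 ∣ l₀ :=
    (h.coprime m).dvd_of_dvd_mul_right (Dvd.intro_left l₁ key.symm)
  have h1 : ρ m 1 ∣ l₁ :=
    (h.coprime m).symm.dvd_of_dvd_mul_right (Dvd.intro_left l₀ key)
  exact ⟨eq_zero_of_dvd_of_isHomogeneous (h.homogeneous m 0) hl₀ hd h0,
    eq_zero_of_dvd_of_isHomogeneous (h.homogeneous m 1) hl₁ hd h1⟩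

lemma exists_linear_of_isHomogeneous {n : ℕ} {f : MvPolynomial (Fin n) ℂ}
    (hf : f.IsHomogeneous 1) : ∃ z : Fin n → ℂ, f = ∑ k, C (z k) * X k := by
  have h := (mem_homogeneousSubmodule 1 f).2 hf
  rw [homogeneousSubmodule_one_eq_span_X, Submodule.mem_span_range_iff_exists_fun] at h
  obtain ⟨z, rfl⟩ := h
  exact ⟨z, by simp only [smul_eq_C_mul]⟩

lemma eval_single_linear {n : ℕ} (z : Fin n → ℂ) (k : Fin n) :
    eval (Pi.single k 1) (∑ i, C (z i) * X i : MvPolynomial (Fin n) ℂ) = z k := by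
  simp [Pi.single_apply]

/-- The linear combination of the components of `Φ` with coefficients `w`. -/
def Tuple.comb (Φ : Tuple) (w : Fin 4 → ℂ) (j k l : Fin 2) : ℂ := ∑ i, w i * Φ (i, j, k, l)

lemma Tuple.tri_comb (Φ : Tuple) (w : Fin 4 → ℂ) (v : Fin 3 → Fin 2 → ℂ) :
    tri (Φ.comb w) (v 0) (v 1) (v 2) = ∑ i, w i * Φ.value v i := by
  simp only [tri, Tuple.comb, Tuple.value, Fin.sum_univ_two, Fin.sum_univ_four]; ring

lemma Tuple.tri_comb' (Φ : Tuple) (w : Fin 4 → ℂ) (s t u : Fin 2 → ℂ) :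
    tri (Φ.comb w) s t u = ∑ i, w i * Φ.value ![s, t, u] i :=
  Φ.tri_comb w ![s, t, u]

lemma exists_common_factor {a b : Fin 2 → Fin 2 → Fin 2 → ℂ}
    (h : ∀ s t u, tri a s t u * s 1 = tri b s t u * s 0) :
    ∃ g : Fin 2 → Fin 2 → ℂ, a = ![g, 0] ∧ b = ![0, g] := by
  have hab : ∀ k l, a 1 k l = 0 ∧ b 0 k l = 0 ∧ a 0 k l = b 1 k l := by
    intro k l
    have e1 := h ![1, 0] (Pi.single k 1) (Pi.single l 1)
    have e2 := h ![0, 1] (Pi.single k 1) (Pi.single l 1)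
    have e3 := h ![1, 1] (Pi.single k 1) (Pi.single l 1)
    simp [tri, Pi.single_apply] at e1 e2 e3
    refine ⟨e2, e1.symm, ?_⟩
    linear_combination e3 - e1 - e2
  refine ⟨a 0, ?_, ?_⟩
  · ext j k l
    revert j
    exact Fin.forall_fin_two.2 ⟨rfl, (hab k l).1⟩
  · ext j k l
    revert j
    exact Fin.forall_fin_two.2 ⟨(hab k l).2.1, (hab k l).2.2.symm⟩

/-- Three linear conditions on `2 × 2` matrices have a nonzero solution. -/
lemma exists_ne_zero_of_three (p q r : Fin 2 → Fin 2 → ℂ) : ∃ N : Fin 2 → Fin 2 → ℂ, N ≠ 0 ∧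
    ∑ k, ∑ l, p k l * N k l = 0 ∧ ∑ k, ∑ l, q k l * N k l = 0 ∧ ∑ k, ∑ l, r k l * N k l = 0 := by
  let f : (Fin 2 × Fin 2 → ℂ) →ₗ[ℂ] Fin 3 → ℂ :=
    (Matrix.of ![fun x => p x.1 x.2, fun x => q x.1 x.2, fun x => r x.1 x.2]).mulVecLin
  have hker : LinearMap.ker f ≠ ⊥ := LinearMap.ker_ne_bot_of_finrank_lt (by simp)
  obtain ⟨N, hN, hN0⟩ := Submodule.exists_mem_ne_zero_of_ne_bot hker
  rw [LinearMap.mem_ker] at hN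
  refine ⟨fun k l => N (k, l), fun h0 => hN0 ?_, ?_, ?_, ?_⟩
  · ext x
    exact congrFun (congrFun h0 x.1) x.2
  · simpa [f, Matrix.mulVec, dotProduct, Fintype.sum_prod_type] using congrFun hN 0
  · simpa [f, Matrix.mulVec, dotProduct, Fintype.sum_prod_type] using congrFun hN 1
  · simpa [f, Matrix.mulVec, dotProduct, Fintype.sum_prod_type] using congrFun hN 2

/-- If `Φ(s, ·, ·)`, as a linear map on `2 × 2` matrices, vanishes at a matrix `N ≠ 0`, then `N`
has rank one for general `s`: otherwise two different points `(t, u)` and `(t', u')` have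
`t ⊗ u - t' ⊗ u'` in the span of `N` and the same image. -/
lemma Tuple.IsInverse.exists_generic (h : Φ.IsInverse ρ d) :
    ∃ c : MvPolynomial (Fin 2) ℂ, c ≠ 0 ∧ ∀ s, eval s c ≠ 0 → ∀ N : Fin 2 → Fin 2 → ℂ, N ≠ 0 →
      (∀ i, ∑ j, ∑ k, ∑ l, Φ (i, j, k, l) * (s j * N k l) = 0) →
      N 0 0 * N 1 1 = N 0 1 * N 1 0 := by
  obtain ⟨j₁, hj₁⟩ := h.left_defined 1
  obtain ⟨j₂, hj₂⟩ := h.left_defined 2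
  set K := aeval Φ.poly (ρ 1 j₁) * aeval Φ.poly (ρ 2 j₂) with hK
  obtain ⟨w, hw⟩ : ∃ w, eval w K ≠ 0 := by
    by_contra! hcon
    exact mul_ne_zero hj₁ hj₂ (MvPolynomial.funext fun w => by rw [← hK, hcon, map_zero])
  -- restrict `K` to the values `t`, `u` given by `w`
  let c : MvPolynomial (Fin 2) ℂ :=
    aeval (fun mj : Fin 3 × Fin 2 => if mj.1 = 0 then X mj.2 else C (w mj)) K
  have hc : ∀ s, eval s c = eval (fun mj => if mj.1 = 0 then s mj.2 else w mj) K := by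
    intro s
    have : (aeval s).comp (aeval fun mj : Fin 3 × Fin 2 => if mj.1 = 0 then X mj.2 else C (w mj)) =
        aeval (R := ℂ) (fun mj => if mj.1 = 0 then s mj.2 else w mj) := by
      ext mj
      by_cases hm : mj.1 = 0 <;> simp [hm]
    exact DFunLike.congr_fun this K
  refine ⟨c, ne_zero_of_eval (x := fun j => w (0, j)) ?_, fun s hs N hN hker => ?_⟩
  · rw [hc]
    have : (fun mj : Fin 3 × Fin 2 => if mj.1 = 0 then w (0, mj.2) else w mj) = w := by
      ext ⟨m, j⟩
      split_ifs with hm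
      · rw [show m = 0 from hm]
      · rfl
    rwa [this]
  rw [hc] at hs
  by_contra hdet
  replace hdet : N 0 0 * N 1 1 - N 0 1 * N 1 0 ≠ 0 := sub_ne_zero.2 hdet
  -- choose `t`, `u` such that the inverse is defined at the image of `(s, t, u)` and such that
  -- the line through `t ⊗ u` in the direction `N` is not tangent to the rank one matrices
  obtain ⟨v, hv0, hvK, hvB⟩ : ∃ v : Fin 3 → Fin 2 → ℂ, v 0 = s ∧
      eval (fun mj : Fin 3 × Fin 2 => v mj.1 mj.2) K ≠ 0 ∧
      v 1 0 * v 2 0 * N 1 1 + v 1 1 * v 2 1 * N 0 0 - v 1 0 * v 2 1 * N 1 0 -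
        v 1 1 * v 2 0 * N 0 1 ≠ 0 := by
    let K' : MvPolynomial (Fin 3 × Fin 2) ℂ :=
      aeval (fun mj : Fin 3 × Fin 2 => if mj.1 = 0 then C (s mj.2) else X mj) K
    let B : MvPolynomial (Fin 3 × Fin 2) ℂ :=
      X (1, 0) * X (2, 0) * C (N 1 1) + X (1, 1) * X (2, 1) * C (N 0 0) -
        X (1, 0) * X (2, 1) * C (N 1 0) - X (1, 1) * X (2, 0) * C (N 0 1)
    have hK' : ∀ v, eval v K' = eval (fun mj => if mj.1 = 0 then s mj.2 else v mj) K := by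
      intro v
      have : (aeval v).comp
          (aeval fun mj : Fin 3 × Fin 2 => if mj.1 = 0 then C (s mj.2) else X mj) =
          aeval (R := ℂ) (fun mj => if mj.1 = 0 then s mj.2 else v mj) := by
        ext mj
        by_cases hm : mj.1 = 0 <;> simp [hm]
      exact DFunLike.congr_fun this K
    have hB0 : B ≠ 0 := by
      intro hB
      have e : ∀ t u : Fin 2 → ℂ, t 0 * u 0 * N 1 1 + t 1 * u 1 * N 0 0 - t 0 * u 1 * N 1 0 -
          t 1 * u 0 * N 0 1 = 0 := fun t u => by
        have := congrArg (eval fun mj : Fin 3 × Fin 2 => (![s, t, u] : Fin 3 → Fin 2 → ℂ) mj.1 mj.2)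
          hB
        simpa [B] using this
      have e1 := e ![1, 0] ![1, 0]
      have e2 := e ![0, 1] ![0, 1]
      have e3 := e ![1, 0] ![0, 1]
      have e4 := e ![0, 1] ![1, 0]
      simp at e1 e2 e3 e4
      simp [e1, e2, e3, e4] at hdet
    obtain ⟨v, hv⟩ : ∃ v, eval v (K' * B) ≠ 0 := by
      by_contra! hcon
      refine mul_ne_zero (ne_zero_of_eval (x := w) ?_) hB0
        (MvPolynomial.funext fun w => by rw [hcon, map_zero])
      rwa [hK']
    rw [map_mul] at hv
    refine ⟨fun m j => if m = 0 then s j else v (m, j), by simp, ?_, ?_⟩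
    · have := left_ne_zero_of_mul hv
      rwa [hK'] at this
    · have := right_ne_zero_of_mul hv
      simpa [B] using this
  set b := v 1 0 * v 2 0 * N 1 1 + v 1 1 * v 2 1 * N 0 0 - v 1 0 * v 2 1 * N 1 0 -
    v 1 1 * v 2 0 * N 0 1 with hb
  set δ := N 0 0 * N 1 1 - N 0 1 * N 1 0 with hδ
  obtain ⟨t', u', h00, h01, h10, h11⟩ := exists_factor_of_det_eq_zero
    (a := v 1 0 * v 2 0 - b / δ * N 0 0) (b := v 1 0 * v 2 1 - b / δ * N 0 1)
    (c := v 1 1 * v 2 0 - b / δ * N 1 0) (d := v 1 1 * v 2 1 - b / δ * N 1 1) (by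
      have : b / δ * δ = b := div_mul_cancel₀ b hdet
      rw [← sub_eq_zero]
      linear_combination (b / δ) * this - (b / δ) * hb)
  have hval : Φ.value ![s, t', u'] = Φ.value v := by
    ext i
    have hi := hker i
    simp only [Tuple.value, Fin.sum_univ_two, Matrix.cons_val_zero, Matrix.cons_val_one,
      Matrix.cons_val_two, Matrix.tail_cons, Matrix.head_cons, hv0] at hi ⊢
    have e00 := h00.symm
    have e01 := h01.symm
    have e10 := h10.symm
    have e11 := h11.symm
    linear_combination -(b / δ) * hi +
      (Φ (i, 0, 0, 0) * s 0 + Φ (i, 1, 0, 0) * s 1) * e00 +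
      (Φ (i, 0, 0, 1) * s 0 + Φ (i, 1, 0, 1) * s 1) * e01 +
      (Φ (i, 0, 1, 0) * s 0 + Φ (i, 1, 1, 0) * s 1) * e10 +
      (Φ (i, 0, 1, 1) * s 0 + Φ (i, 1, 1, 1) * s 1) * e11
  rw [hK, map_mul, eval_aeval_poly, eval_aeval_poly] at hvK
  have hprop : ∀ (m : Fin 3) (j : Fin 2), eval (Φ.value v) (ρ m j) ≠ 0 →
      v m 0 * (![s, t', u'] : Fin 3 → Fin 2 → ℂ) m 1 =
      v m 1 * (![s, t', u'] : Fin 3 → Fin 2 → ℂ) m 0 := by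
    intro m j hj
    have e1 := h.eval_left_inv m v
    have e2 := h.eval_left_inv m ![s, t', u']
    rw [hval] at e2
    revert j
    refine Fin.forall_fin_two.2 ⟨fun hj => mul_left_cancel₀ hj ?_, fun hj => mul_left_cancel₀ hj ?_⟩
    · linear_combination v m 0 * e2 - (![s, t', u'] : Fin 3 → Fin 2 → ℂ) m 0 * e1
    · linear_combination v m 1 * e2 - (![s, t', u'] : Fin 3 → Fin 2 → ℂ) m 1 * e1
  have ht0 : v 1 ≠ 0 := fun h0 => hvB (by rw [hb]; simp [h0])
  have hu0 : v 2 ≠ 0 := fun h0 => hvB (by rw [hb]; simp [h0])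
  obtain ⟨μ, rfl⟩ := exists_smul_of_det_eq_zero (b := t') ht0
    (hprop 1 j₁ (left_ne_zero_of_mul hvK))
  obtain ⟨ν, rfl⟩ := exists_smul_of_det_eq_zero (b := u') hu0
    (hprop 2 j₂ (right_ne_zero_of_mul hvK))
  simp only [Pi.smul_apply, smul_eq_mul] at h00 h01 h10 h11
  have hx : b / δ ≠ 0 := div_ne_zero hvB hdet
  have : (b / δ) ^ 2 * δ = 0 := by
    have e00 : b / δ * N 0 0 = (1 - μ * ν) * (v 1 0 * v 2 0) := by linear_combination -h00
    have e01 : b / δ * N 0 1 = (1 - μ * ν) * (v 1 0 * v 2 1) := by linear_combination -h01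
    have e10 : b / δ * N 1 0 = (1 - μ * ν) * (v 1 1 * v 2 0) := by linear_combination -h10
    have e11 : b / δ * N 1 1 = (1 - μ * ν) * (v 1 1 * v 2 1) := by linear_combination -h11
    calc (b / δ) ^ 2 * δ = (b / δ * N 0 0) * (b / δ * N 1 1) - (b / δ * N 0 1) * (b / δ * N 1 0) := by
          rw [hδ]; ring
      _ = 0 := by rw [e00, e01, e10, e11]; ring
  exact mul_ne_zero (pow_ne_zero 2 hx) hdet this

open Matrix in
/-- The coordinates given by a basis of linear forms. -/
lemma exists_basis_of_forms {Z : Fin 4 → Fin 4 → ℂ} (hZ : LinearIndependent ℂ Z) :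
    ∃ A : Fin 4 → Fin 4 → ℂ, LinearIndependent ℂ A ∧ ∀ x : Fin 4 → ℂ,
      x = ∑ r, (∑ i, Z r i * x i) • A r := by
  have hU : IsUnit (Matrix.of Z) := Matrix.linearIndependent_rows_iff_isUnit.1 hZ
  have hdet := (Matrix.isUnit_iff_isUnit_det _).1 hU
  refine ⟨fun r i => (Matrix.of Z)⁻¹ i r, ?_, fun x => ?_⟩
  · exact Matrix.linearIndependent_cols_iff_isUnit.2 ((Matrix.isUnit_nonsing_inv_iff).2 hU)
  · have : (Matrix.of Z)⁻¹ *ᵥ (Matrix.of Z *ᵥ x) = x := by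
      rw [mulVec_mulVec, nonsing_inv_mul _ hdet, one_mulVec]
    conv_lhs => rw [← this]
    ext i
    simp only [mulVec, dotProduct, Matrix.of_apply, Finset.sum_apply, Pi.smul_apply, smul_eq_mul]
    exact Finset.sum_congr rfl fun r _ => mul_comm _ _

lemma linearIndependent_of_isRelPrime {z₀ z₁ : Fin 4 → ℂ}
    (h : IsRelPrime (∑ k, C (z₀ k) * X k : MvPolynomial (Fin 4) ℂ) (∑ k, C (z₁ k) * X k)) :
    LinearIndependent ℂ ![z₀, z₁] := by
  have hunit : ∀ z : Fin 4 → ℂ, ¬ IsUnit (∑ k, C (z k) * X k : MvPolynomial (Fin 4) ℂ) := by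
    intro z hu
    have := hu.map (eval (0 : Fin 4 → ℂ))
    simp at this
  rw [LinearIndependent.pair_iff]
  intro x y hxy
  have e : ∀ k, x * z₀ k + y * z₁ k = 0 := fun k => by simpa using congrFun hxy k
  refine ⟨by_contra fun hx => hunit z₁ (h ?_ dvd_rfl), by_contra fun hy => hunit z₀ (h dvd_rfl ?_)⟩
  · refine ⟨C (-(y / x)), ?_⟩
    rw [Finset.sum_mul]
    refine Finset.sum_congr rfl fun k _ => ?_
    have : z₀ k = z₁ k * -(y / x) := by field_simp; linear_combination e k
    rw [this, C_mul]; ring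
  · refine ⟨C (-(x / y)), ?_⟩
    rw [Finset.sum_mul]
    refine Finset.sum_congr rfl fun k _ => ?_
    have : z₁ k = z₀ k * -(x / y) := by field_simp; linear_combination e k
    rw [this, C_mul]; ring

/-- Up to a linear coordinate change in `ℙ³`, a trilinear birational map of type `(1, 2, 2)` has
the components `P`, `s₀ g`, `R`, `s₁ g`. -/
theorem exists_baseData (hΦ : Φ ∈ birationalOfType ![1, 2, 2]) :
    ∃ (A : Fin 4 → Fin 4 → ℂ) (P R : Fin 2 → Fin 2 → Fin 2 → ℂ) (g : Fin 2 → Fin 2 → ℂ)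
      (c : MvPolynomial (Fin 2) ℂ), LinearIndependent ℂ A ∧ BaseData P R g c ∧
      ∀ s t u, Φ.value ![s, t, u] = tri P s t u • A 0 + (s 0 * bil g t u) • A 1 +
        tri R s t u • A 2 + (s 1 * bil g t u) • A 3 := by
  obtain ⟨-, ρ, h⟩ := hΦ
  obtain ⟨z₀, hz₀⟩ := exists_linear_of_isHomogeneous (h.homogeneous 0 0)
  obtain ⟨z₁, hz₁⟩ := exists_linear_of_isHomogeneous (h.homogeneous 0 1)
  have hind : LinearIndependent ℂ ![z₀, z₁] := by
    apply linearIndependent_of_isRelPrime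
    rw [← hz₀, ← hz₁]
    exact h.coprime 0
  obtain ⟨z₂, hz₂⟩ := exists_linearIndependent_snoc_of_lt_finrank hind (by simp)
  obtain ⟨z₃, hz₃⟩ := exists_linearIndependent_snoc_of_lt_finrank hz₂ (by simp)
  have hZ : LinearIndependent ℂ ![z₂, z₀, z₃, z₁] := by
    have e : (Fin.snoc (Fin.snoc ![z₀, z₁] z₂ : Fin 3 → Fin 4 → ℂ) z₃ : Fin 4 → Fin 4 → ℂ) ∘
        ![2, 0, 3, 1] = ![z₂, z₀, z₃, z₁] := by
      funext r
      fin_cases r <;> rfl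
    rw [← e]
    exact hz₃.comp _ (by decide)
  obtain ⟨A, hA, hx⟩ := exists_basis_of_forms hZ
  obtain ⟨g, hg₀, hg₁⟩ := exists_common_factor (a := Φ.comb z₀) (b := Φ.comb z₁) fun s t u => by
    have := h.eval_left_inv 0 ![s, t, u]
    rw [hz₀, hz₁] at this
    simpa [Φ.tri_comb'] using this
  have hval : ∀ s t u i, ∑ j, (![z₂, z₀, z₃, z₁] : Fin 4 → Fin 4 → ℂ) i j * Φ.value ![s, t, u] j =
      (![tri (Φ.comb z₂) s t u, s 0 * bil g t u, tri (Φ.comb z₃) s t u, s 1 * bil g t u] :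
        Fin 4 → ℂ) i := by
    intro s t u i
    have e₀ : s 0 * bil g t u = tri (Φ.comb z₀) s t u := by rw [hg₀, tri_eq_sum]; simp [bil]
    have e₁ : s 1 * bil g t u = tri (Φ.comb z₁) s t u := by rw [hg₁, tri_eq_sum]; simp [bil]
    rw [e₀, e₁]
    fin_cases i <;> simp [Φ.tri_comb']
  -- a linear combination of `P`, `s₀ g`, `R`, `s₁ g` is a linear form in the components of `Φ`
  have hlin : ∀ α β γ₀ γ₁ : ℂ, ∃ w : Fin 4 → ℂ, (∀ s t u,
      α * tri (Φ.comb z₂) s t u + β * tri (Φ.comb z₃) s t u +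
        (γ₀ * s 0 + γ₁ * s 1) * bil g t u = eval (Φ.value ![s, t, u]) (∑ k, C (w k) * X k)) ∧
      ((∑ k, C (w k) * X k : MvPolynomial (Fin 4) ℂ) = 0 → α = 0 ∧ β = 0 ∧ γ₀ = 0 ∧ γ₁ = 0) := by
    intro α β γ₀ γ₁
    refine ⟨fun k => α * z₂ k + γ₀ * z₀ k + β * z₃ k + γ₁ * z₁ k, fun s t u => ?_, fun h0 => ?_⟩
    · have e0 := hval s t u 0
      have e1 := hval s t u 1
      have e2 := hval s t u 2
      have e3 := hval s t u 3
      simp [Fin.sum_univ_four] at e0 e1 e2 e3 ⊢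
      linear_combination -α * e0 - γ₀ * e1 - β * e2 - γ₁ * e3
    · have := Fintype.linearIndependent_iff.1 hZ ![α, γ₀, β, γ₁] (by
        ext k
        have := congrArg (eval (Pi.single k 1)) h0
        rw [eval_single_linear, map_zero] at this
        simpa [Fin.sum_univ_four] using this)
      exact ⟨this 0, this 2, this 1, this 3⟩
  have hv : ∀ v : Fin 3 → Fin 2 → ℂ, ![v 0, v 1, v 2] = v := fun v => by
    ext m; fin_cases m <;> rfl
  have hnl : ∀ m : Fin 3, 1 < (![1, 2, 2] : Fin 3 → ℕ) m → ∀ L : Fin 2 → (Fin 2 → ℂ) → (Fin 2 → ℂ) →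
      (Fin 2 → ℂ) → ℂ, (∀ j, InSpan (Φ.comb z₂) (Φ.comb z₃) g (L j)) →
      (∀ v : Fin 3 → Fin 2 → ℂ, L 0 (v 0) (v 1) (v 2) * v m 1 = L 1 (v 0) (v 1) (v 2) * v m 0) →
      ∀ j s t u, L j s t u = 0 := by
    intro m hm L hL hLm
    have : ∀ j, ∃ w : Fin 4 → ℂ, ∀ s t u,
        L j s t u = eval (Φ.value ![s, t, u]) (∑ k, C (w k) * X k) := fun j => by
      obtain ⟨α, β, γ₀, γ₁, hL⟩ := hL j
      obtain ⟨w, hw, -⟩ := hlin α β γ₀ γ₁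
      exact ⟨w, fun s t u => by rw [hL, hw]⟩
    choose w hw using this
    have h0 := h.not_linear hm (isHomogeneous_linear (w 0)) (isHomogeneous_linear (w 1))
      fun v => by
        have := hLm v
        rwa [hw, hw, hv] at this
    refine Fin.forall_fin_two.2 ⟨fun s t u => ?_, fun s t u => ?_⟩
    · rw [hw, h0.1, map_zero]
    · rw [hw, h0.2, map_zero]
  obtain ⟨c, hc, hcN⟩ := h.exists_generic
  refine ⟨A, Φ.comb z₂, Φ.comb z₃, g, c, hA, ⟨fun α β γ₀ γ₁ h0 => ?_, fun b h0 h1 s u => ?_,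
    fun b h0 h1 s t => ?_, hc, fun s hs => ?_⟩, fun s t u => ?_⟩
  · obtain ⟨w, hw, hw0⟩ := hlin α β γ₀ γ₁
    exact hw0 (h.eq_zero_of_eval_value (isHomogeneous_linear w) fun v => by
      rw [← hv v, ← hw]; exact h0 _ _ _)
  · have := hnl 1 (by simp) (fun j s t u => b s u * t j) (Fin.forall_fin_two.2 ⟨h0, h1⟩)
      (fun v => by ring) 0 s ![1, 0] u
    simpa using this
  · have := hnl 2 (by simp) (fun j s t u => b s t * u j) (Fin.forall_fin_two.2 ⟨h0, h1⟩)
      (fun v => by ring) 0 s t ![1, 0]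
    simpa using this
  · obtain ⟨N, hN0, f0, f1, f2⟩ := exists_ne_zero_of_three
      (fun k l => ∑ j, Φ.comb z₂ j k l * s j) (fun k l => ∑ j, Φ.comb z₃ j k l * s j) g
    simp only [Fin.sum_univ_two] at f0 f1 f2
    have hΦN : ∀ i, ∑ j, ∑ k, ∑ l, Φ (i, j, k, l) * (s j * N k l) = 0 := by
      intro i
      refine (congrFun (hx fun i => ∑ j, ∑ k, ∑ l, Φ (i, j, k, l) * (s j * N k l)) i).trans ?_
      have e : ∀ z : Fin 4 → ℂ, ∑ i, z i * ∑ j, ∑ k, ∑ l, Φ (i, j, k, l) * (s j * N k l) =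
          ∑ j, ∑ k, ∑ l, Φ.comb z j k l * (s j * N k l) := fun z => by
        simp only [Tuple.comb, Fin.sum_univ_two, Fin.sum_univ_four]; ring
      have hr : ∀ r, ∑ i, (![z₂, z₀, z₃, z₁] : Fin 4 → Fin 4 → ℂ) r i *
          ∑ j, ∑ k, ∑ l, Φ (i, j, k, l) * (s j * N k l) = 0 := by
        intro r
        rw [e]
        fin_cases r
        · change ∑ j, ∑ k, ∑ l, Φ.comb z₂ j k l * (s j * N k l) = 0
          simp only [Fin.sum_univ_two]
          linear_combination f0
        · change ∑ j, ∑ k, ∑ l, Φ.comb z₀ j k l * (s j * N k l) = 0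
          rw [hg₀]
          simp [Fin.sum_univ_two]
          linear_combination s 0 * f2
        · change ∑ j, ∑ k, ∑ l, Φ.comb z₃ j k l * (s j * N k l) = 0
          simp only [Fin.sum_univ_two]
          linear_combination f1
        · change ∑ j, ∑ k, ∑ l, Φ.comb z₁ j k l * (s j * N k l) = 0
          rw [hg₁]
          simp [Fin.sum_univ_two]
          linear_combination s 1 * f2
      rw [Finset.sum_apply]
      exact Finset.sum_eq_zero fun r _ => by rw [Pi.smul_apply, hr, zero_smul]
    obtain ⟨m, n, h00, h01, h10, h11⟩ := exists_factor_of_det_eq_zero (hcN s hs N hN0 hΦN)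
    refine ⟨m, n, ?_, ?_, ?_, ?_, ?_⟩
    · rintro rfl
      apply hN0
      ext k l
      fin_cases k <;> fin_cases l <;> simp [h00, h01, h10, h11]
    · rintro rfl
      apply hN0
      ext k l
      fin_cases k <;> fin_cases l <;> simp [h00, h01, h10, h11]
    · simp only [tri, Fin.sum_univ_two]
      rw [h00, h01, h10, h11] at f0
      linear_combination f0
    · simp only [tri, Fin.sum_univ_two]
      rw [h00, h01, h10, h11] at f1
      linear_combination f1
    · simp only [bil, Fin.sum_univ_two]
      rw [h00, h01, h10, h11] at f2
      linear_combination f2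
  · conv_lhs => rw [hx (Φ.value ![s, t, u])]
    rw [Fin.sum_univ_four, hval, hval, hval, hval]
    rfl

end

/-! ### Reduction to the normal form -/

/-- The bilinear form `x₀ t₀ u₀ + x₁ t₀ u₁ + x₂ t₁ u₀`; these are the bilinear forms that vanish at
the point `((0 : 1), (0 : 1))` of `ℙ¹ × ℙ¹`. -/
def form3 (x : Fin 3 → ℂ) (t u : Fin 2 → ℂ) : ℂ :=
  x 0 * (t 0 * u 0) + x 1 * (t 0 * u 1) + x 2 * (t 1 * u 0)

/-- The `3 × 3` determinant with rows `x`, `y`, `z`. -/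
def vol3 {K : Type*} [CommRing K] (x y z : Fin 3 → K) : K :=
  x 0 * (y 1 * z 2 - y 2 * z 1) - x 1 * (y 0 * z 2 - y 2 * z 0) + x 2 * (y 0 * z 1 - y 1 * z 0)

/-- Simultaneous diagonalization: the determinant of the pencil with rows `bP(s, ·)` and
`bR(s, ·)` has two different roots, and at these the matrix has rank one. -/
lemma exists_diagonalization {bP bR : Fin 2 → Fin 2 → ℂ} {h₀ h₁ h₂ : ℂ}
    (h0 : h₀ = bP 0 0 * bR 0 1 - bP 0 1 * bR 0 0) (h2 : h₂ = bP 1 0 * bR 1 1 - bP 1 1 * bR 1 0)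
    (h1 : h₁ = bP 0 0 * bR 1 1 - bP 0 1 * bR 1 0 + (bP 1 0 * bR 0 1 - bP 1 1 * bR 0 0))
    (hdisc : h₁ ^ 2 - 4 * h₀ * h₂ ≠ 0) (he : bP 0 1 * bR 1 1 - bP 1 1 * bR 0 1 ≠ 0) :
    ∃ (M N : Matrix (Fin 2) (Fin 2) ℂ) (p r x y : Fin 2 → ℂ), M.det ≠ 0 ∧ N * M = 1 ∧
      x 0 * y 1 - x 1 * y 0 ≠ 0 ∧ p 0 * r 1 - p 1 * r 0 ≠ 0 ∧ p 1 ≠ 0 ∧ r 1 ≠ 0 ∧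
      (∀ k, bP 0 k * N 0 0 + bP 1 k * N 1 0 = x 0 * p k) ∧
      (∀ k, bR 0 k * N 0 0 + bR 1 k * N 1 0 = x 1 * p k) ∧
      (∀ k, bP 0 k * N 0 1 + bP 1 k * N 1 1 = y 0 * r k) ∧
      ∀ k, bR 0 k * N 0 1 + bR 1 k * N 1 1 = y 1 * r k := by
  obtain ⟨l, m, e0, e2, e1⟩ := exists_mul_eq_quadratic h₀ h₁ h₂
  have hD : l 0 * m 1 - l 1 * m 0 ≠ 0 := by
    intro hD
    apply hdisc
    rw [← e0, ← e1, ← e2]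
    linear_combination (l 0 * m 1 - l 1 * m 0) * hD
  set D := l 0 * m 1 - l 1 * m 0 with hDdef
  let M : Matrix (Fin 2) (Fin 2) ℂ := !![l 0, l 1; m 0, m 1]
  let N : Matrix (Fin 2) (Fin 2) ℂ := !![m 1 / D, -l 1 / D; -m 0 / D, l 0 / D]
  obtain ⟨x, p, ha, hb, hc, hd⟩ := exists_factor_of_det_eq_zero
    (a := bP 0 0 * N 0 0 + bP 1 0 * N 1 0) (b := bP 0 1 * N 0 0 + bP 1 1 * N 1 0)
    (c := bR 0 0 * N 0 0 + bR 1 0 * N 1 0) (d := bR 0 1 * N 0 0 + bR 1 1 * N 1 0) (by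
      simp only [N, Matrix.of_apply, Matrix.cons_val', Matrix.cons_val_zero, Matrix.cons_val_one,
        Matrix.cons_val_fin_one]
      field_simp
      linear_combination -m 1 ^ 2 * (h0 - e0.symm) + m 0 * m 1 * (h1 - e1.symm) -
        m 0 ^ 2 * (h2 - e2.symm))
  obtain ⟨y, r, ha', hb', hc', hd'⟩ := exists_factor_of_det_eq_zero
    (a := bP 0 0 * N 0 1 + bP 1 0 * N 1 1) (b := bP 0 1 * N 0 1 + bP 1 1 * N 1 1)
    (c := bR 0 0 * N 0 1 + bR 1 0 * N 1 1) (d := bR 0 1 * N 0 1 + bR 1 1 * N 1 1) (by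
      simp only [N, Matrix.of_apply, Matrix.cons_val', Matrix.cons_val_zero, Matrix.cons_val_one,
        Matrix.cons_val_fin_one]
      field_simp
      linear_combination -l 1 ^ 2 * (h0 - e0.symm) + l 0 * l 1 * (h1 - e1.symm) -
        l 0 ^ 2 * (h2 - e2.symm))
  have hdetN : N 0 0 * N 1 1 - N 0 1 * N 1 0 ≠ 0 := by
    have : N 0 0 * N 1 1 - N 0 1 * N 1 0 = D⁻¹ := by
      simp only [N, Matrix.of_apply, Matrix.cons_val', Matrix.cons_val_zero, Matrix.cons_val_one,
        Matrix.cons_val_fin_one]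
      field_simp
      rw [hDdef]
      ring
    rw [this]
    exact inv_ne_zero hD
  -- the middle coefficient of the determinant, in the coordinates given by its roots, is one
  have hmid : (x 0 * y 1 - x 1 * y 0) * (p 0 * r 1 - p 1 * r 0) = 1 := by
    have : (x 0 * y 1 - x 1 * y 0) * (p 0 * r 1 - p 1 * r 0) =
        (bP 0 0 * N 0 0 + bP 1 0 * N 1 0) * (bR 0 1 * N 0 1 + bR 1 1 * N 1 1) -
        (bP 0 1 * N 0 0 + bP 1 1 * N 1 0) * (bR 0 0 * N 0 1 + bR 1 0 * N 1 1) +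
        ((bP 0 0 * N 0 1 + bP 1 0 * N 1 1) * (bR 0 1 * N 0 0 + bR 1 1 * N 1 0) -
        (bP 0 1 * N 0 1 + bP 1 1 * N 1 1) * (bR 0 0 * N 0 0 + bR 1 0 * N 1 0)) := by
      rw [ha, hb, hc, hd, ha', hb', hc', hd']; ring
    rw [this]
    simp only [N, Matrix.of_apply, Matrix.cons_val', Matrix.cons_val_zero, Matrix.cons_val_one,
      Matrix.cons_val_fin_one]
    field_simp
    rw [hDdef]
    linear_combination 2 * m 1 * l 1 * (h0 - e0.symm) - (l 0 * m 1 + l 1 * m 0) * (h1 - e1.symm) +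
      2 * l 0 * m 0 * (h2 - e2.symm)
  have hpr : (x 0 * y 1 - x 1 * y 0) * (p 1 * r 1) ≠ 0 := by
    have : (x 0 * y 1 - x 1 * y 0) * (p 1 * r 1) =
        (bP 0 1 * bR 1 1 - bP 1 1 * bR 0 1) * (N 0 0 * N 1 1 - N 0 1 * N 1 0) := by
      linear_combination -(bR 0 1 * N 0 1 + bR 1 1 * N 1 1) * hb - x 0 * p 1 * hd' +
        (bR 0 1 * N 0 0 + bR 1 1 * N 1 0) * hb' + y 0 * r 1 * hd
    rw [this]
    exact mul_ne_zero he hdetN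
  have hne : (x 0 * y 1 - x 1 * y 0) * (p 0 * r 1 - p 1 * r 0) ≠ 0 := by
    rw [hmid]; exact one_ne_zero
  refine ⟨M, N, p, r, x, y, by simpa [M, Matrix.det_fin_two] using hD, ?_, left_ne_zero_of_mul hne,
    right_ne_zero_of_mul hne, left_ne_zero_of_mul (right_ne_zero_of_mul hpr),
    right_ne_zero_of_mul (right_ne_zero_of_mul hpr), Fin.forall_fin_two.2 ⟨ha, hb⟩,
    Fin.forall_fin_two.2 ⟨hc, hd⟩, Fin.forall_fin_two.2 ⟨ha', hb'⟩, Fin.forall_fin_two.2 ⟨hc', hd'⟩⟩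
  ext i j
  fin_cases i <;> fin_cases j <;> simp [M, N, Matrix.mul_apply, Fin.sum_univ_two] <;> field_simp <;>
    rw [hDdef] <;> ring

section

open Matrix

variable {Φ : Tuple} {A : Fin 4 → Fin 4 → ℂ} {a b : Matrix (Fin 2) (Fin 2) ℂ}
  {p r : Fin 2 → Fin 3 → ℂ} {g : Fin 3 → ℂ}

/-- `(P, s₀ g, R, s₁ g)`, with respect to the basis `A` and the coordinates `a t`, `b u`, where
`P = s₀ p₀ + s₁ p₁` and `R = s₀ r₀ + s₁ r₁`, and all bilinear forms vanish at one point. -/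
def baseValue (A : Fin 4 → Fin 4 → ℂ) (a b : Matrix (Fin 2) (Fin 2) ℂ) (p r : Fin 2 → Fin 3 → ℂ)
    (g : Fin 3 → ℂ) (s t u : Fin 2 → ℂ) : Fin 4 → ℂ :=
  (s 0 * form3 (p 0) (a *ᵥ t) (b *ᵥ u) + s 1 * form3 (p 1) (a *ᵥ t) (b *ᵥ u)) • A 0 +
    (s 0 * form3 g (a *ᵥ t) (b *ᵥ u)) • A 1 +
    (s 0 * form3 (r 0) (a *ᵥ t) (b *ᵥ u) + s 1 * form3 (r 1) (a *ᵥ t) (b *ᵥ u)) • A 2 +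
    (s 1 * form3 g (a *ᵥ t) (b *ᵥ u)) • A 3

/-- `g₁` times the coefficient of `t₁ u₀` in `x - (x₁ / g₁) g`, where the multiple of `g` is the one
that removes the coefficient of `t₀ u₁`. -/
def elim (g x : Fin 3 → ℂ) : ℂ := x 2 * g 1 - x 1 * g 2

/-- The restriction of the map to `{s} × ℙ¹ × ℙ¹` degenerates at the roots of a binary quadratic form
in `s`. If these are different and `g` is irreducible, `P` and `R` can be brought into the form
`s₀ p(t) u₀` and `s₁ r(t) u₀`. The last condition says that `p` and `r` do not vanish at the base
point; then `t₀` and `t₁` can be chosen proportional to `p` and `r`, and `u₁` in such a way that `g`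
becomes `u₀ t₁ - t₀ u₁`. -/
theorem isGeneralForm_of_baseValue (hΦ : ∀ v, Φ.value v = baseValue A a b p r g (v 0) (v 1) (v 2))
    (hA : LinearIndependent ℂ A) (ha : a.det ≠ 0) (hb : b.det ≠ 0) (hg₁ : g 1 ≠ 0) (hg₂ : g 2 ≠ 0)
    (hdisc : (vol3 (p 0) g (r 1) + vol3 (p 1) g (r 0)) ^ 2 -
      4 * vol3 (p 0) g (r 0) * vol3 (p 1) g (r 1) ≠ 0)
    (he : elim g (p 0) * elim g (r 1) - elim g (p 1) * elim g (r 0) ≠ 0) : IsGeneralForm Φ := by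
  -- subtract multiples of `g` from `P` and `R` such that they become divisible by `u₀`
  let c : (Fin 3 → ℂ) → Fin 2 → ℂ := fun x =>
    ![x 0 - x 1 / g 1 * g 0, x 2 - x 1 / g 1 * g 2]
  have hc : ∀ x t u, form3 x t u = u 0 * (c x 0 * t 0 + c x 1 * t 1) + x 1 / g 1 * form3 g t u := by
    intro x t u
    simp [c, form3]
    field_simp
    ring
  obtain ⟨M, N, p', r', x, y, hM, hNM, hxy, hpr, hp, hr, e1, e2, e3, e4⟩ :=
    exists_diagonalization (bP := fun j => c (p j)) (bR := fun j => c (r j)) rfl rfl rfl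
      (by
        have h : ∀ x y, c x 0 * c y 1 - c x 1 * c y 0 = vol3 x g y / g 1 := fun x y => by
          simp [c, vol3]; field_simp; ring
        rw [h, h, h, h]
        intro h0
        apply hdisc
        field_simp at h0
        linear_combination h0)
      (by
        have h : ∀ x, c x 1 = elim g x / g 1 := fun x => by simp [c, elim]; field_simp
        rw [h, h, h, h]
        intro h0
        apply he
        field_simp at h0
        linear_combination h0)
  set κ := r' 0 / r' 1 - p' 0 / p' 1 with hκdef
  have hκ : κ ≠ 0 := by
    intro h0
    apply hpr
    rw [hκdef] at h0
    field_simp at h0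
    linear_combination -h0
  let U : Matrix (Fin 2) (Fin 2) ℂ := !![(g 0 - g 2 * (p' 0 / p' 1)) / κ, g 1 / κ;
    (g 0 - g 2 * (p' 0 / p' 1)) / κ - g 2, g 1 / κ]
  let T : Matrix (Fin 2) (Fin 2) ℂ := !![p' 0 / p' 1, 1; r' 0 / r' 1, 1]
  let B₁ := A 1 + (p 0 1 / g 1) • A 0 + (r 0 1 / g 1) • A 2
  let B₃ := A 3 + (p 1 1 / g 1) • A 0 + (r 1 1 / g 1) • A 2
  have hN : N.det ≠ 0 := by
    intro h0
    have := congrArg Matrix.det hNM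
    rw [Matrix.det_mul, h0, zero_mul, Matrix.det_one] at this
    exact one_ne_zero this.symm
  refine ⟨![(p' 1 / g 2) • (x 0 • A 0 + x 1 • A 2), N 0 0 • B₁ + N 1 0 • B₃,
    (r' 1 / g 2) • (y 0 • A 0 + y 1 • A 2), N 0 1 • B₁ + N 1 1 • B₃], M, T * a, U * b, ?_, hM,
    ?_, ?_, fun v => ?_⟩
  · rw [Fintype.linearIndependent_iff] at hA ⊢
    intro z hz
    have h4 := hA ![z 0 * (p' 1 / g 2) * x 0 + z 2 * (r' 1 / g 2) * y 0 +
        (z 1 * N 0 0 + z 3 * N 0 1) * (p 0 1 / g 1) + (z 1 * N 1 0 + z 3 * N 1 1) * (p 1 1 / g 1),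
      z 1 * N 0 0 + z 3 * N 0 1,
      z 0 * (p' 1 / g 2) * x 1 + z 2 * (r' 1 / g 2) * y 1 +
        (z 1 * N 0 0 + z 3 * N 0 1) * (r 0 1 / g 1) + (z 1 * N 1 0 + z 3 * N 1 1) * (r 1 1 / g 1),
      z 1 * N 1 0 + z 3 * N 1 1] (by
        rw [← hz]
        simp only [Fin.sum_univ_four, Matrix.cons_val, B₁, B₃]
        module)
    have f0 := h4 0
    have f1 := h4 1
    have f2 := h4 2
    have f3 := h4 3
    simp only [Matrix.cons_val] at f0 f1 f2 f3
    rw [Matrix.det_fin_two] at hN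
    have z1 : z 1 = 0 := mul_left_cancel₀ hN (by linear_combination N 1 1 * f1 - N 0 1 * f3)
    have z3 : z 3 = 0 := mul_left_cancel₀ hN (by linear_combination N 0 0 * f3 - N 1 0 * f1)
    rw [z1, z3] at f0 f2
    have z0 : z 0 = 0 := by
      have : z 0 * (p' 1 / g 2) = 0 :=
        mul_left_cancel₀ hxy (by linear_combination y 1 * f0 - y 0 * f2)
      exact (mul_eq_zero.1 this).resolve_right (div_ne_zero hp hg₂)
    have z2 : z 2 = 0 := by
      have : z 2 * (r' 1 / g 2) = 0 :=
        mul_left_cancel₀ hxy (by linear_combination x 0 * f2 - x 1 * f0)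
      exact (mul_eq_zero.1 this).resolve_right (div_ne_zero hr hg₂)
    intro i
    fin_cases i <;> assumption
  · rw [Matrix.det_mul]
    refine mul_ne_zero (fun h0 => hκ ?_) ha
    simp [T, Matrix.det_fin_two] at h0
    rw [hκdef]
    linear_combination -h0
  · rw [Matrix.det_mul]
    refine mul_ne_zero (fun h0 => ?_) hb
    simp [U, Matrix.det_fin_two] at h0
    have : g 2 * (g 1 / κ) = 0 := by linear_combination h0
    exact mul_ne_zero hg₂ (div_ne_zero hg₁ hκ) this
  · rw [hΦ, baseValue, ← mulVec_mulVec, ← mulVec_mulVec]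
    set t := a *ᵥ v 1
    set u := b *ᵥ v 2
    obtain ⟨s, hs⟩ : ∃ s, s = M *ᵥ v 0 := ⟨_, rfl⟩
    have hv : v 0 = N *ᵥ s := by rw [hs, mulVec_mulVec, hNM, one_mulVec]
    rw [← hs, hv]
    have hG : (U *ᵥ u) 0 * (T *ᵥ t) 1 - (T *ᵥ t) 0 * (U *ᵥ u) 1 = form3 g t u := by
      have : (g 0 - g 2 * (p' 0 / p' 1)) / κ * κ = g 0 - g 2 * (p' 0 / p' 1) :=
        div_mul_cancel₀ _ hκ
      have h' : g 1 / κ * κ = g 1 := div_mul_cancel₀ _ hκ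
      simp [U, T, mulVec, dotProduct, Fin.sum_univ_two, form3]
      rw [hκdef] at this h' ⊢
      linear_combination t 0 * u 0 * this + t 0 * u 1 * h'
    have hU : (U *ᵥ u) 0 - (U *ᵥ u) 1 = g 2 * u 0 := by
      simp [U, mulVec, dotProduct, Fin.sum_univ_two]; ring
    have hT0 : p' 1 * (T *ᵥ t) 0 = p' 0 * t 0 + p' 1 * t 1 := by
      simp [T, mulVec, dotProduct, Fin.sum_univ_two]; field_simp
    have hT1 : r' 1 * (T *ᵥ t) 1 = r' 0 * t 0 + r' 1 * t 1 := by
      simp [T, mulVec, dotProduct, Fin.sum_univ_two]; field_simp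
    rw [canon, hG, hU]
    have hs0 : (N *ᵥ s) 0 = N 0 0 * s 0 + N 0 1 * s 1 := by
      simp [mulVec, dotProduct, Fin.sum_univ_two]
    have hs1 : (N *ᵥ s) 1 = N 1 0 * s 0 + N 1 1 * s 1 := by
      simp [mulVec, dotProduct, Fin.sum_univ_two]
    rw [hs0, hs1]
    have k0 : s 0 * (T *ᵥ t) 0 * (g 2 * u 0) * (p' 1 / g 2) =
        s 0 * u 0 * (p' 0 * t 0 + p' 1 * t 1) := by
      rw [← hT0]; field_simp
    have k1 : s 1 * (T *ᵥ t) 1 * (g 2 * u 0) * (r' 1 / g 2) =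
        s 1 * u 0 * (r' 0 * t 0 + r' 1 * t 1) := by
      rw [← hT1]; field_simp
    rw [hc (p 0), hc (p 1), hc (r 0), hc (r 1)]
    ext i
    simp only [Matrix.cons_val, Pi.add_apply, Pi.smul_apply, smul_eq_mul, B₁, B₃]
    linear_combination
      (A 0 i * u 0) * (s 0 * (t 0 * e1 0 + t 1 * e1 1) + s 1 * (t 0 * e3 0 + t 1 * e3 1)) +
      (A 2 i * u 0) * (s 0 * (t 0 * e2 0 + t 1 * e2 1) + s 1 * (t 0 * e4 0 + t 1 * e4 1)) -
      (x 0 * A 0 i + x 1 * A 2 i) * k0 - (y 0 * A 0 i + y 1 * A 2 i) * k1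

end

/-! ### A family containing all maps of type `(1, 2, 2)` -/

section

open Matrix

lemma eq_add_of_det_eq_one {m m' : Fin 2 → ℂ} (h : m' 0 * m 1 - m' 1 * m 0 = 1) (t : Fin 2 → ℂ) :
    t = (t 0 * m 1 - t 1 * m 0) • m' + (m' 0 * t 1 - m' 1 * t 0) • m := by
  ext i
  revert i
  refine Fin.forall_fin_two.2 ⟨?_, ?_⟩
  · simp; linear_combination -t 0 * h
  · simp; linear_combination -t 1 * h

/-- Since all components of the map have a common base line, it belongs to the family
`baseValue`. -/
lemma exists_baseValue {Φ : Tuple} (hΦ : Φ ∈ birationalOfType ![1, 2, 2]) :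
    ∃ (A : Fin 4 → Fin 4 → ℂ) (a b : Matrix (Fin 2) (Fin 2) ℂ) (p r : Fin 2 → Fin 3 → ℂ)
      (g : Fin 3 → ℂ), ∀ v, Φ.value v = baseValue A a b p r g (v 0) (v 1) (v 2) := by
  obtain ⟨A, P, R, g, c, -, hB, hval⟩ := exists_baseData hΦ
  obtain ⟨m, n, hm, hn, hg, hPR⟩ := hB.exists_base
  obtain ⟨m', hm'⟩ := exists_det_eq_one hm
  obtain ⟨n', hn'⟩ := exists_det_eq_one hn
  let x : (Fin 2 → Fin 2 → ℂ) → Fin 3 → ℂ := fun q => ![bil q m' n', bil q m' n, bil q m n']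
  have hx : ∀ q, bil q m n = 0 → ∀ t u, bil q t u =
      form3 (x q) (!![m 1, -m 0; -m' 1, m' 0] *ᵥ t) (!![n 1, -n 0; -n' 1, n' 0] *ᵥ u) := by
    intro q hq t u
    conv_lhs => rw [eq_add_of_det_eq_one hm' t, eq_add_of_det_eq_one hn' u]
    simp [bil] at hq
    simp [form3, x, bil, mulVec, dotProduct, Fin.sum_univ_two]
    linear_combination (m' 0 * t 1 - m' 1 * t 0) * (n' 0 * u 1 - n' 1 * u 0) * hq
  have hcoord : ∀ a : Fin 2 → Fin 2 → Fin 2 → ℂ, (∀ s, tri a s m n = 0) → ∀ j, bil (a j) m n = 0 := by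
    intro a ha
    have h0 := ha ![1, 0]
    have h1 := ha ![0, 1]
    simp [tri_eq_sum] at h0 h1
    exact Fin.forall_fin_two.2 ⟨h0, h1⟩
  have hP := hcoord P fun s => (hPR s).1
  have hR := hcoord R fun s => (hPR s).2
  refine ⟨A, !![m 1, -m 0; -m' 1, m' 0], !![n 1, -n 0; -n' 1, n' 0], fun j => x (P j), fun j => x (R j), x g, fun v => ?_⟩
  have hv : ![v 0, v 1, v 2] = v := by ext m; fin_cases m <;> rfl
  rw [baseValue, ← hx _ (hP 0), ← hx _ (hP 1), ← hx _ (hR 0), ← hx _ (hR 1), ← hx _ hg, ← hv, hval,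
    tri_eq_sum, tri_eq_sum]
  rfl

end

section

variable {K L : Type*} [CommRing K] [CommRing L]

/-- The coefficient of `t_k u_l` in the bilinear form `form3 x (a t) (b u)`. -/
def form3Coeff (a b : Fin 2 → Fin 2 → K) (x : Fin 3 → K) (k l : Fin 2) : K :=
  x 0 * (a 0 k * b 0 l) + x 1 * (a 0 k * b 1 l) + x 2 * (a 1 k * b 0 l)

/-- The coefficients of the trilinear map `baseValue`, over any ring. -/
def baseCoeff (A : Fin 4 → Fin 4 → K) (a b : Fin 2 → Fin 2 → K) (p r : Fin 2 → Fin 3 → K)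
    (g : Fin 3 → K) : Fin 4 × Fin 2 × Fin 2 × Fin 2 → K := fun x =>
  form3Coeff a b (p x.2.1) x.2.2.1 x.2.2.2 * A 0 x.1 +
    (![1, 0] : Fin 2 → K) x.2.1 * form3Coeff a b g x.2.2.1 x.2.2.2 * A 1 x.1 +
    form3Coeff a b (r x.2.1) x.2.2.1 x.2.2.2 * A 2 x.1 +
    (![0, 1] : Fin 2 → K) x.2.1 * form3Coeff a b g x.2.2.1 x.2.2.2 * A 3 x.1

lemma map_baseCoeff (f : K →+* L) (A : Fin 4 → Fin 4 → K) (a b : Fin 2 → Fin 2 → K)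
    (p r : Fin 2 → Fin 3 → K) (g : Fin 3 → K) (x : Fin 4 × Fin 2 × Fin 2 × Fin 2) :
    f (baseCoeff A a b p r g x) = baseCoeff (fun i j => f (A i j)) (fun i j => f (a i j))
      (fun i j => f (b i j)) (fun i j => f (p i j)) (fun i j => f (r i j)) (fun i => f (g i)) x := by
  obtain ⟨i, j, k, l⟩ := x
  fin_cases j <;> simp [baseCoeff, form3Coeff]

/-- The `4 × 4` determinant of the values of the trilinear map at four integral points. -/
def minor (Φ : Fin 4 × Fin 2 × Fin 2 × Fin 2 → K) (s t u : Fin 4 → Fin 2 → ℤ) : K :=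
  Matrix.det (Matrix.of fun n i : Fin 4 => ∑ j, ∑ k, ∑ l,
    Φ (i, j, k, l) * ((s n j * t n k * u n l : ℤ) : K))

lemma map_minor (f : K →+* L) (Φ : Fin 4 × Fin 2 × Fin 2 × Fin 2 → K) (s t u : Fin 4 → Fin 2 → ℤ) :
    f (minor Φ s t u) = minor (fun x => f (Φ x)) s t u := by
  rw [minor, minor, RingHom.map_det]
  congr 1
  ext n i
  simp

/-- The determinant of the values at `((1, x), E₀₀)`, `((1, x), E₀₁)`, `((1, x), E₁₀)` and
`((0, 1), E_{kl})`, where the trilinear map is viewed as a bilinear map in `s` and in `2 × 2` matrices.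
For `(P, s₀ g, R, s₁ g)` it is, up to a constant, the product of `g_{kl}` and of the value at `(1, x)`
of the binary quadratic form that vanishes where `P(s)`, `g`, `R(s)` are linearly dependent. -/
def minorG (Φ : Fin 4 × Fin 2 × Fin 2 × Fin 2 → K) (x : ℤ) (k l : Fin 2) : K :=
  minor Φ ![![1, x], ![1, x], ![1, x], ![0, 1]] ![![1, 0], ![1, 0], ![0, 1], Pi.single k 1]
    ![![1, 0], ![0, 1], ![1, 0], Pi.single l 1]

/-- The determinant of the values at the four points `(eᵢ, t, eⱼ)`, a binary quartic in `t`. The base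
point is a double root of it; `isGeneralForm_of_baseValue` requires that it is not a triple root. -/
def minorT (Φ : Fin 4 × Fin 2 × Fin 2 × Fin 2 → K) (t : Fin 2 → ℤ) : K :=
  minor Φ ![![1, 0], ![0, 1], ![1, 0], ![0, 1]] ![t, t, t, t] ![![1, 0], ![1, 0], ![0, 1], ![0, 1]]

/-- The discriminant in `x` of `minorG Φ x 1 0`. -/
def discS (Φ : Fin 4 × Fin 2 × Fin 2 × Fin 2 → K) : K :=
  (minorG Φ 1 1 0 - minorG Φ (-1) 1 0) ^ 2 -
    8 * minorG Φ 0 1 0 * (minorG Φ 1 1 0 + minorG Φ (-1) 1 0 - 2 * minorG Φ 0 1 0)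

/-- For `(P, s₀ g, R, s₁ g)` this is, up to a constant, the determinant of `g`. -/
def detG (Φ : Fin 4 × Fin 2 × Fin 2 × Fin 2 → K) : K :=
  minorG Φ 1 0 0 * minorG Φ 1 1 1 - minorG Φ 1 0 1 * minorG Φ 1 1 0

/-- The invariant of degree two (up to a factor) of the binary quartic with values `f₀`, `f₁`, `f₂`,
`f₃`, `e` at `(1, 0)`, `(1, 1)`, `(1, -1)`, `(1, 2)`, `(0, 1)`. It vanishes if there is a triple
root. -/
def quarticInvariant (f₀ f₁ f₂ f₃ e : K) : K :=
  144 * f₀ * e - (3 * (f₁ - f₂) - (f₃ - f₀ - 2 * (f₁ + f₂ - 2 * f₀ - 2 * e) - 16 * e - (f₁ - f₂))) *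
    (f₃ - f₀ - 2 * (f₁ + f₂ - 2 * f₀ - 2 * e) - 16 * e - (f₁ - f₂)) +
    3 * (f₁ + f₂ - 2 * f₀ - 2 * e) ^ 2

/-- The invariant of degree two of the binary quartic `minorT Φ`. -/
def invT (Φ : Fin 4 × Fin 2 × Fin 2 × Fin 2 → K) : K :=
  quarticInvariant (minorT Φ ![1, 0]) (minorT Φ ![1, 1]) (minorT Φ ![1, -1]) (minorT Φ ![1, 2])
    (minorT Φ ![0, 1])

/-- The product of the polynomials in the coefficients whose non-vanishing ensures that a trilinear
birational map of type `(1, 2, 2)` is general. -/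
def genericity (Φ : Fin 4 × Fin 2 × Fin 2 × Fin 2 → K) : K := discS Φ * detG Φ * invT Φ

lemma map_genericity (f : K →+* L) (Φ : Fin 4 × Fin 2 × Fin 2 × Fin 2 → K) :
    f (genericity Φ) = genericity fun x => f (Φ x) := by
  simp only [genericity, discS, detG, invT, quarticInvariant, minorG, minorT, map_mul, map_add,
    map_sub, map_pow, map_minor, map_ofNat]

end

section

open Matrix

variable {Φ : Tuple} {A : Fin 4 → Fin 4 → ℂ} {a b : Matrix (Fin 2) (Fin 2) ℂ}
  {p r : Fin 2 → Fin 3 → ℂ} {g : Fin 3 → ℂ}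

lemma form3_mulVec (x : Fin 3 → ℂ) (t u : Fin 2 → ℂ) :
    form3 x (a *ᵥ t) (b *ᵥ u) = ∑ k, ∑ l, form3Coeff a b x k l * (t k * u l) := by
  simp [form3, form3Coeff, mulVec, dotProduct, Fin.sum_univ_two]; ring

lemma value_baseCoeff (v : Fin 3 → Fin 2 → ℂ) :
    Tuple.value (baseCoeff A a b p r g) v = baseValue A a b p r g (v 0) (v 1) (v 2) := by
  ext i
  simp only [Tuple.value, baseValue, baseCoeff, form3_mulVec, Fin.sum_univ_two, Pi.add_apply,
    Pi.smul_apply, smul_eq_mul, Matrix.cons_val_zero, Matrix.cons_val_one]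
  ring

lemma Tuple.ext_value {Ψ : Tuple} (h : ∀ v, Φ.value v = Ψ.value v) : Φ = Ψ := by
  ext ⟨i, j, k, l⟩
  have := congrFun (h ![Pi.single j 1, Pi.single k 1, Pi.single l 1]) i
  simpa [Tuple.value, Pi.single_apply] using this

lemma minor_eq (Φ : Tuple) (s t u : Fin 4 → Fin 2 → ℤ) :
    minor Φ s t u = Matrix.det (Matrix.of fun n => Φ.value
      ![fun j => (s n j : ℂ), fun j => (t n j : ℂ), fun j => (u n j : ℂ)]) := by
  rw [minor]
  congr 1
  ext n i
  simp [Tuple.value]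

lemma minor_baseCoeff (s t u : Fin 4 → Fin 2 → ℤ) :
    minor (baseCoeff A a b p r g) s t u = Matrix.det (Matrix.of fun n : Fin 4 =>
      (![(s n 0 : ℂ) * form3 (p 0) (a *ᵥ fun j => (t n j : ℂ)) (b *ᵥ fun j => (u n j : ℂ)) +
          (s n 1 : ℂ) * form3 (p 1) (a *ᵥ fun j => (t n j : ℂ)) (b *ᵥ fun j => (u n j : ℂ)),
        (s n 0 : ℂ) * form3 g (a *ᵥ fun j => (t n j : ℂ)) (b *ᵥ fun j => (u n j : ℂ)),
        (s n 0 : ℂ) * form3 (r 0) (a *ᵥ fun j => (t n j : ℂ)) (b *ᵥ fun j => (u n j : ℂ)) +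
          (s n 1 : ℂ) * form3 (r 1) (a *ᵥ fun j => (t n j : ℂ)) (b *ᵥ fun j => (u n j : ℂ)),
        (s n 1 : ℂ) * form3 g (a *ᵥ fun j => (t n j : ℂ)) (b *ᵥ fun j => (u n j : ℂ))] :
          Fin 4 → ℂ)) * Matrix.det (Matrix.of A) := by
  rw [minor_eq, ← Matrix.det_mul]
  congr 1
  ext n i
  rw [Matrix.of_apply, value_baseCoeff, Matrix.mul_apply, Fin.sum_univ_four]
  simp [baseValue]

/-- The coefficients with indices `00`, `01`, `10` of `form3 x (a t) (b u)` depend linearly on `x`;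
`δ` is the determinant of this linear map. -/
lemma exists_vol3_form3Coeff (a b : Matrix (Fin 2) (Fin 2) ℂ) : ∃ δ : ℂ, (a = 1 → b = 1 → δ = 1) ∧
    ∀ x y z, vol3 ![form3Coeff a b x 0 0, form3Coeff a b x 0 1, form3Coeff a b x 1 0]
      ![form3Coeff a b y 0 0, form3Coeff a b y 0 1, form3Coeff a b y 1 0]
      ![form3Coeff a b z 0 0, form3Coeff a b z 0 1, form3Coeff a b z 1 0] = δ * vol3 x y z := by
  refine ⟨vol3 ![a 0 0 * b 0 0, a 0 0 * b 0 1, a 0 1 * b 0 0]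
    ![a 0 0 * b 1 0, a 0 0 * b 1 1, a 0 1 * b 1 0] ![a 1 0 * b 0 0, a 1 0 * b 0 1, a 1 1 * b 0 0],
    ?_, ?_⟩
  · rintro rfl rfl
    simp [vol3]
  · intro x y z
    simp only [vol3, form3Coeff, Matrix.cons_val]
    ring

lemma det_of_eq_det4 (f : Fin 4 → Fin 4 → ℂ) :
    (Matrix.of f).det = det4 (f 0) (f 1) (f 2) (f 3) := by
  rw [det4]
  congr 1
  ext n i
  fin_cases n <;> rfl

lemma minorG_baseCoeff {δ : ℂ}
    (hδ : ∀ x y z, vol3 ![form3Coeff a b x 0 0, form3Coeff a b x 0 1, form3Coeff a b x 1 0]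
      ![form3Coeff a b y 0 0, form3Coeff a b y 0 1, form3Coeff a b y 1 0]
      ![form3Coeff a b z 0 0, form3Coeff a b z 0 1, form3Coeff a b z 1 0] = δ * vol3 x y z)
    (x : ℤ) (k l : Fin 2) : minorG (baseCoeff A a b p r g) x k l =
      Matrix.det (Matrix.of A) * δ * vol3 (p 0 + (x : ℂ) • p 1) g (r 0 + (x : ℂ) • r 1) *
        form3Coeff a b g k l := by
  rw [mul_assoc (Matrix.det _), ← hδ, minorG, minor_baseCoeff, mul_comm _ (Matrix.det _), mul_assoc]
  congr 1
  have hlin : ∀ (y z : Fin 3 → ℂ) k l, form3Coeff a b (y + (x : ℂ) • z) k l =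
      form3Coeff a b y k l + x * form3Coeff a b z k l := fun y z k l => by
    simp [form3Coeff]; ring
  have hsingle : ∀ (y : Fin 3 → ℂ) (k l : Fin 2),
      form3 y (a *ᵥ fun j => ((Pi.single k 1 : Fin 2 → ℤ) j : ℂ))
        (b *ᵥ fun j => ((Pi.single l 1 : Fin 2 → ℤ) j : ℂ)) = form3Coeff a b y k l := fun y k l => by
    rw [form3_mulVec]
    simp [Pi.single_apply]
  have h0 : (![1, 0] : Fin 2 → ℤ) = Pi.single 0 1 := by ext i; fin_cases i <;> rfl
  have h1 : (![0, 1] : Fin 2 → ℤ) = Pi.single 1 1 := by ext i; fin_cases i <;> rfl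
  have e00 := fun y => hsingle y 0 0
  have e01 := fun y => hsingle y 0 1
  have e10 := fun y => hsingle y 1 0
  rw [← h0] at e00
  rw [← h0, ← h1] at e01 e10
  rw [det_of_eq_det4, det4_eq]
  simp only [Matrix.cons_val, e00, e01, e10, hsingle, hlin, vol3]
  push_cast
  ring

lemma minorT_baseCoeff (t : Fin 2 → ℤ) : ∃ τ : Fin 2 → ℂ, τ = (a *ᵥ fun j => (t j : ℂ)) ∧
    minorT (baseCoeff A a b p r g) t =
      -Matrix.det (Matrix.of A) * b.det ^ 2 * τ 0 ^ 2 *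
      ((τ 0 * (p 0 0 * g 1 - p 0 1 * g 0) + τ 1 * elim g (p 0)) *
        (τ 0 * (r 1 0 * g 1 - r 1 1 * g 0) + τ 1 * elim g (r 1)) -
      (τ 0 * (p 1 0 * g 1 - p 1 1 * g 0) + τ 1 * elim g (p 1)) *
        (τ 0 * (r 0 0 * g 1 - r 0 1 * g 0) + τ 1 * elim g (r 0))) := by
  refine ⟨_, rfl, ?_⟩
  set τ := a *ᵥ fun j => (t j : ℂ)
  rw [minorT, minor_baseCoeff, det_of_eq_det4, det4_eq, mul_comm _ (Matrix.det _), neg_mul,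
    neg_mul, neg_mul, mul_assoc, mul_assoc, ← mul_neg]
  congr 1
  have h0 : (b *ᵥ fun j => ((![1, 0] : Fin 2 → ℤ) j : ℂ)) = fun i => b i 0 := by
    ext i; simp [mulVec, dotProduct, Fin.sum_univ_two]
  have h1 : (b *ᵥ fun j => ((![0, 1] : Fin 2 → ℤ) j : ℂ)) = fun i => b i 1 := by
    ext i; simp [mulVec, dotProduct, Fin.sum_univ_two]
  simp only [Matrix.cons_val, h0, h1, form3, Matrix.det_fin_two, elim]
  push_cast
  ring

lemma quarticInvariant_eq_zero (κ x y z w : ℂ) {f : ℂ → ℂ → ℂ}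
    (hf : ∀ t u, f t u = κ * (x * t + y * u) ^ 3 * (z * t + w * u)) :
    quarticInvariant (f 1 0) (f 1 1) (f 1 (-1)) (f 1 2) (f 0 1) = 0 := by
  simp only [quarticInvariant, hf]
  ring

/-- A map of the family with nonvanishing `genericity` has the normal form. -/
theorem isGeneralForm_of_genericity (hΦ : ∀ v, Φ.value v = baseValue A a b p r g (v 0) (v 1) (v 2))
    (h : genericity Φ ≠ 0) : IsGeneralForm Φ := by
  have hbase : Φ = baseCoeff A a b p r g :=
    Tuple.ext_value fun v => by rw [hΦ, value_baseCoeff]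
  obtain ⟨δ, -, hδ⟩ := exists_vol3_form3Coeff a b
  have hG := minorG_baseCoeff (A := A) (p := p) (r := r) (g := g) hδ
  rw [← hbase] at hG
  have hS : discS Φ ≠ 0 := left_ne_zero_of_mul (left_ne_zero_of_mul h)
  have hD : detG Φ ≠ 0 := right_ne_zero_of_mul (left_ne_zero_of_mul h)
  have hT : invT Φ ≠ 0 := right_ne_zero_of_mul h
  rw [discS, hG, hG, hG] at hS
  rw [detG, hG, hG, hG, hG] at hD
  have hA : (Matrix.of A).det ≠ 0 := by
    intro h0
    apply hS
    rw [h0]; ring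
  have hdet : a.det * b.det * (g 1 * g 2) ≠ 0 := by
    intro h0
    apply hD
    simp only [form3Coeff]
    rw [Matrix.det_fin_two, Matrix.det_fin_two] at h0
    set V := vol3 (p 0 + ((1 : ℤ) : ℂ) • p 1) g (r 0 + ((1 : ℤ) : ℂ) • r 1)
    linear_combination -((Matrix.of A).det * δ * V) ^ 2 * h0
  refine isGeneralForm_of_baseValue hΦ
    (Matrix.linearIndependent_rows_iff_isUnit.2 ((Matrix.isUnit_iff_isUnit_det _).2
      (isUnit_iff_ne_zero.2 hA)))
    (left_ne_zero_of_mul (left_ne_zero_of_mul hdet))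
    (right_ne_zero_of_mul (left_ne_zero_of_mul hdet))
    (left_ne_zero_of_mul (right_ne_zero_of_mul hdet))
    (right_ne_zero_of_mul (right_ne_zero_of_mul hdet)) (fun h0 => hS ?_) fun h0 => hT ?_
  · simp only [vol3, Pi.add_apply, Pi.smul_apply, smul_eq_mul] at h0 ⊢
    push_cast
    linear_combination 4 * ((Matrix.of A).det * δ * form3Coeff a b g 1 0) ^ 2 * h0
  · -- `minorT` has the triple root `a t = (0 : 1)`
    set κ := -(Matrix.of A).det * b.det ^ 2
    set e : (Fin 3 → ℂ) → ℂ := fun x => x 0 * g 1 - x 1 * g 0 with he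
    set y := e (p 0) * e (r 1) - e (p 1) * e (r 0)
    set z := e (p 0) * elim g (r 1) + elim g (p 0) * e (r 1) - e (p 1) * elim g (r 0) -
      elim g (p 1) * e (r 0)
    have hQ : ∀ t : Fin 2 → ℤ, minorT Φ t = κ * (a 0 0 * t 0 + a 0 1 * t 1) ^ 3 *
        ((a 0 0 * y + a 1 0 * z) * t 0 + (a 0 1 * y + a 1 1 * z) * t 1) := by
      intro t
      obtain ⟨τ, hτ, hQ⟩ := minorT_baseCoeff (A := A) (a := a) (b := b) (p := p) (r := r) (g := g) t
      have h0' : τ 0 = a 0 0 * t 0 + a 0 1 * t 1 := by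
        rw [hτ]; simp [mulVec, dotProduct, Fin.sum_univ_two]
      have h1' : τ 1 = a 1 0 * t 0 + a 1 1 * t 1 := by
        rw [hτ]; simp [mulVec, dotProduct, Fin.sum_univ_two]
      rw [hbase, hQ, ← h0']
      have : (a 0 0 * y + a 1 0 * z) * t 0 + (a 0 1 * y + a 1 1 * z) * t 1 = τ 0 * y + τ 1 * z := by
        rw [h0', h1']; ring
      rw [this]
      simp only [y, z, he, κ]
      linear_combination -(Matrix.of A).det * b.det ^ 2 * τ 0 ^ 2 * τ 1 ^ 2 * h0
    have := quarticInvariant_eq_zero κ (a 0 0) (a 0 1) (a 0 0 * y + a 1 0 * z)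
      (a 0 1 * y + a 1 1 * z) (f := fun t u => κ * (a 0 0 * t + a 0 1 * u) ^ 3 *
        ((a 0 0 * y + a 1 0 * z) * t + (a 0 1 * y + a 1 1 * z) * u)) fun t u => rfl
    rw [invT, hQ, hQ, hQ, hQ, hQ]
    simpa using this

/-- A map of the family with nonvanishing `genericity`. -/
lemma genericity_ne_zero : genericity (baseCoeff (K := ℂ) (1 : Matrix (Fin 4) (Fin 4) ℂ)
    (1 : Matrix (Fin 2) (Fin 2) ℂ) (1 : Matrix (Fin 2) (Fin 2) ℂ) ![![0, 0, -1], 0]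
    ![0, ![-1, 0, -1]] ![0, 1, -1]) ≠ 0 := by
  set Φ : Tuple := baseCoeff (K := ℂ) (1 : Matrix (Fin 4) (Fin 4) ℂ)
    (1 : Matrix (Fin 2) (Fin 2) ℂ) (1 : Matrix (Fin 2) (Fin 2) ℂ) ![![0, 0, -1], 0]
    ![0, ![-1, 0, -1]] ![0, 1, -1] with hΦ
  obtain ⟨δ, hδ1, hδ⟩ := exists_vol3_form3Coeff 1 1
  have hdet : (Matrix.of (1 : Matrix (Fin 4) (Fin 4) ℂ)).det = 1 := Matrix.det_one
  have hG : ∀ (x : ℤ) k l, minorG Φ x k l = -x * form3Coeff (1 : Matrix (Fin 2) (Fin 2) ℂ)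
      (1 : Matrix (Fin 2) (Fin 2) ℂ) ![0, 1, -1] k l := by
    intro x k l
    refine (minorG_baseCoeff (A := (1 : Matrix (Fin 4) (Fin 4) ℂ)) (p := ![![0, 0, -1], 0])
      (r := ![0, ![-1, 0, -1]]) (g := ![0, 1, -1]) hδ x k l).trans ?_
    rw [hδ1 rfl rfl, hdet]
    simp [vol3]
  have hT : ∀ t : Fin 2 → ℤ, minorT Φ t = -(t 0 : ℂ) ^ 2 * ((t 1) * (t 0 + t 1)) := by
    intro t
    obtain ⟨τ, hτ, h⟩ := minorT_baseCoeff (A := (1 : Matrix (Fin 4) (Fin 4) ℂ)) (a := 1) (b := 1)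
      (p := ![![0, 0, -1], 0]) (r := ![0, ![-1, 0, -1]]) (g := ![0, 1, -1]) t
    rw [one_mulVec] at hτ
    rw [hΦ, h, hdet, hτ]
    simp [elim]
    ring
  refine mul_ne_zero (mul_ne_zero ?_ ?_) ?_
  · rw [discS, hG, hG, hG]
    simp [form3Coeff]
  · rw [detG, hG, hG, hG, hG]
    simp [form3Coeff]
  · rw [invT, hT, hT, hT, hT, hT, quarticInvariant]
    simp
    norm_num

end

/-! ### Density of the general maps -/

/-- The polynomial of degree one with the values `x` at `0` and `y` at `1`. -/
def linePoly (x y : ℂ) : Polynomial ℂ := Polynomial.C x + Polynomial.X * Polynomial.C (y - x)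

@[simp] lemma eval_zero_linePoly (x y : ℂ) : (linePoly x y).eval 0 = x := by simp [linePoly]

@[simp] lemma eval_one_linePoly (x y : ℂ) : (linePoly x y).eval 1 = y := by simp [linePoly]

lemma isGeneralForm_of_mem {Φ : Tuple} (hΦ : Φ ∈ birationalOfType ![1, 2, 2])
    (h : genericity Φ ≠ 0) : IsGeneralForm Φ := by
  obtain ⟨A, a, b, p, r, g, hv⟩ := exists_baseValue hΦ
  exact isGeneralForm_of_genericity hv h

/-- Every map of type `(1, 2, 2)` is joined by a line in the parameters of the family `baseCoeff`
to a general one, and all but finitely many points on this line give general maps. -/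
lemma eval_eq_zero_of_general {q : MvPolynomial (Fin 4 × Fin 2 × Fin 2 × Fin 2) ℂ}
    (hq : ∀ Φ : Tuple, IsGeneralForm Φ → genericity Φ ≠ 0 → eval Φ q = 0) {Φ : Tuple}
    (hΦ : Φ ∈ birationalOfType ![1, 2, 2]) : eval Φ q = 0 := by
  obtain ⟨A, a, b, p, r, g, hv⟩ := exists_baseValue hΦ
  let Ψ : Fin 4 × Fin 2 × Fin 2 × Fin 2 → Polynomial ℂ :=
    baseCoeff (fun i j => linePoly (A i j) ((1 : Matrix (Fin 4) (Fin 4) ℂ) i j))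
      (fun i j => linePoly (a i j) ((1 : Matrix (Fin 2) (Fin 2) ℂ) i j))
      (fun i j => linePoly (b i j) ((1 : Matrix (Fin 2) (Fin 2) ℂ) i j))
      (fun i j => linePoly (p i j) ((![![0, 0, -1], 0] : Fin 2 → Fin 3 → ℂ) i j))
      (fun i j => linePoly (r i j) ((![0, ![-1, 0, -1]] : Fin 2 → Fin 3 → ℂ) i j))
      (fun i => linePoly (g i) ((![0, 1, -1] : Fin 3 → ℂ) i))
  have hΨ : ∀ (ε : ℂ), (fun x => (Ψ x).eval ε) = baseCoeff
      (fun i j => (linePoly (A i j) ((1 : Matrix (Fin 4) (Fin 4) ℂ) i j)).eval ε)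
      (fun i j => (linePoly (a i j) ((1 : Matrix (Fin 2) (Fin 2) ℂ) i j)).eval ε)
      (fun i j => (linePoly (b i j) ((1 : Matrix (Fin 2) (Fin 2) ℂ) i j)).eval ε)
      (fun i j => (linePoly (p i j) ((![![0, 0, -1], 0] : Fin 2 → Fin 3 → ℂ) i j)).eval ε)
      (fun i j => (linePoly (r i j) ((![0, ![-1, 0, -1]] : Fin 2 → Fin 3 → ℂ) i j)).eval ε)
      (fun i => (linePoly (g i) ((![0, 1, -1] : Fin 3 → ℂ) i)).eval ε) := fun ε =>
    funext fun x => map_baseCoeff (Polynomial.evalRingHom ε) _ _ _ _ _ _ x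
  have hq' : ∀ ε, (aeval Ψ q : Polynomial ℂ).eval ε = eval (fun x => (Ψ x).eval ε) q := by
    intro ε
    have : ((Polynomial.aeval ε).comp (aeval Ψ) :
        MvPolynomial (Fin 4 × Fin 2 × Fin 2 × Fin 2) ℂ →ₐ[ℂ] ℂ) =
        aeval (fun x => (Ψ x).eval ε) := by
      ext x
      simp
    exact DFunLike.congr_fun this q
  have hgen : ∀ ε, (genericity Ψ).eval ε = genericity fun x => (Ψ x).eval ε := fun ε =>
    map_genericity (Polynomial.evalRingHom ε) Ψ
  have hmul : aeval Ψ q * genericity Ψ = 0 := by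
    refine Polynomial.funext fun ε => ?_
    rw [Polynomial.eval_mul, Polynomial.eval_zero, hq', hgen]
    by_cases h0 : genericity (fun x => (Ψ x).eval ε) = 0
    · rw [h0, mul_zero]
    · rw [hq _ (isGeneralForm_of_genericity (fun v => by rw [hΨ]; exact value_baseCoeff v) h0) h0,
        zero_mul]
  have hne : genericity Ψ ≠ 0 := by
    intro h0
    apply genericity_ne_zero
    have := hgen 1
    rw [h0, Polynomial.eval_zero, hΨ] at this
    simp only [eval_one_linePoly] at this
    exact this.symm
  have h0 := hq' 0
  rw [(mul_eq_zero.1 hmul).resolve_right hne, Polynomial.eval_zero, hΨ] at h0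
  simp only [eval_zero_linePoly] at h0
  have hbase : Φ = baseCoeff A a b p r g :=
    Tuple.ext_value fun v => by rw [hv, value_baseCoeff]
  rw [hbase]
  exact h0.symm

end TrilinearLC

end

theorem propositionC :
    TrilinearLC.HoldsForGeneral (TrilinearLC.birationalOfType ![1, 2, 2])
      (fun Φ : TrilinearLC.Tuple =>
        (∃ a b c x y : TrilinearLC.Line,
          TrilinearLC.FocalConfiguration Φ a b c x y ∧
          ∀ a' b' c' x' y' : TrilinearLC.Line,
            TrilinearLC.FocalConfiguration Φ a' b' c' x' y' →
              a' = a ∧ b' = b ∧ c' = c ∧ ((x' = x ∧ y' = y) ∨ (x' = y ∧ y' = x))) ∧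
        (∀ m : Fin 3, TrilinearLC.IsLinearCongruence (TrilinearLC.Tuple.congruence Φ m))) := by
  have hq : ∀ Φ : TrilinearLC.Tuple, MvPolynomial.eval Φ
      (TrilinearLC.genericity (K := MvPolynomial _ ℂ) MvPolynomial.X) =
        TrilinearLC.genericity Φ := fun Φ => by
    rw [TrilinearLC.map_genericity]
    simp only [MvPolynomial.eval_X]
  have hmem : ∀ Φ : TrilinearLC.Tuple, TrilinearLC.genericity Φ ≠ 0 →
      TrilinearLC.IsGeneralForm Φ → Φ ∈ {y ∈ TrilinearLC.birationalOfType ![1, 2, 2] |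
        ∃ q ∈ ({TrilinearLC.genericity (K := MvPolynomial _ ℂ) MvPolynomial.X} :
          Set (MvPolynomial _ ℂ)), MvPolynomial.eval y q ≠ 0} := fun Φ h hΦ =>
    ⟨hΦ.mem_birationalOfType, _, rfl, by rwa [hq]⟩
  refine ⟨{TrilinearLC.genericity (K := MvPolynomial _ ℂ) MvPolynomial.X}, _, rfl,
    ⟨_, hmem _ TrilinearLC.genericity_ne_zero (TrilinearLC.isGeneralForm_of_genericity
      (fun v => TrilinearLC.value_baseCoeff v) TrilinearLC.genericity_ne_zero)⟩,
    fun q h y hy => TrilinearLC.eval_eq_zero_of_general (fun Φ hΦ hne => h Φ (hmem Φ hne hΦ)) hy, ?_⟩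
  rintro Φ ⟨hΦ, q, rfl, hne⟩
  rw [hq] at hne
  have hgen := TrilinearLC.isGeneralForm_of_mem hΦ hne
  obtain ⟨a, b, c, x, y, h⟩ := hgen.exists_focalConfiguration
  exact ⟨⟨a, b, c, x, y, h, fun a' b' c' x' y' h' => h.unique h'⟩, hgen.isLinearCongruence⟩
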